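/- **Setting.** Let $\gamma:S^2\to(0,\infty)$ be of class $C^3$, let $\tilde\gamma$ be its positive, degree one homogeneous extension to $\mathbb R^3$. Let $\Sigma\subset\mathbb R^3$ be a closed (compact, without boundary) embedded oriented piecewise smooth surface: $\Sigma$ is a compact topological surface which is the disjoint union of finitely many faces $\Sigma_1,\dots,\Sigma_N$ (embedded smooth surfaces, open in $\Sigma$), finitely many pairwise disjoint open edges $\Gamma_1,\dots,\Gamma_L$, and the finite set of end points (vertices) of the edges. Each edge is an embedded regular $C^1$ arc, $C^1$ and regular up to its end points, which may coincide. Each face together with its boundary is a smooth surface with piecewise smooth boundary: near a point of an open edge it is a smooth half disc bounded by the edge, and near a vertex it lies in a smooth surface. Along each open edge exactly two different faces meet. Each face carries a unit normal $\nu$, continuous up to its boundary, and the orientations are coherent: the two adjacent faces induce opposite orientations on their common edge. On $\Sigma_j$ the Cahn–Hoffman field is $\xi=\nabla\tilde\gamma(\nu)$, which extends continuously to the closure of $\Sigma_j$, and the anisotropic mean curvature is $\Lambda=-\operatorname{div}_{\Sigma}\xi$. For a piecewise smooth immersion $X:\Sigma\to\mathbb R^3$ with induced normal $\nu_X$ and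 area element $d\Sigma_X$, put $$\mathcal F[X]=\int_{\Sigma}\gamma(\nu_X)\,d\Sigma_X,\qquad V[X]=\frac13\int_{\Sigma}X\cdot\nu_X\,d\Sigma_X .$$ $\Sigma$ is *in equilibrium* for the volume-constrained energy if $\frac{d}{d\varepsilon}\big|_{\varepsilon=0}\mathcal F[X_\varepsilon]$ exists and equals $0$ for every family of piecewise smooth immersions $X_\varepsilon:\Sigma\to\mathbb R^3$, $|\varepsilon|<\delta$, which is smooth in $(\varepsilon,p)$ on each closed face and satisfies $X_0=\mathrm{id}$ and $V[X_\varepsilon]=V[X_0]$ for all $|\varepsilon|<\delta$. **Proposition.** $\Sigma$ is in equilibrium for the volume-constrained energy if and only if both of the following hold: (i) there is one constant $c$ with $\Lambda\equiv c$ on $\bigcup_j\Sigma_j$; (ii) along each edge $\Gamma_i$, $(\xi_1-\xi_2)\times\Gamma_i'\equiv0$, where $\xi_1,\xi_2$ are the limits of $\xi$ from the two faces adjacent to $\Gamma_i$, and $\Gamma_i'$ is the tangent of the edge. Moreover, (ii) holds whenever $\xi$ (defined on $\bigcup_j\Sigma_j$) extends to a continuous map on all of $\Sigma$. -/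

import Mathlib

open Set MeasureTheory
open scoped Topology ContDiff Manifold RealInnerProductSpace EuclideanSpace

noncomputable section

namespace AnisotropicSurface

/-- Euclidean three-space. -/
abbrev E3 : Type := EuclideanSpace ℝ (Fin 3)

/-- The unit sphere `S²` of three-space. -/
abbrev S2 : Type := Metric.sphere (0 : E3) 1

/-- The vector product of three-space. -/
def cross (u v : E3) : E3 := WithLp.toLp 2 (crossProduct (WithLp.ofLp u) (WithLp.ofLp v))

/-- The radial projection `x / ‖x‖` of a non-zero vector to the unit sphere. -/
def direction (x : E3) (hx : x ≠ 0) : S2 :=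
  ⟨‖x‖⁻¹ • x, by
    rw [mem_sphere_zero_iff_norm, norm_smul, norm_inv, norm_norm,
      inv_mul_cancel₀ (norm_ne_zero_iff.mpr hx)]⟩

open Classical in
/-- The positive, degree one homogeneous extension of `γ : S² → ℝ` to three-space. -/
def homExt (γ : S2 → ℝ) (x : E3) : ℝ :=
  if hx : x = 0 then 0 else ‖x‖ * γ (direction x hx)

/-- A smooth local change of coordinates of three-space (smooth with smooth inverse, between open
sets). -/
structure IsSmoothChart (Φ : OpenPartialHomeomorph E3 E3) : Prop where
  smooth : ContDiffOn ℝ ∞ Φ Φ.source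
  smooth_symm : ContDiffOn ℝ ∞ Φ.symm Φ.target

/-- A closed, embedded, oriented, piecewise smooth surface in three-space.

The surface is a compact topological surface (without boundary), the disjoint union of finitely
many faces, finitely many open edges and the end points of the edges (the vertices).
* A face is an embedded smooth surface, open in the whole surface.
* An edge is a regular `C¹` arc, parametrized by `[0, 1]`; the open edges are embedded and pairwise
  disjoint, and edges may share end points only.  The two end points of an edge may coincide, so a
  closed edge is included.
* Each face together with its boundary is a smooth surface with piecewise smooth boundary: at a
  point of an open edge it is, in smooth coordinates of the ambient space, a half plane bounded by
  the edge, and at a vertex it is contained in a smooth surface defined around the vertex.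
* Along each open edge exactly two faces meet.  They are called `left` and `right`.

The orientation is given by a unit normal on each face, continuous up to the boundary of the face.
The orientations of the faces fit together: at an edge, the vector `ν × Γ'` points into the left
face, and `-ν × Γ'` into the right face, `ν` being the normal of the respective face, so that
the edge gets opposite boundary orientations from its two sides. -/
structure PiecewiseSmoothSurface where
  /-- The point set. -/
  carrier : Set E3
  isCompact : IsCompact carrier
  surface : Nonempty (ChartedSpace (EuclideanSpace ℝ (Fin 2)) carrier)
  /-- The number of faces. -/
  N : ℕ
  /-- The (open) faces. -/
  face : Fin N → Set E3
  /-- The number of edges. -/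
  L : ℕ
  /-- The parametrized edges; only the values on `[0, 1]` are used. -/
  edge : Fin L → ℝ → E3
  carrier_eq : carrier = (⋃ j, face j) ∪ ⋃ i, edge i '' Icc 0 1
  face_disjoint : Pairwise fun j k => Disjoint (face j) (face k)
  face_edge_disjoint : ∀ j i, Disjoint (face j) (edge i '' Icc 0 1)
  edge_disjoint : Pairwise fun i k => Disjoint (edge i '' Ioo 0 1) (edge k '' Ioo 0 1)
  vertex_notMem : ∀ i k, edge i 0 ∉ edge k '' Ioo 0 1 ∧ edge i 1 ∉ edge k '' Ioo 0 1
  edge_injOn : ∀ i, InjOn (edge i) (Ioo 0 1)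
  edge_contDiffOn : ∀ i, ContDiffOn ℝ 1 (edge i) (Icc 0 1)
  edge_regular : ∀ i, ∀ t ∈ Icc (0 : ℝ) 1, derivWithin (edge i) (Icc 0 1) t ≠ 0
  /-- Around a point of a face, the surface is that face, and is an embedded smooth surface. -/
  face_chart : ∀ j, ∀ p ∈ face j, ∃ Φ : OpenPartialHomeomorph E3 E3, IsSmoothChart Φ ∧
    p ∈ Φ.source ∧ ∀ x ∈ Φ.source, (x ∈ carrier ↔ Φ x 2 = 0) ∧ (x ∈ carrier → x ∈ face j)
  left : Fin L → Fin N
  right : Fin L → Fin N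
  left_ne_right : ∀ i, left i ≠ right i
  /-- At a point of an open edge, the surface consists of two smooth half discs, one in the left
  face and one in the right face, and of their common boundary, which is the edge. -/
  edge_chart : ∀ i, ∀ t ∈ Ioo (0 : ℝ) 1, ∃ Φ Ψ : OpenPartialHomeomorph E3 E3,
    IsSmoothChart Φ ∧ IsSmoothChart Ψ ∧ edge i t ∈ Φ.source ∧ edge i t ∈ Ψ.source ∧
    (∀ x ∈ Φ.source, (x ∈ face (left i) ↔ Φ x 2 = 0 ∧ 0 < Φ x 0) ∧
      (x ∈ edge i '' Ioo 0 1 ↔ Φ x 2 = 0 ∧ Φ x 0 = 0)) ∧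
    (∀ x ∈ Ψ.source, (x ∈ face (right i) ↔ Ψ x 2 = 0 ∧ 0 < Ψ x 0) ∧
      (x ∈ edge i '' Ioo 0 1 ↔ Ψ x 2 = 0 ∧ Ψ x 0 = 0)) ∧
    (∀ x ∈ Φ.source ∩ Ψ.source, x ∈ carrier →
      x ∈ face (left i) ∨ x ∈ edge i '' Ioo 0 1 ∨ x ∈ face (right i))
  /-- Around a vertex, each face is contained in an embedded smooth surface. -/
  vertex_chart : ∀ i, ∀ t ∈ ({0, 1} : Set ℝ), ∀ j, ∃ Φ : OpenPartialHomeomorph E3 E3,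
    IsSmoothChart Φ ∧ edge i t ∈ Φ.source ∧ ∀ x ∈ Φ.source, x ∈ face j → Φ x 2 = 0
  /-- The unit normals of the faces. -/
  normal : Fin N → E3 → E3
  normal_continuousOn : ∀ j, ContinuousOn (normal j) (closure (face j))
  norm_normal : ∀ j, ∀ p ∈ closure (face j), ‖normal j p‖ = 1
  normal_perp : ∀ j, ∀ p ∈ face j, ∀ v ∈ tangentConeAt ℝ (face j) p, ⟪normal j p, v⟫ = 0
  left_oriented : ∀ i, ∀ t ∈ Ioo (0 : ℝ) 1,
    cross (normal (left i) (edge i t)) (derivWithin (edge i) (Icc 0 1) t) ∈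
      posTangentConeAt (face (left i)) (edge i t)
  right_oriented : ∀ i, ∀ t ∈ Ioo (0 : ℝ) 1,
    -cross (normal (right i) (edge i t)) (derivWithin (edge i) (Icc 0 1) t) ∈
      posTangentConeAt (face (right i)) (edge i t)

/-- The action of a linear map `D` on area vectors (the cofactor map): it sends `a × b` to
`D a × D b`, see `areaMap_cross`.  If `e₁, e₂` is a positive orthonormal frame of the plane
orthogonal to the unit vector `n`, then `areaMap D n = D e₁ × D e₂`, which depends only on the
restriction of `D` to this plane. -/
def areaMap (D : E3 →L[ℝ] E3) (n : E3) : E3 :=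
  n 0 • cross (D (EuclideanSpace.single 1 1)) (D (EuclideanSpace.single 2 1)) +
  n 1 • cross (D (EuclideanSpace.single 2 1)) (D (EuclideanSpace.single 0 1)) +
  n 2 • cross (D (EuclideanSpace.single 0 1)) (D (EuclideanSpace.single 1 1))

theorem areaMap_cross (D : E3 →L[ℝ] E3) (a b : E3) :
    areaMap D (cross a b) = cross (D a) (D b) := by
  have h : ∀ v : E3, D v = v 0 • D (EuclideanSpace.single 0 1) +
      v 1 • D (EuclideanSpace.single 1 1) + v 2 • D (EuclideanSpace.single 2 1) := by
    intro v
    rw [← map_smul, ← map_smul, ← map_smul, ← map_add, ← map_add]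
    congr 1
    ext i
    fin_cases i <;> simp
  rw [h a, h b]
  ext i
  fin_cases i <;> simp [areaMap, cross, cross_apply] <;> ring

namespace PiecewiseSmoothSurface

variable (S : PiecewiseSmoothSurface)

/-- For a map `X` from the surface to space: the vector `dX e₁ × dX e₂` at a point `p` of the face
`j`, where `e₁, e₂` is a positive orthonormal frame of the tangent plane.  Its norm is the area
element of the image surface relative to that of `S`, and its direction is the normal of the image
surface.  The derivative within the face is determined on the tangent plane, which suffices. -/
def areaVector (X : E3 → E3) (j : Fin S.N) (p : E3) : E3 :=
  areaMap (fderivWithin ℝ X (S.face j) p) (S.normal j p)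

/-- The anisotropic energy `∫ γ(ν_X) dΣ_X` of the image of the surface under `X`, pulled back to
the surface: `γ(ν_X) dΣ_X = γ(n / ‖n‖) ‖n‖ dΣ`, where `n` is the area vector. -/
def energy (γ : S2 → ℝ) (X : E3 → E3) : ℝ :=
  ∑ j, ∫ p in S.face j, homExt γ (S.areaVector X j p) ∂μHE[2]

/-- The algebraic volume `(1/3) ∫ X ⬝ ν_X dΣ_X` enclosed by the image of the surface under `X`. -/
def volume (X : E3 → E3) : ℝ :=
  (1 / 3) * ∑ j, ∫ p in S.face j, ⟪X p, S.areaVector X j p⟫ ∂μHE[2]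

/-- `X` is a deformation of the surface through piecewise smooth immersions, defined for
`|ε| < δ`: on each closed face it is smooth in `ε` and the point jointly.  (It is then
continuous on the whole surface.) -/
structure IsVariation (δ : ℝ) (X : ℝ → E3 → E3) : Prop where
  pos : 0 < δ
  initial : ∀ p ∈ S.carrier, X 0 p = p
  smooth : ∀ j, ContDiffOn ℝ ∞ (fun q : ℝ × E3 => X q.1 q.2) (Ioo (-δ) δ ×ˢ closure (S.face j))
  immersion : ∀ ε ∈ Ioo (-δ) δ, ∀ j, ∀ p ∈ S.face j, S.areaVector (X ε) j p ≠ 0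

/-- The surface is a critical point of the energy among its volume preserving deformations. -/
def IsEquilibrium (γ : S2 → ℝ) : Prop :=
  ∀ (δ : ℝ) (X : ℝ → E3 → E3), S.IsVariation δ X →
    (∀ ε ∈ Ioo (-δ) δ, S.volume (X ε) = S.volume (X 0)) →
    HasDerivAt (fun ε => S.energy γ (X ε)) 0 0

/-- The Cahn-Hoffman field of the face `j`: the gradient of the homogeneous extension of `γ`,
evaluated at the normal.  At boundary points of the face it is the limit from that face. -/
def cahnHoffman (γ : S2 → ℝ) (j : Fin S.N) (p : E3) : E3 :=
  gradient (homExt γ) (S.normal j p)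

/-- The divergence along the face `j` of a vector field `Y` on this face: the trace of
`v ↦ dY v` over the tangent plane, i.e. the full trace minus the normal part. -/
def surfaceDiv (j : Fin S.N) (Y : E3 → E3) (p : E3) : ℝ :=
  LinearMap.trace ℝ E3 (fderivWithin ℝ Y (S.face j) p : E3 →ₗ[ℝ] E3) -
    ⟪S.normal j p, fderivWithin ℝ Y (S.face j) p (S.normal j p)⟫

/-- The anisotropic mean curvature `Λ = - div ξ`, for `ξ` the Cahn-Hoffman field. -/
def anisotropicMeanCurvature (γ : S2 → ℝ) (j : Fin S.N) (p : E3) : ℝ :=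
  -S.surfaceDiv j (S.cahnHoffman γ j) p

/-- The force balance along the edges: `(ξ₁ - ξ₂) × Γ' = 0`. -/
def ForceBalance (γ : S2 → ℝ) : Prop :=
  ∀ i, ∀ t ∈ Icc (0 : ℝ) 1,
    cross (S.cahnHoffman γ (S.left i) (S.edge i t) - S.cahnHoffman γ (S.right i) (S.edge i t))
      (derivWithin (S.edge i) (Icc 0 1) t) = 0

/-- The Cahn-Hoffman field, defined on the faces, extends continuously to the whole surface. -/
def CahnHoffmanExtends (γ : S2 → ℝ) : Prop :=
  ∃ ξ : E3 → E3, ContinuousOn ξ S.carrier ∧ ∀ j, ∀ p ∈ S.face j, ξ p = S.cahnHoffman γ j p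

end PiecewiseSmoothSurface

end AnisotropicSurface

end

/-! The equivalence is read off from the first variation formulas. Let `W` be the velocity at `ε =
0` of a variation starting at the identity. Since the area vector of the identity is `ν` and `∇γ̃(ν)
= ξ`, the energy has derivative `∑ ∫ ⟪ξ, areaPolar id dW ν⟫` over the faces. If the derivative of a
field `Y` takes values in the tangent plane, then pointwise `⟪Y, areaPolar id dW ν⟫ = div Y ⟪W, ν⟫ -
⟪curl (W × Y), ν⟫` (`inner_curlVec_cross_field`). This applies to `Y = ξ`, because the Hessian of
`γ̃` at `ν` is symmetric and annihilates `ν`, and to the position field `Y = x`. Stokes' theorem on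
each face turns the curl into line integrals; an edge occurs twice, with opposite orientations, so
that only the jump of `Y` across it survives (`sum_areaVariation`).

The outcome is `δF = -∑ ∫ Λ ⟪W, ν⟫ - ∑ ∫ ⟪W, (ξ₁ - ξ₂) × Γ'⟫` and `δV = ∑ ∫ ⟪W, ν⟫`. Conditions (i)
and (ii) reduce `δF` to `-c δV`, which vanishes when the volume is preserved. Conversely, a smooth
field is corrected by a second field of nonzero flux, using the implicit function theorem, to give a
volume preserving variation. This yields a multiplier `c` with `energyForm = c * flux` on all smooth
fields (`IsEquilibrium.exists_multiplier`). Bump fields inside a face force `Λ = c`; bump fields at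
a point of an open edge then force the jump term to vanish. The last claim holds because a
continuous extension of `ξ` agrees, by density, with the limits from both sides of an edge.

The analytic core is Stokes' theorem on a face (`curlFlux_eq_sum`) for fields that are continuous up
to the boundary with bounded tangential derivative. Near points of the face and of its open edges it
is Green's theorem in a chart, combined with the area formula for the Hausdorff measure. The local
statements are added up by a partition of unity. Vertices, where no half disc is available, are
removed by cutoffs: on scale `r` the cutoff has gradient `O(1/r)` while the area is `O(r²)`, so the
error is `O(r)`. -/

noncomputable section

namespace AnisotropicSurface

/-! ### The vector product -/

theorem cross_zero (u v : E3) : cross u v 0 = u 1 * v 2 - u 2 * v 1 := by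
  simp [cross, cross_apply]

theorem cross_one (u v : E3) : cross u v 1 = u 2 * v 0 - u 0 * v 2 := by
  simp [cross, cross_apply]

theorem cross_two (u v : E3) : cross u v 2 = u 0 * v 1 - u 1 * v 0 := by
  simp [cross, cross_apply]

theorem inner_eq (u v : E3) : ⟪u, v⟫ = u 0 * v 0 + u 1 * v 1 + u 2 * v 2 := by
  simp [PiLp.inner_apply, Fin.sum_univ_three, mul_comm]

theorem isBilinearMap_cross : IsBilinearMap ℝ cross where
  add_left x y z := by simp [cross]
  smul_left c x y := by simp [cross]
  add_right x y z := by simp [cross]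
  smul_right c x y := by simp [cross]

/-- The vector product as a continuous bilinear map. -/
def crossL : E3 →L[ℝ] E3 →L[ℝ] E3 := isBilinearMap_cross.toContinuousBilinearMap

@[simp]
theorem crossL_apply (u v : E3) : crossL u v = cross u v := rfl

theorem inner_cross_self_left (u v : E3) : ⟪cross u v, u⟫ = 0 := by
  rw [inner_eq, cross_zero, cross_one, cross_two]; ring

theorem inner_cross_left_eq (u v w : E3) : ⟪cross u v, w⟫ = ⟪u, cross v w⟫ := by
  simp only [inner_eq, cross_zero, cross_one, cross_two]; ring

theorem cross_anticomm' (u v : E3) : cross v u = -cross u v := by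
  ext i; fin_cases i <;> simp [cross, cross_apply] <;> ring

theorem cross_zero_left (v : E3) : cross 0 v = 0 := by
  ext i; fin_cases i <;> simp [cross]

theorem cross_cross (u v w : E3) : cross (cross u v) w = ⟪u, w⟫ • v - ⟪v, w⟫ • u := by
  ext i; fin_cases i <;> simp [cross, cross_apply, inner_eq] <;> ring

theorem norm_cross_sq (u v : E3) : ‖cross u v‖ ^ 2 = ‖u‖ ^ 2 * ‖v‖ ^ 2 - ⟪u, v⟫ ^ 2 := by
  simp only [← real_inner_self_eq_norm_sq, inner_eq, cross_zero, cross_one, cross_two]; ring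

/-- A vector orthogonal to two independent vectors is a multiple of their vector product. -/
theorem eq_smul_cross {a b x : E3} (h : cross a b ≠ 0) (ha : ⟪x, a⟫ = 0) (hb : ⟪x, b⟫ = 0) :
    x = (⟪x, cross a b⟫ / ‖cross a b‖ ^ 2) • cross a b := by
  have hn : ‖cross a b‖ ^ 2 ≠ 0 := by simpa using h
  have h1 : cross x (cross a b) = 0 := by
    rw [cross_anticomm', cross_cross, real_inner_comm, ha, real_inner_comm, hb]; simp
  have h2 : cross (cross x (cross a b)) (cross a b) = 0 := by rw [h1, cross_zero_left]
  rw [cross_cross, real_inner_self_eq_norm_sq, sub_eq_zero] at h2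
  rw [div_eq_inv_mul, mul_smul, h2, smul_smul, inv_mul_cancel₀ hn, one_smul]

/-- Cramer's rule in the basis `a`, `b`, `a × b`: the coefficients of `‖a × b‖² • v` are triple
products, and the one in the direction `a × b` is zero by hypothesis. -/
theorem ortho_decomp {a b v : E3} (h : cross a b ≠ 0) (hv : ⟪cross a b, v⟫ = 0) :
    ∃ s t : ℝ, v = s • a + t • b := by
  have hn : ‖cross a b‖ ^ 2 ≠ 0 := by simpa using h
  refine ⟨⟪cross v b, cross a b⟫ / ‖cross a b‖ ^ 2, ⟪cross a v, cross a b⟫ / ‖cross a b‖ ^ 2, ?_⟩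
  have key : ‖cross a b‖ ^ 2 • v =
      ⟪cross v b, cross a b⟫ • a + ⟪cross a v, cross a b⟫ • b + ⟪cross a b, v⟫ • cross a b := by
    rw [← real_inner_self_eq_norm_sq, inner_eq (cross a b) (cross a b)]
    ext i
    fin_cases i <;> simp [cross, cross_apply, inner_eq] <;> ring
  rw [hv, zero_smul, add_zero] at key
  rw [div_eq_inv_mul, div_eq_inv_mul, mul_smul, mul_smul, ← smul_add, ← key, smul_smul,
    inv_mul_cancel₀ hn, one_smul]

/-- Take any unit `a` orthogonal to `n` and `b = n × a`. Expressions in a derivative and a normal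
`n` are then evaluated on `n = cross a b`, where they involve only the values on tangent vectors. -/
theorem exists_frame {n : E3} (hn : ‖n‖ = 1) :
    ∃ a b : E3, cross a b = n ∧ ⟪n, a⟫ = 0 ∧ ⟪n, b⟫ = 0 ∧ ‖a‖ = 1 := by
  obtain ⟨a, ha, hna⟩ : ∃ a : E3, ‖a‖ = 1 ∧ ⟪n, a⟫ = 0 := by
    have hpos : 0 < Module.finrank ℝ (ℝ ∙ n)ᗮ := by
      have h1 := Submodule.finrank_add_finrank_orthogonal (ℝ ∙ n)
      have h2 : Module.finrank ℝ (ℝ ∙ n) = 1 :=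
        finrank_span_singleton (by rintro rfl; simp at hn)
      rw [finrank_euclideanSpace_fin] at h1
      omega
    obtain ⟨x, hx⟩ := Module.finrank_pos_iff_exists_ne_zero.mp hpos
    have hx' : (x : E3) ≠ 0 := by simpa using hx
    refine ⟨‖(x : E3)‖⁻¹ • (x : E3), norm_smul_inv_norm (𝕜 := ℝ) hx', ?_⟩
    rw [inner_smul_right, Submodule.mem_orthogonal_singleton_iff_inner_right.mp x.2, mul_zero]
  refine ⟨a, cross n a, ?_, hna, ?_, ha⟩
  · rw [cross_anticomm', cross_cross, hna, real_inner_self_eq_norm_sq, ha]; simp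
  · rw [real_inner_comm, inner_cross_self_left]

/-! ### Expressions in a derivative which depend on its tangential part only -/

theorem expand (D : E3 →L[ℝ] E3) (v : E3) :
    D v = v 0 • D (EuclideanSpace.single 0 1) + v 1 • D (EuclideanSpace.single 1 1) +
      v 2 • D (EuclideanSpace.single 2 1) := by
  rw [← map_smul, ← map_smul, ← map_smul, ← map_add, ← map_add]
  congr 1
  ext i
  fin_cases i <;> simp

/-- The curl of a vector field with derivative `D`. -/
def curlVec (D : E3 →L[ℝ] E3) : E3 :=
  WithLp.toLp 2 ![D (EuclideanSpace.single 1 1) 2 - D (EuclideanSpace.single 2 1) 1,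
    D (EuclideanSpace.single 2 1) 0 - D (EuclideanSpace.single 0 1) 2,
    D (EuclideanSpace.single 0 1) 1 - D (EuclideanSpace.single 1 1) 0]

/-- The curl is the vector representing the antisymmetric part of `D`. Its component along `a × b`
therefore depends only on `D` on the plane of `a` and `b`. -/
theorem inner_curlVec_cross (D : E3 →L[ℝ] E3) (a b : E3) :
    ⟪curlVec D, cross a b⟫ = ⟪D a, b⟫ - ⟪D b, a⟫ := by
  rw [expand D a, expand D b]
  simp [curlVec, inner_eq, cross_zero, cross_one, cross_two]
  ring

/-- The polarization of the quadratic map `areaMap`. -/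
def areaPolar (D D' : E3 →L[ℝ] E3) (n : E3) : E3 :=
  n 0 • (cross (D (EuclideanSpace.single 1 1)) (D' (EuclideanSpace.single 2 1)) +
    cross (D' (EuclideanSpace.single 1 1)) (D (EuclideanSpace.single 2 1))) +
  n 1 • (cross (D (EuclideanSpace.single 2 1)) (D' (EuclideanSpace.single 0 1)) +
    cross (D' (EuclideanSpace.single 2 1)) (D (EuclideanSpace.single 0 1))) +
  n 2 • (cross (D (EuclideanSpace.single 0 1)) (D' (EuclideanSpace.single 1 1)) +
    cross (D' (EuclideanSpace.single 0 1)) (D (EuclideanSpace.single 1 1)))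

theorem areaPolar_cross (D D' : E3 →L[ℝ] E3) (a b : E3) :
    areaPolar D D' (cross a b) = cross (D a) (D' b) + cross (D' a) (D b) := by
  rw [expand D a, expand D b, expand D' a, expand D' b]
  ext i
  fin_cases i <;> simp [areaPolar, cross, cross_apply] <;> ring

theorem hasDerivAt_areaMap {D : ℝ → E3 →L[ℝ] E3} {D' : E3 →L[ℝ] E3} {t : ℝ}
    (hD : HasDerivAt D D' t) (n : E3) :
    HasDerivAt (fun s => areaMap (D s) n) (areaPolar (D t) D' n) t := by
  have h : ∀ v, HasDerivAt (fun s => D s v) (D' v) t := fun v => by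
    simpa using hD.clm_apply (hasDerivAt_const t v)
  have hc : ∀ v w, HasDerivAt (fun s => cross (D s v) (D s w))
      (cross (D t v) (D' w) + cross (D' v) (D t w)) t := fun v w =>
    (crossL.hasFDerivAt_of_bilinear (h v).hasFDerivAt (h w).hasFDerivAt).hasDerivAt.congr_deriv
      (by simp)
  exact (((hc _ _).const_smul (n 0)).add ((hc _ _).const_smul (n 1))).add
    ((hc _ _).const_smul (n 2))

theorem continuous_areaMap : Continuous fun q : (E3 →L[ℝ] E3) × E3 => areaMap q.1 q.2 := by
  have hc : ∀ v w : E3, Continuous fun q : (E3 →L[ℝ] E3) × E3 => cross (q.1 v) (q.1 w) :=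
    fun v w => (crossL.continuous₂.comp (by fun_prop :
      Continuous fun q : (E3 →L[ℝ] E3) × E3 => (q.1 v, q.1 w)) :)
  have hn : ∀ i, Continuous fun q : (E3 →L[ℝ] E3) × E3 => q.2 i := fun i => by fun_prop
  exact (((hn 0).smul (hc _ _)).add ((hn 1).smul (hc _ _))).add ((hn 2).smul (hc _ _))

theorem continuous_areaPolar : Continuous fun q : (E3 →L[ℝ] E3) × (E3 →L[ℝ] E3) × E3 =>
    areaPolar q.1 q.2.1 q.2.2 := by
  have hc : ∀ v w : E3, Continuous fun q : (E3 →L[ℝ] E3) × (E3 →L[ℝ] E3) × E3 =>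
      cross (q.1 v) (q.2.1 w) + cross (q.2.1 v) (q.1 w) := fun v w =>
    (crossL.continuous₂.comp (by fun_prop : Continuous
      fun q : (E3 →L[ℝ] E3) × (E3 →L[ℝ] E3) × E3 => (q.1 v, q.2.1 w)) :).add
    (crossL.continuous₂.comp (by fun_prop : Continuous
      fun q : (E3 →L[ℝ] E3) × (E3 →L[ℝ] E3) × E3 => (q.2.1 v, q.1 w)) :)
  have hn : ∀ i, Continuous fun q : (E3 →L[ℝ] E3) × (E3 →L[ℝ] E3) × E3 => q.2.2 i :=
    fun i => by fun_prop
  exact (((hn 0).smul (hc _ _)).add ((hn 1).smul (hc _ _))).add ((hn 2).smul (hc _ _))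

theorem continuous_curlVec : Continuous curlVec := by
  unfold curlVec
  refine (PiLp.continuous_toLp 2 _).comp (continuous_pi fun i => ?_)
  fin_cases i <;> simp <;> fun_prop

theorem areaMap_one (n : E3) : areaMap (ContinuousLinearMap.id ℝ E3) n = n := by
  ext i
  fin_cases i <;> simp [areaMap, cross, cross_apply]

section tangential

variable {n : E3} {D D₁ D' D₁' : E3 →L[ℝ] E3}

/-- The derivative within a face is determined only on the tangent plane; its value on the normal is
an arbitrary choice. This lemma and the next two show that the area vector, its polarization and the
normal curl do not see that choice. -/
theorem areaMap_congr (hn : ‖n‖ = 1) (h : ∀ v, ⟪n, v⟫ = 0 → D v = D₁ v) :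
    areaMap D n = areaMap D₁ n := by
  obtain ⟨a, b, hab, ha, hb, -⟩ := exists_frame hn
  rw [← hab, areaMap_cross, areaMap_cross, h a ha, h b hb]

theorem areaPolar_congr (hn : ‖n‖ = 1) (h : ∀ v, ⟪n, v⟫ = 0 → D v = D₁ v)
    (h' : ∀ v, ⟪n, v⟫ = 0 → D' v = D₁' v) : areaPolar D D' n = areaPolar D₁ D₁' n := by
  obtain ⟨a, b, hab, ha, hb, -⟩ := exists_frame hn
  rw [← hab, areaPolar_cross, areaPolar_cross, h a ha, h b hb, h' a ha, h' b hb]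

theorem inner_curlVec_congr (hn : ‖n‖ = 1) (h : ∀ v, ⟪n, v⟫ = 0 → D v = D₁ v) :
    ⟪curlVec D, n⟫ = ⟪curlVec D₁, n⟫ := by
  obtain ⟨a, b, hab, ha, hb, -⟩ := exists_frame hn
  rw [← hab, inner_curlVec_cross, inner_curlVec_cross, h a ha, h b hb]

/-- The orthogonal projection to the plane orthogonal to the unit vector `n`. -/
def tangentProj (n : E3) : E3 →L[ℝ] E3 :=
  ContinuousLinearMap.id ℝ E3 - (innerSL ℝ n).smulRight n

theorem tangentProj_apply (n v : E3) : tangentProj n v = v - ⟪n, v⟫ • n := by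
  simp [tangentProj]

theorem tangentProj_eq_self {v : E3} (h : ⟪n, v⟫ = 0) : tangentProj n v = v := by
  rw [tangentProj_apply, h]; simp

theorem inner_tangentProj (hn : ‖n‖ = 1) (v : E3) : ⟪n, tangentProj n v⟫ = 0 := by
  rw [tangentProj_apply, inner_sub_right, inner_smul_right, real_inner_self_eq_norm_sq, hn]; ring

theorem continuous_tangentProj : Continuous tangentProj := by
  unfold tangentProj
  fun_prop

theorem norm_tangentProj_le (hn : ‖n‖ = 1) : ‖tangentProj n‖ ≤ 2 := by
  refine (norm_sub_le _ _).trans ?_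
  have h1 : ‖ContinuousLinearMap.id ℝ E3‖ ≤ 1 := ContinuousLinearMap.norm_id_le
  have h2 : ‖(innerSL ℝ n).smulRight n‖ ≤ 1 := by
    rw [ContinuousLinearMap.norm_smulRight_apply, innerSL_apply_norm, hn]; norm_num
  linarith

theorem trace_eq (D : E3 →L[ℝ] E3) : LinearMap.trace ℝ E3 (D : E3 →ₗ[ℝ] E3) =
    D (EuclideanSpace.single 0 1) 0 + D (EuclideanSpace.single 1 1) 1 +
      D (EuclideanSpace.single 2 1) 2 := by
  rw [LinearMap.trace_eq_sum_inner _ (EuclideanSpace.basisFun (Fin 3) ℝ), Fin.sum_univ_three]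
  simp [inner_eq]

/-- The trace of the tangential part. -/
theorem trace_sub_inner (D : E3 →L[ℝ] E3) (n : E3) :
    LinearMap.trace ℝ E3 (D : E3 →ₗ[ℝ] E3) - ⟪n, D n⟫ =
      LinearMap.trace ℝ E3 (D.comp (tangentProj n) : E3 →ₗ[ℝ] E3) := by
  rw [trace_eq, trace_eq]
  simp only [ContinuousLinearMap.comp_apply, tangentProj_apply, map_sub, map_smul]
  rw [expand D n]
  simp [inner_eq]
  ring

theorem continuous_trace : Continuous fun D : E3 →L[ℝ] E3 =>
    LinearMap.trace ℝ E3 (D : E3 →ₗ[ℝ] E3) := by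
  simp only [trace_eq]
  fun_prop

/-- The pointwise identity behind the first variation formula: `D` is the derivative of the
variation field `W`, and `D'` is the derivative of the field `Y`. -/
theorem inner_curlVec_crossField (D D' : E3 →L[ℝ] E3) (W Y n : E3)  :
    ⟪curlVec ((crossL.flip Y).comp D + (crossL W).comp D'), n⟫ =
      -⟪Y, areaPolar (ContinuousLinearMap.id ℝ E3) D n⟫ +
        (LinearMap.trace ℝ E3 (D' : E3 →ₗ[ℝ] E3) * ⟪W, n⟫ - ⟪D' W, n⟫) := by
  rw [expand D' W, trace_eq]
  simp [curlVec, areaPolar, inner_eq, cross, cross_apply]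
  ring

end tangential

end AnisotropicSurface

namespace AnisotropicSurface

/-! ### The homogeneous extension -/

variable {γ : S2 → ℝ}

theorem homExt_of_ne {x : E3} (hx : x ≠ 0) : homExt γ x = ‖x‖ * γ (direction x hx) := by
  simp [homExt, hx]

theorem homExt_smul {t : ℝ} (ht : 0 < t) (x : E3) : homExt γ (t • x) = t * homExt γ x := by
  rcases eq_or_ne x 0 with rfl | hx
  · simp [homExt]
  have hx' : t • x ≠ 0 := smul_ne_zero ht.ne' hx
  rw [homExt_of_ne hx, homExt_of_ne hx', norm_smul, Real.norm_of_nonneg ht.le, mul_assoc]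
  congr 3
  apply Subtype.ext
  simp only [direction, norm_smul, Real.norm_of_nonneg ht.le, smul_smul]
  congr 1
  field_simp

-- Off the origin the extension is the norm times `γ` composed with the radial projection. The
-- latter is smooth as a map from the open submanifold of nonzero vectors to the sphere.
open TopologicalSpace in
theorem contDiffAt_homExt (hγ' : ContMDiff (𝓡 2) 𝓘(ℝ, ℝ) 3 γ) {x : E3} (hx : x ≠ 0) :
    ContDiffAt ℝ 3 (homExt γ) x := by
  let U : Opens E3 := ⟨{x | x ≠ 0}, isOpen_ne⟩
  have h1 : ContMDiff 𝓘(ℝ, E3) 𝓘(ℝ, E3) 3 (fun y : U => ‖(y : E3)‖⁻¹ • (y : E3)) := by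
    intro y
    have hy : (y : E3) ≠ 0 := y.2
    have : ContDiffAt ℝ 3 (fun y : E3 => ‖y‖⁻¹ • y) y :=
      ((contDiffAt_norm ℝ hy).inv (norm_ne_zero_iff.mpr hy)).smul contDiffAt_id
    exact this.contMDiffAt.comp y (contMDiff_subtype_val y)
  have h2 : ∀ y : U, ‖(y : E3)‖⁻¹ • (y : E3) ∈ Metric.sphere (0 : E3) 1 := fun y =>
    (direction y.1 y.2).2
  have h3 := hγ'.comp (h1.codRestrict_sphere (n := 2) h2)
  have h4 : ContMDiffAt 𝓘(ℝ, E3) 𝓘(ℝ, ℝ) 3 (fun y : U => homExt γ y) ⟨x, hx⟩ := by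
    have h5 : ContMDiffAt 𝓘(ℝ, E3) 𝓘(ℝ, ℝ) 3 (fun y : U => ‖(y : E3)‖) ⟨x, hx⟩ :=
      (contDiffAt_norm ℝ hx).contMDiffAt.comp (⟨x, hx⟩ : U) (contMDiff_subtype_val _)
    refine (h5.mul (h3 ⟨x, hx⟩)).congr_of_eventuallyEq (.of_forall fun y => ?_)
    exact homExt_of_ne y.2
  have h6 := (contMDiffAt_subtype_iff (U := U) (f := homExt γ) (x := ⟨x, hx⟩)).mp h4
  exact h6.contDiffAt

/-- Differentiating the degree one homogeneity relation in the point produces the same factor `t` on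
both sides, so the gradient is homogeneous of degree zero. -/
theorem gradient_homExt_smul (hγ' : ContMDiff (𝓡 2) 𝓘(ℝ, ℝ) 3 γ) {x : E3} (hx : x ≠ 0) {t : ℝ}
    (ht : 0 < t) : gradient (homExt γ) (t • x) = gradient (homExt γ) x := by
  have h1 : HasFDerivAt (homExt γ) (fderiv ℝ (homExt γ) (t • x)) (t • x) :=
    ((contDiffAt_homExt hγ' (smul_ne_zero ht.ne' hx)).differentiableAt (by norm_num)).hasFDerivAt
  have h2 : HasFDerivAt (homExt γ) (fderiv ℝ (homExt γ) x) x :=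
    ((contDiffAt_homExt hγ' hx).differentiableAt (by norm_num)).hasFDerivAt
  have h3 : HasFDerivAt (fun y : E3 => t • y) (t • ContinuousLinearMap.id ℝ E3) x :=
    (hasFDerivAt_id x).const_smul t
  have h4 : HasFDerivAt (fun y => t * homExt γ y)
      ((fderiv ℝ (homExt γ) (t • x)).comp (t • ContinuousLinearMap.id ℝ E3)) x :=
    (h1.comp x h3).congr_of_eventuallyEq (.of_forall fun y => (homExt_smul ht y).symm)
  have h5 := h4.unique (h2.const_mul t)
  unfold gradient
  congr 1
  ext v
  have := congrArg (fun L : E3 →L[ℝ] ℝ => L v) h5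
  simpa [ht.ne'] using this

theorem contDiffAt_gradient_homExt (hγ' : ContMDiff (𝓡 2) 𝓘(ℝ, ℝ) 3 γ) {x : E3} (hx : x ≠ 0) :
    ContDiffAt ℝ 2 (gradient (homExt γ)) x := by
  have h := (contDiffAt_homExt hγ' hx).fderiv_right (m := 2) (by norm_num)
  exact (InnerProductSpace.toDual ℝ E3).symm.contDiff.contDiffAt.comp x h

theorem inner_gradient_homExt (γ : S2 → ℝ) (x v : E3) :
    ⟪gradient (homExt γ) x, v⟫ = fderiv ℝ (homExt γ) x v := by
  simp [gradient]

/-- Degree zero homogeneity reduces the bound to the compact sphere. It dominates the integrand when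
the energy is differentiated, since area vectors of a variation are not unit vectors. -/
theorem norm_gradient_homExt_le (hγ' : ContMDiff (𝓡 2) 𝓘(ℝ, ℝ) 3 γ) :
    ∃ C, ∀ x : E3, x ≠ 0 → ‖gradient (homExt γ) x‖ ≤ C := by
  have hc : ContinuousOn (gradient (homExt γ)) (Metric.sphere (0 : E3) 1) := fun x hx =>
    (contDiffAt_gradient_homExt hγ' (Metric.ne_of_mem_sphere hx one_ne_zero)).continuousAt
      |>.continuousWithinAt
  obtain ⟨C, hC⟩ := (isCompact_sphere (0 : E3) 1).exists_bound_of_continuousOn hc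
  refine ⟨C, fun x hx => ?_⟩
  rw [← gradient_homExt_smul hγ' hx (inv_pos.mpr (norm_pos_iff.mpr hx))]
  exact hC _ (direction x hx).2

/-- The Hessian of the homogeneous extension: symmetric, and `x` lies in its kernel. -/
theorem inner_fderiv_gradient_homExt (hγ' : ContMDiff (𝓡 2) 𝓘(ℝ, ℝ) 3 γ) {x : E3} (hx : x ≠ 0)
    (v : E3) : ⟪x, fderiv ℝ (gradient (homExt γ)) x v⟫ = 0 := by
  set H := fderiv ℝ (gradient (homExt γ)) x with hH
  have hd : HasFDerivAt (gradient (homExt γ)) H x :=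
    ((contDiffAt_gradient_homExt hγ' hx).differentiableAt (by norm_num)).hasFDerivAt
  -- Euler's relation: the gradient is constant along the ray through `x`. Symmetry of the Hessian
  -- then moves `x` to the other slot.
  have h1 : H x = 0 := by
    have h2 : HasDerivAt (fun t : ℝ => t • x) x 1 := by
      simpa using (hasDerivAt_id (1 : ℝ)).smul_const x
    have hd' : HasFDerivAt (gradient (homExt γ)) H ((1 : ℝ) • x) := by rwa [one_smul]
    have h3 : HasDerivAt (fun t : ℝ => gradient (homExt γ) (t • x)) (H x) 1 := by
      have h := hd'.comp_hasDerivAt (1 : ℝ) h2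
      exact h
    have h4 : HasDerivAt (fun t : ℝ => gradient (homExt γ) (t • x)) 0 1 := by
      refine (hasDerivAt_const (1 : ℝ) (gradient (homExt γ) x)).congr_of_eventuallyEq ?_
      filter_upwards [lt_mem_nhds (zero_lt_one' ℝ)] with t ht
      exact gradient_homExt_smul hγ' hx ht
    exact h3.unique h4
  have h5 : ∀ᶠ y in 𝓝 x, HasFDerivAt (homExt γ) (innerSL ℝ (gradient (homExt γ) y)) y := by
    filter_upwards [isOpen_ne.mem_nhds hx] with y hy
    have := ((contDiffAt_homExt hγ' hy).differentiableAt (by norm_num)).hasGradientAt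
    exact this.hasFDerivAt
  have h6 : HasFDerivAt (fun y => innerSL ℝ (gradient (homExt γ) y)) ((innerSL ℝ).comp H) x :=
    ((innerSL ℝ (E := E3)).hasFDerivAt.comp x hd :)
  have h7 := second_derivative_symmetric_of_eventually h5 h6 v x
  simpa [h1, real_inner_comm] using h7

end AnisotropicSurface

namespace AnisotropicSurface

/-! ### The area formula for parametrized surfaces -/

open scoped NNReal ENNReal
open Filter

/-- The parameter plane. -/
abbrev E2 : Type := EuclideanSpace ℝ (Fin 2)

/-- Two maps on a common index set are compared, so that a parametrization and its differential can
play both roles in turn. The correspondence `f x ↦ g x` is a `K`-Lipschitz map of the images, and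
area scales by at most `K ^ 2`. -/
theorem euclideanHausdorffMeasure_image_le {X Y Z : Type*} [MetricSpace Y] [MeasurableSpace Y]
    [BorelSpace Y] [MetricSpace Z] [MeasurableSpace Z] [BorelSpace Z] {f : X → Y} {g : X → Z}
    {K : ℝ≥0} {A : Set X} (h : ∀ x ∈ A, ∀ y ∈ A, dist (g x) (g y) ≤ K * dist (f x) (f y)) :
    μHE[2] (g '' A) ≤ (K : ℝ≥0∞) ^ 2 * μHE[2] (f '' A) := by
  rcases A.eq_empty_or_nonempty with rfl | ⟨x₀, hx₀⟩
  · simp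
  have : Nonempty X := ⟨x₀⟩
  have hinv : ∀ x ∈ A, Function.invFunOn f A (f x) ∈ A ∧ f (Function.invFunOn f A (f x)) = f x :=
    fun x hx => Function.invFunOn_pos ⟨x, hx, rfl⟩
  have hL : LipschitzOnWith K (g ∘ Function.invFunOn f A) (f '' A) := by
    refine LipschitzOnWith.of_dist_le_mul ?_
    rintro _ ⟨x, hx, rfl⟩ _ ⟨y, hy, rfl⟩
    have := h _ (hinv x hx).1 _ (hinv y hy).1
    rwa [(hinv x hx).2, (hinv y hy).2] at this
  have him : (g ∘ Function.invFunOn f A) '' (f '' A) = g '' A := by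
    rw [image_image]
    refine image_congr fun x hx => ?_
    have := h _ (hinv x hx).1 x hx
    rw [(hinv x hx).2, dist_self, mul_zero] at this
    exact dist_le_zero.mp this
  have := hL.hausdorffMeasure_image_le (d := 2) (by norm_num)
  rw [him] at this
  simp only [Measure.euclideanHausdorffMeasure_def, Measure.smul_apply, Measure.nnreal_smul_coe_apply]
  rw [mul_left_comm]
  gcongr
  exact_mod_cast this

/-- Both squares equal the Gram determinant of the two image vectors, by Lagrange's identity
`norm_cross_sq`. -/
theorem normDet_eq_norm_cross (L : E2 →L[ℝ] E3) : (L : E2 →ₗ[ℝ] E3).normDet =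
    ‖cross (L (EuclideanSpace.single 0 1)) (L (EuclideanSpace.single 1 1))‖ := by
  have h := (L : E2 →ₗ[ℝ] E3).normDet_sq_eq_det_gram (EuclideanSpace.basisFun (Fin 2) ℝ)
  rw [Matrix.det_fin_two] at h
  simp only [Matrix.gram_apply, EuclideanSpace.basisFun_apply, ContinuousLinearMap.coe_coe,
    RCLike.ofReal_real_eq_id, id_eq, real_inner_self_eq_norm_sq] at h
  rw [← sq_eq_sq₀ (LinearMap.normDet_nonneg _) (norm_nonneg _), h, norm_cross_sq,
    real_inner_comm (L (EuclideanSpace.single 0 1))]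
  ring

section area

variable {ψ : E2 → E3} {ψ' : E2 → E2 →L[ℝ] E3} {U : Set E2}

/-- The area element of a parametrization with derivative `L`. -/
def areaFactor (L : E2 →L[ℝ] E3) : ℝ :=
  ‖cross (L (EuclideanSpace.single 0 1)) (L (EuclideanSpace.single 1 1))‖

theorem areaFactor_nonneg (L : E2 →L[ℝ] E3) : 0 ≤ areaFactor L := norm_nonneg _

theorem continuous_areaFactor : Continuous areaFactor := by
  unfold areaFactor
  exact (crossL.continuous₂.comp (by fun_prop : Continuous fun L : E2 →L[ℝ] E3 =>
    (L (EuclideanSpace.single 0 1), L (EuclideanSpace.single 1 1))) :).norm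

theorem measure_linear_image (L : E2 →L[ℝ] E3) (A : Set E2) :
    μHE[2] (L '' A) = ENNReal.ofReal (areaFactor L) * volume A := by
  have h := (L : E2 →ₗ[ℝ] E3).euclideanHausdorffMeasure_image_eq_normDet_mul_volume A
  rwa [finrank_euclideanSpace_fin, normDet_eq_norm_cross] at h

/-- An injective linear map is bounded below. The error in strict differentiability is thus small
relative to the distance of the images under `L`, and near `u` the map and its differential distort
each other by a factor as close to 1 as desired. -/
theorem exists_lipschitz_compare {u : E2} {L : E2 →L[ℝ] E3} (hd : HasStrictFDerivAt ψ L u)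
    (hne : areaFactor L ≠ 0) {K : ℝ≥0} (hK : 1 < K) : ∀ᶠ q : E2 × E2 in 𝓝 (u, u),
      dist (ψ q.1) (ψ q.2) ≤ K * dist (L q.1) (L q.2) ∧
      dist (L q.1) (L q.2) ≤ K * dist (ψ q.1) (ψ q.2) := by
  have hker : (L : E2 →ₗ[ℝ] E3).ker = ⊥ := by
    by_contra hcon
    have := LinearMap.normDet_eq_zero_iff_ker_ne_bot.mpr hcon
    rw [normDet_eq_norm_cross] at this
    exact hne this
  obtain ⟨k, hk0, hk⟩ := (L : E2 →ₗ[ℝ] E3).exists_antilipschitzWith hker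
  have hK0 : (0 : ℝ) < K := lt_trans zero_lt_one (by exact_mod_cast hK)
  have hK1 : (1 : ℝ) < K := by exact_mod_cast hK
  -- With the lower bound constant `k` of `L`, the error becomes at most `(1 - K⁻¹) ‖L q.1 - L
  -- q.2‖`. Since also `1 - K⁻¹ ≤ K - 1`, this one choice gives both inequalities.
  set ε : ℝ := (1 - (K : ℝ)⁻¹) / k with hε
  have hk0' : (0 : ℝ) < k := by exact_mod_cast hk0
  have hεpos : 0 < ε := div_pos (sub_pos.mpr (inv_lt_one_of_one_lt₀ hK1)) hk0'
  filter_upwards [hd.isLittleO.def hεpos] with q hq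
  have h1 : ‖q.1 - q.2‖ ≤ k * ‖L q.1 - L q.2‖ := by
    simpa [dist_eq_norm] using hk.le_mul_dist q.1 q.2
  have h2 : ‖ψ q.1 - ψ q.2 - L (q.1 - q.2)‖ ≤ (1 - (K : ℝ)⁻¹) * ‖L q.1 - L q.2‖ := by
    refine hq.trans ((mul_le_mul_of_nonneg_left h1 hεpos.le).trans_eq ?_)
    rw [hε]; field_simp
  rw [map_sub] at h2
  rw [dist_eq_norm, dist_eq_norm]
  set a := ψ q.1 - ψ q.2
  set b := L q.1 - L q.2
  have h3 : ‖a‖ ≤ ‖b‖ + ‖a - b‖ := by simpa using norm_add_le b (a - b)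
  have h4 : ‖b‖ ≤ ‖a‖ + ‖a - b‖ := by
    have := norm_sub_le a (a - b); simpa using this
  have hKi : (1 : ℝ) - (K : ℝ)⁻¹ ≤ K - 1 := by
    have : (K : ℝ) * (K : ℝ)⁻¹ = 1 := mul_inv_cancel₀ hK0.ne'
    nlinarith [inv_pos.mpr hK0]
  constructor
  · nlinarith [norm_nonneg b]
  · have : (K : ℝ)⁻¹ * ‖b‖ ≤ ‖a‖ := by linarith
    rwa [inv_mul_le_iff₀ hK0] at this

/-- The Hausdorff measure is pulled back to a measure `ρ` on the plane and its density is computed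
by Besicovitch differentiation. On small balls, `ρ` is comparable with the area of the linear image
up to the factor `K ^ 2`, for every `K > 1`; letting `K` tend to 1 identifies the density with the
area element. -/
theorem measure_image_eq_lintegral (hU : IsOpen U) (hinj : InjOn ψ U) {K : ℝ≥0}
    (hL : LipschitzOnWith K ψ U) (hd : ∀ u ∈ U, HasStrictFDerivAt ψ (ψ' u) u)
    (hne : ∀ u ∈ U, areaFactor (ψ' u) ≠ 0) {A : Set E2} (hA : MeasurableSet A) (hAU : A ⊆ U) :
    μHE[2] (ψ '' A) = ∫⁻ u in A, ENNReal.ofReal (areaFactor (ψ' u)) := by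
  have hemb := hL.continuousOn.measurableEmbedding hU.measurableSet hinj
  set ρ : Measure E2 := ((μHE[2] : Measure E3).comap (U.domRestrict ψ)).map Subtype.val with hρ
  have hρA : ∀ B : Set E2, MeasurableSet B → ρ B = μHE[2] (ψ '' (B ∩ U)) := by
    intro B hB
    rw [hρ, Measure.map_apply measurable_subtype_coe hB, hemb.comap_apply]
    congr 1
    ext x
    simp only [mem_image, mem_preimage, Subtype.exists, Set.domRestrict_apply, mem_inter_iff]
    constructor
    · rintro ⟨a, ha, h1, h2⟩; exact ⟨a, ⟨h1, ha⟩, h2⟩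
    · rintro ⟨a, ⟨h1, ha⟩, h2⟩; exact ⟨a, ha, h1, h2⟩
  -- The Lipschitz constant is needed only here: it makes `ρ` locally finite and absolutely
  -- continuous, so that it is the integral of its density.
  have hle : ρ ≤ (K ^ 2 : ℝ≥0) • (volume : Measure E2) := by
    refine Measure.le_iff.mpr fun B hB => ?_
    rw [hρA B hB]
    have h1 := euclideanHausdorffMeasure_image_le (f := (id : E2 → E2)) (g := ψ) (A := B ∩ U)
      (K := K) fun x hx y hy => hL.dist_le_mul x hx.2 y hy.2
    rw [image_id, EuclideanSpace.euclideanHausdorffMeasure_eq_volume] at h1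
    refine h1.trans ?_
    rw [Measure.smul_apply, ENNReal.smul_def, smul_eq_mul]
    push_cast
    gcongr
    exact inter_subset_left
  have : IsLocallyFiniteMeasure ρ := Measure.isLocallyFiniteMeasure_of_le hle
  have hac : ρ ≪ volume := (Measure.absolutelyContinuous_of_le hle).trans
    Measure.smul_absolutelyContinuous
  have hratio : ∀ u ∈ U, ∀ K : ℝ≥0, 1 < K → ∀ᶠ r in 𝓝[>] (0 : ℝ),
      ρ (Metric.closedBall u r) ≤
        (K : ℝ≥0∞) ^ 2 * (ENNReal.ofReal (areaFactor (ψ' u)) * volume (Metric.closedBall u r)) ∧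
      ENNReal.ofReal (areaFactor (ψ' u)) * volume (Metric.closedBall u r) ≤
        (K : ℝ≥0∞) ^ 2 * ρ (Metric.closedBall u r) := by
    intro u hu K hK
    have h1 := exists_lipschitz_compare (hd u hu) (hne u hu) hK
    rw [nhds_prod_eq] at h1
    obtain ⟨t, ht, hts⟩ := (eventually_prod_self_iff (r := fun x y => dist (ψ x) (ψ y) ≤ K * dist (ψ' u x) (ψ' u y) ∧
      dist (ψ' u x) (ψ' u y) ≤ K * dist (ψ x) (ψ y))).mp h1
    obtain ⟨R, hR, hRt⟩ := Metric.nhds_basis_closedBall.mem_iff.mp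
      (Filter.inter_mem ht (hU.mem_nhds hu))
    filter_upwards [Ioc_mem_nhdsGT hR] with r hr
    have hsub := (Metric.closedBall_subset_closedBall hr.2).trans hRt
    have hBU : Metric.closedBall u r ∩ U = Metric.closedBall u r :=
      inter_eq_left.mpr (hsub.trans inter_subset_right)
    rw [hρA _ Metric.isClosed_closedBall.measurableSet, hBU, ← measure_linear_image]
    exact ⟨euclideanHausdorffMeasure_image_le fun x hx y hy =>
        (hts x (hsub hx).1 y (hsub hy).1).1,
      euclideanHausdorffMeasure_image_le fun x hx y hy =>
        (hts x (hsub hx).1 y (hsub hy).1).2⟩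
  have hone : ∀ c : ℝ≥0∞, Tendsto (fun K : ℝ≥0 => (K : ℝ≥0∞) ^ 2 * c) (𝓝[>] 1) (𝓝 c) := by
    intro c
    have h1 : Tendsto (fun K : ℝ≥0 => ((K ^ 2 : ℝ≥0) : ℝ≥0∞)) (𝓝[>] 1) (𝓝 ((1 ^ 2 : ℝ≥0) : ℝ≥0∞)) :=
      ENNReal.tendsto_coe.mpr (((continuous_pow 2).tendsto 1).mono_left nhdsWithin_le_nhds)
    have h2 := ENNReal.Tendsto.mul_const (b := c) h1 (Or.inl (by simp))
    simpa using h2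
  have hder : ∀ᵐ u ∂(volume.restrict A), ρ.rnDeriv volume u =
      ENNReal.ofReal (areaFactor (ψ' u)) := by
    rw [ae_restrict_iff' hA]
    filter_upwards [Besicovitch.ae_tendsto_rnDeriv ρ volume] with u hu huA
    have huU := hAU huA
    have hpos : ∀ᶠ r in 𝓝[>] (0 : ℝ), volume (Metric.closedBall u r) ≠ 0 ∧
        volume (Metric.closedBall u r) ≠ ⊤ := by
      filter_upwards [self_mem_nhdsWithin] with r hr
      exact ⟨(Metric.measure_closedBall_pos _ _ hr).ne', measure_closedBall_lt_top.ne⟩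
    apply le_antisymm
    · refine ge_of_tendsto (hone _) ?_
      filter_upwards [self_mem_nhdsWithin] with K hK
      refine le_of_tendsto hu ?_
      filter_upwards [hratio u huU K hK, hpos] with r hr hv
      exact ENNReal.div_le_of_le_mul (by rw [mul_assoc]; exact hr.1)
    · refine ge_of_tendsto (hone _) ?_
      filter_upwards [self_mem_nhdsWithin] with K hK
      refine ge_of_tendsto (ENNReal.Tendsto.const_mul hu (Or.inr (by finiteness))) ?_
      filter_upwards [hratio u huU K hK, hpos] with r hr hv
      rw [← mul_div_assoc, ENNReal.le_div_iff_mul_le (Or.inl hv.1) (Or.inl hv.2)]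
      exact hr.2
  calc μHE[2] (ψ '' A) = ρ A := by rw [hρA A hA, inter_eq_left.mpr hAU]
    _ = ∫⁻ u in A, ρ.rnDeriv volume u := by
      rw [← withDensity_apply _ hA, Measure.withDensity_rnDeriv_eq ρ volume hac]
    _ = _ := lintegral_congr_ae hder

/-- The change of variables formula for a parametrized surface. -/
theorem setIntegral_image_eq (hU : IsOpen U) (hinj : InjOn ψ U) {K : ℝ≥0}
    (hL : LipschitzOnWith K ψ U) (hd : ∀ u ∈ U, HasStrictFDerivAt ψ (ψ' u) u)
    (hne : ∀ u ∈ U, areaFactor (ψ' u) ≠ 0) (hc : ContinuousOn ψ' U) {A : Set E2}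
    (hA : MeasurableSet A) (hAU : A ⊆ U) (g : E3 → ℝ) :
    ∫ x in ψ '' A, g x ∂μHE[2] = ∫ u in A, areaFactor (ψ' u) * g (ψ u) := by
  have hcont := hL.continuousOn.mono hAU
  have hemb := hcont.measurableEmbedding hA (hinj.mono hAU)
  have hmeas : AEMeasurable (fun u => (areaFactor (ψ' u)).toNNReal) (volume.restrict A) :=
    ((continuous_areaFactor.comp_continuousOn (hc.mono hAU)).aemeasurable hA).real_toNNReal
  have hmap : Measure.map (A.domRestrict ψ) (Measure.comap (↑)
      ((volume : Measure E2).withDensity fun u => ENNReal.ofReal (areaFactor (ψ' u)))) =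
      (μHE[2] : Measure E3).restrict (ψ '' A) := by
    ext B hB
    rw [hemb.map_apply, (MeasurableEmbedding.subtype_coe hA).comap_apply,
      Measure.restrict_apply hB]
    have h1 : Subtype.val '' (A.domRestrict ψ ⁻¹' B) = A ∩ ψ ⁻¹' B := by
      ext x; simp [and_comm]
    have h2 : MeasurableSet (A ∩ ψ ⁻¹' B) := by
      rw [← h1]
      exact (MeasurableEmbedding.subtype_coe hA).measurableSet_image.mpr (hemb.measurable hB)
    rw [h1, withDensity_apply _ h2, ← measure_image_eq_lintegral hU hinj hL hd hne h2
      (inter_subset_left.trans hAU), image_inter_preimage, inter_comm]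
  rw [← hmap, hemb.integral_map]
  simp only [Set.domRestrict_apply, ← Function.comp_apply (f := g), ENNReal.ofReal]
  rw [← (MeasurableEmbedding.subtype_coe hA).integral_map, map_comap_subtype_coe hA,
    setIntegral_withDensity_eq_setIntegral_smul₀ hmeas _ hA]
  congr with x
  rw [NNReal.smul_def, Real.coe_toNNReal _ (areaFactor_nonneg _), smul_eq_mul]

end area

end AnisotropicSurface

namespace AnisotropicSurface

/-! ### Parametrizations obtained from charts -/

/-- The inclusion of the parameter plane as the plane of the first two coordinates. -/
def planeIncl : E2 →L[ℝ] E3 :=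
  (EuclideanSpace.proj (0 : Fin 2) : E2 →L[ℝ] ℝ).smulRight (EuclideanSpace.single (0 : Fin 3) (1 : ℝ)) +
  (EuclideanSpace.proj (1 : Fin 2) : E2 →L[ℝ] ℝ).smulRight (EuclideanSpace.single (1 : Fin 3) (1 : ℝ))

/-- The projection to the first two coordinates. -/
def planeProj : E3 →L[ℝ] E2 :=
  (EuclideanSpace.proj (0 : Fin 3) : E3 →L[ℝ] ℝ).smulRight (EuclideanSpace.single (0 : Fin 2) (1 : ℝ)) +
  (EuclideanSpace.proj (1 : Fin 3) : E3 →L[ℝ] ℝ).smulRight (EuclideanSpace.single (1 : Fin 2) (1 : ℝ))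

@[simp] theorem planeIncl_zero (u : E2) : planeIncl u 0 = u 0 := by simp [planeIncl]
@[simp] theorem planeIncl_one (u : E2) : planeIncl u 1 = u 1 := by simp [planeIncl]
@[simp] theorem planeIncl_two (u : E2) : planeIncl u 2 = 0 := by simp [planeIncl]
@[simp] theorem planeProj_zero (x : E3) : planeProj x 0 = x 0 := by simp [planeProj]
@[simp] theorem planeProj_one (x : E3) : planeProj x 1 = x 1 := by simp [planeProj]

@[simp] theorem planeProj_planeIncl (u : E2) : planeProj (planeIncl u) = u := by
  ext i; fin_cases i <;> simp

theorem planeIncl_planeProj {x : E3} (hx : x 2 = 0) : planeIncl (planeProj x) = x := by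
  ext i; fin_cases i <;> simp [hx]

theorem planeIncl_single_zero :
    planeIncl (EuclideanSpace.single 0 1) = EuclideanSpace.single 0 1 := by
  ext i; fin_cases i <;> simp

theorem planeIncl_single_one :
    planeIncl (EuclideanSpace.single 1 1) = EuclideanSpace.single 1 1 := by
  ext i; fin_cases i <;> simp

section chart

variable (Φ : OpenPartialHomeomorph E3 E3)

/-- The parametrization of the coordinate surface `Φ · 2 = 0`. -/
def chartParam (u : E2) : E3 := Φ.symm (planeIncl u)

/-- The domain of `chartParam`. -/
def chartDomain : Set E2 := planeIncl ⁻¹' Φ.target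

/-- The derivative of `chartParam`. -/
def chartDeriv (u : E2) : E2 →L[ℝ] E3 := (fderiv ℝ Φ.symm (planeIncl u)).comp planeIncl

/-- The coordinate vector fields. -/
def chartFrame (i : Fin 3) (x : E3) : E3 := fderiv ℝ Φ.symm (Φ x) (EuclideanSpace.single i 1)

/-- A normal field of the coordinate surfaces. -/
def chartNormal (x : E3) : E3 := cross (chartFrame Φ 0 x) (chartFrame Φ 1 x)

/-- A unit normal field of the coordinate surfaces. -/
def chartUnitNormal (x : E3) : E3 := ‖chartNormal Φ x‖⁻¹ • chartNormal Φ x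

theorem isOpen_chartDomain : IsOpen (chartDomain Φ) :=
  Φ.open_target.preimage planeIncl.continuous

theorem planeProj_mem_chartDomain {x : E3} (hx : x ∈ Φ.source) (h2 : Φ x 2 = 0) :
    planeProj (Φ x) ∈ chartDomain Φ := by
  rw [chartDomain, mem_preimage, planeIncl_planeProj h2]
  exact Φ.map_source hx

theorem chartParam_planeProj {x : E3} (hx : x ∈ Φ.source) (h2 : Φ x 2 = 0) :
    chartParam Φ (planeProj (Φ x)) = x := by
  rw [chartParam, planeIncl_planeProj h2, Φ.left_inv hx]

theorem chartParam_mem_source {u : E2} (hu : u ∈ chartDomain Φ) : chartParam Φ u ∈ Φ.source :=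
  Φ.map_target hu

theorem apply_chartParam {u : E2} (hu : u ∈ chartDomain Φ) : Φ (chartParam Φ u) = planeIncl u :=
  Φ.right_inv hu

theorem injOn_chartParam : InjOn (chartParam Φ) (chartDomain Φ) := by
  intro u hu v hv h
  have := congrArg Φ h
  rw [apply_chartParam Φ hu, apply_chartParam Φ hv] at this
  simpa using congrArg planeProj this

variable {Φ} (hΦ : IsSmoothChart Φ)
include hΦ

theorem contDiffAt_chart {x : E3} (hx : x ∈ Φ.source) : ContDiffAt ℝ ∞ Φ x :=
  hΦ.smooth.contDiffAt (Φ.open_source.mem_nhds hx)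

theorem contDiffAt_chart_symm {y : E3} (hy : y ∈ Φ.target) : ContDiffAt ℝ ∞ Φ.symm y :=
  hΦ.smooth_symm.contDiffAt (Φ.open_target.mem_nhds hy)

theorem contDiffAt_chartParam {u : E2} (hu : u ∈ chartDomain Φ) :
    ContDiffAt ℝ ∞ (chartParam Φ) u :=
  (contDiffAt_chart_symm hΦ hu).comp u planeIncl.contDiff.contDiffAt

theorem hasFDerivAt_chart {x : E3} (hx : x ∈ Φ.source) : HasFDerivAt Φ (fderiv ℝ Φ x) x :=
  ((contDiffAt_chart hΦ hx).differentiableAt (by norm_num)).hasFDerivAt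

theorem hasFDerivAt_chartParam {u : E2} (hu : u ∈ chartDomain Φ) :
    HasFDerivAt (chartParam Φ) (chartDeriv Φ u) u :=
  ((contDiffAt_chart_symm hΦ hu).differentiableAt (by norm_num)).hasFDerivAt.comp u
    planeIncl.hasFDerivAt

theorem hasStrictFDerivAt_chartParam {u : E2} (hu : u ∈ chartDomain Φ) :
    HasStrictFDerivAt (chartParam Φ) (chartDeriv Φ u) u :=
  (contDiffAt_chartParam hΦ hu).hasStrictFDerivAt' (hasFDerivAt_chartParam hΦ hu) (by norm_num)

theorem contDiffAt_chartDeriv {u : E2} (hu : u ∈ chartDomain Φ) :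
    ContDiffAt ℝ ∞ (chartDeriv Φ) u := by
  have h := (contDiffAt_chart_symm hΦ hu).fderiv_right (m := ∞) (by norm_num)
  exact (h.comp u planeIncl.contDiff.contDiffAt).clm_comp contDiffAt_const

theorem fderiv_chart_frame {x : E3} (hx : x ∈ Φ.source) (v : E3) :
    fderiv ℝ Φ x (fderiv ℝ Φ.symm (Φ x) v) = v := by
  have hy := Φ.map_source hx
  have h1 := ((contDiffAt_chart_symm hΦ hy).differentiableAt (by norm_num)).hasFDerivAt
  have h2 : HasFDerivAt Φ (fderiv ℝ Φ x) (Φ.symm (Φ x)) := by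
    rw [Φ.left_inv hx]; exact hasFDerivAt_chart hΦ hx
  have h3 := (h2.comp _ h1).unique ((hasFDerivAt_id (Φ x)).congr_of_eventuallyEq
    (Φ.eventually_right_inverse hy))
  simpa using congrArg (fun L : E3 →L[ℝ] E3 => L v) h3

/-- The cofactor map of the derivative of `Φ` sends the product of the first two frame vectors to
the product of the first two coordinate vectors, which is the third one and not zero. -/
theorem chartNormal_ne_zero {x : E3} (hx : x ∈ Φ.source) : chartNormal Φ x ≠ 0 := by
  intro h
  have h1 := areaMap_cross (fderiv ℝ Φ x) (chartFrame Φ 0 x) (chartFrame Φ 1 x)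
  rw [← chartNormal, h, chartFrame, chartFrame, fderiv_chart_frame hΦ hx,
    fderiv_chart_frame hΦ hx] at h1
  have h2 := congrArg (fun v : E3 => v 2) h1
  simp [areaMap, cross_two] at h2

theorem contDiffAt_chartFrame {x : E3} (hx : x ∈ Φ.source) (i : Fin 3) :
    ContDiffAt ℝ ∞ (chartFrame Φ i) x := by
  have h := (contDiffAt_chart_symm hΦ (Φ.map_source hx)).fderiv_right (m := ∞) (by norm_num)
  exact (h.comp x (contDiffAt_chart hΦ hx)).clm_apply contDiffAt_const

theorem contDiffAt_chartNormal {x : E3} (hx : x ∈ Φ.source) :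
    ContDiffAt ℝ ∞ (chartNormal Φ) x :=
  ((crossL.contDiff.contDiffAt.comp x (contDiffAt_chartFrame hΦ hx 0)).clm_apply
    (contDiffAt_chartFrame hΦ hx 1) :)

theorem contDiffAt_chartUnitNormal {x : E3} (hx : x ∈ Φ.source) :
    ContDiffAt ℝ ∞ (chartUnitNormal Φ) x :=
  (((contDiffAt_chartNormal hΦ hx).norm ℝ (chartNormal_ne_zero hΦ hx)).inv
    (norm_ne_zero_iff.mpr (chartNormal_ne_zero hΦ hx))).smul (contDiffAt_chartNormal hΦ hx)

theorem norm_chartUnitNormal {x : E3} (hx : x ∈ Φ.source) : ‖chartUnitNormal Φ x‖ = 1 :=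
  norm_smul_inv_norm (𝕜 := ℝ) (chartNormal_ne_zero hΦ hx)

omit hΦ in
theorem chartDeriv_single_zero {u : E2} (hu : u ∈ chartDomain Φ) :
    chartDeriv Φ u (EuclideanSpace.single 0 1) = chartFrame Φ 0 (chartParam Φ u) := by
  rw [chartDeriv, ContinuousLinearMap.comp_apply, planeIncl_single_zero, chartFrame,
    apply_chartParam Φ hu]

omit hΦ in
theorem chartDeriv_single_one {u : E2} (hu : u ∈ chartDomain Φ) :
    chartDeriv Φ u (EuclideanSpace.single 1 1) = chartFrame Φ 1 (chartParam Φ u) := by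
  rw [chartDeriv, ContinuousLinearMap.comp_apply, planeIncl_single_one, chartFrame,
    apply_chartParam Φ hu]

omit hΦ in
theorem areaFactor_chartDeriv {u : E2} (hu : u ∈ chartDomain Φ) :
    areaFactor (chartDeriv Φ u) = ‖chartNormal Φ (chartParam Φ u)‖ := by
  rw [areaFactor, chartDeriv_single_zero hu, chartDeriv_single_one hu, chartNormal]

theorem areaFactor_chartDeriv_ne_zero {u : E2} (hu : u ∈ chartDomain Φ) :
    areaFactor (chartDeriv Φ u) ≠ 0 := by
  rw [areaFactor_chartDeriv hu]
  exact norm_ne_zero_iff.mpr (chartNormal_ne_zero hΦ (chartParam_mem_source Φ hu))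

/-- A set containing the coordinate surface has its tangent vectors in the tangent cone. -/
theorem frame_mem_tangentConeAt {x : E3} (hx : x ∈ Φ.source) (h2 : Φ x 2 = 0) {s : Set E3}
    (hs : ∀ y ∈ Φ.source, Φ y 2 = 0 → y ∈ s) (a b : ℝ) :
    a • chartFrame Φ 0 x + b • chartFrame Φ 1 x ∈ tangentConeAt ℝ s x := by
  have hu := planeProj_mem_chartDomain Φ hx h2
  have hxu := chartParam_planeProj Φ hx h2
  have h := (hasFDerivAt_chartParam hΦ hu).hasFDerivWithinAt.mapsTo_tangent_cone
    (s := chartDomain Φ)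
  rw [tangentConeAt_of_mem_nhds ((isOpen_chartDomain Φ).mem_nhds hu), hxu] at h
  have hmem := h (mem_univ (a • EuclideanSpace.single 0 1 + b • EuclideanSpace.single 1 1))
  rw [map_add, map_smul, map_smul, chartDeriv_single_zero hu, chartDeriv_single_one hu, hxu] at hmem
  refine tangentConeAt_mono ?_ hmem
  rintro _ ⟨u, hu, rfl⟩
  exact hs _ (chartParam_mem_source Φ hu) (by rw [apply_chartParam Φ hu, planeIncl_two])

end chart

/-! ### Point set properties of piecewise smooth surfaces -/

namespace PiecewiseSmoothSurface

variable (S : PiecewiseSmoothSurface)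

theorem face_subset (j : Fin S.N) : S.face j ⊆ S.carrier := by
  rw [S.carrier_eq]
  exact (subset_iUnion S.face j).trans subset_union_left

theorem edge_subset (i : Fin S.L) : S.edge i '' Icc 0 1 ⊆ S.carrier := by
  rw [S.carrier_eq]
  exact (subset_iUnion (fun i => S.edge i '' Icc 0 1) i).trans subset_union_right

theorem closure_face_subset (j : Fin S.N) : closure (S.face j) ⊆ S.carrier :=
  closure_minimal (S.face_subset j) S.isCompact.isClosed

theorem isCompact_closure_face (j : Fin S.N) : IsCompact (closure (S.face j)) :=
  S.isCompact.of_isClosed_subset isClosed_closure (S.closure_face_subset j)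

theorem isCompact_edge (i : Fin S.L) : IsCompact (S.edge i '' Icc 0 1) :=
  isCompact_Icc.image_of_continuousOn (S.edge_contDiffOn i).continuousOn

theorem face_chart' {j : Fin S.N} {p : E3} (hp : p ∈ S.face j) :
    ∃ Φ : OpenPartialHomeomorph E3 E3, IsSmoothChart Φ ∧ p ∈ Φ.source ∧
      (∀ x ∈ Φ.source, x ∈ S.face j ↔ Φ x 2 = 0) ∧
      ∀ x ∈ Φ.source, x ∈ S.carrier → x ∈ S.face j := by
  obtain ⟨Φ, hΦ, hpΦ, h⟩ := S.face_chart j p hp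
  exact ⟨Φ, hΦ, hpΦ, fun x hx => ⟨fun hj => (h x hx).1.mp (S.face_subset j hj),
    fun h2 => (h x hx).2 ((h x hx).1.mpr h2)⟩, fun x hx => (h x hx).2⟩

/-- The set is the union of the domains of the face charts, in which the surface consists of points
of the face only. Relative openness makes the faces Borel sets and lets bump functions be confined
to one face. -/
theorem exists_isOpen_face (j : Fin S.N) : ∃ U : Set E3, IsOpen U ∧ S.face j = U ∩ S.carrier := by
  choose Φ _ hp _ h using fun p : S.face j => S.face_chart' p.2
  refine ⟨⋃ p, (Φ p).source, isOpen_iUnion fun p => (Φ p).open_source, ?_⟩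
  ext x
  simp only [mem_inter_iff, mem_iUnion]
  exact ⟨fun hx => ⟨⟨⟨x, hx⟩, hp ⟨x, hx⟩⟩, S.face_subset j hx⟩,
    fun ⟨⟨p, hxp⟩, hx⟩ => h p x hxp hx⟩

theorem measurableSet_face (j : Fin S.N) : MeasurableSet (S.face j) := by
  obtain ⟨U, hU, h⟩ := S.exists_isOpen_face j
  rw [h]
  exact hU.measurableSet.inter S.isCompact.isClosed.measurableSet

/-- A limit point of the face `j` lying in another face would have a neighbourhood in which the
surface is that other face. At a point of an open edge the surface nearby is made of the two
adjacent faces and the edge, so `j` must be one of them. -/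
theorem closure_face_cases {j : Fin S.N} {p : E3} (hp : p ∈ closure (S.face j)) :
    p ∈ S.face j ∨ (∃ i, ∃ t ∈ Ioo (0 : ℝ) 1, p = S.edge i t ∧ (S.left i = j ∨ S.right i = j)) ∨
      ∃ i, ∃ t ∈ ({0, 1} : Set ℝ), p = S.edge i t := by
  have hc := S.closure_face_subset j hp
  rw [S.carrier_eq] at hc
  rcases hc with hc | hc
  · obtain ⟨k, hk⟩ := mem_iUnion.mp hc
    rcases eq_or_ne k j with rfl | hkj
    · exact Or.inl hk
    obtain ⟨Φ, -, hpΦ, -, h⟩ := S.face_chart' hk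
    obtain ⟨x, hxΦ, hxj⟩ := mem_closure_iff.mp hp _ Φ.open_source hpΦ
    exact ((S.face_disjoint hkj).ne_of_mem (h x hxΦ (S.face_subset j hxj)) hxj rfl).elim
  · obtain ⟨i, t, ht, rfl⟩ := mem_iUnion.mp hc
    rcases eq_or_lt_of_le ht.1 with h0 | h0
    · exact Or.inr (Or.inr ⟨i, t, by simp [← h0], rfl⟩)
    rcases eq_or_lt_of_le ht.2 with h1 | h1
    · exact Or.inr (Or.inr ⟨i, t, by simp [h1], rfl⟩)
    refine Or.inr (Or.inl ⟨i, t, ⟨h0, h1⟩, rfl, ?_⟩)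
    obtain ⟨Φ, Ψ, -, -, hΦ, hΨ, -, -, h⟩ := S.edge_chart i t ⟨h0, h1⟩
    obtain ⟨x, hx, hxj⟩ := mem_closure_iff.mp hp _ (Φ.open_source.inter Ψ.open_source) ⟨hΦ, hΨ⟩
    rcases h x hx (S.face_subset j hxj) with h | h | h
    · left
      by_contra hne
      exact (S.face_disjoint hne).ne_of_mem h hxj rfl
    · exact ((S.face_edge_disjoint j i).ne_of_mem hxj (image_mono Ioo_subset_Icc_self h) rfl).elim
    · right
      by_contra hne
      exact (S.face_disjoint hne).ne_of_mem h hxj rfl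

/-- A chart in which the face `j` is contained in the coordinate surface. -/
structure IsFaceChart (j : Fin S.N) (Φ : OpenPartialHomeomorph E3 E3) : Prop where
  isSmoothChart : IsSmoothChart Φ
  eq_zero : ∀ x ∈ Φ.source, x ∈ S.face j → Φ x 2 = 0

theorem exists_isFaceChart {j : Fin S.N} {p : E3} (hp : p ∈ closure (S.face j)) :
    ∃ Φ, S.IsFaceChart j Φ ∧ p ∈ Φ.source := by
  rcases S.closure_face_cases hp with hp | ⟨i, t, ht, rfl, h⟩ | ⟨i, t, ht, rfl⟩
  · obtain ⟨Φ, hΦ, hpΦ, h, -⟩ := S.face_chart' hp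
    exact ⟨Φ, ⟨hΦ, fun x hx => (h x hx).mp⟩, hpΦ⟩
  · obtain ⟨Φ, Ψ, hΦ, hΨ, hpΦ, hpΨ, h1, h2, -⟩ := S.edge_chart i t ht
    rcases h with rfl | rfl
    · exact ⟨Φ, ⟨hΦ, fun x hx hxj => ((h1 x hx).1.mp hxj).1⟩, hpΦ⟩
    · exact ⟨Ψ, ⟨hΨ, fun x hx hxj => ((h2 x hx).1.mp hxj).1⟩, hpΨ⟩
  · obtain ⟨Φ, hΦ, hpΦ, h⟩ := S.vertex_chart i t ht j
    exact ⟨Φ, ⟨hΦ, h⟩, hpΦ⟩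

variable {S}

/-- The tangent cone of a face contains the plane orthogonal to the normal. -/
theorem mem_tangentConeAt_of_inner_eq_zero {j : Fin S.N} {p : E3} (hp : p ∈ S.face j) {v : E3}
    (hv : ⟪S.normal j p, v⟫ = 0) : v ∈ tangentConeAt ℝ (S.face j) p := by
  obtain ⟨Φ, hΦ, hpΦ, h, -⟩ := S.face_chart' hp
  have h2 := (h p hpΦ).mp hp
  have hcone := frame_mem_tangentConeAt hΦ hpΦ h2 (s := S.face j) fun y hy => (h y hy).mpr
  have h0 := S.normal_perp j p hp _ (hcone 1 0)
  have h1 := S.normal_perp j p hp _ (hcone 0 1)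
  simp only [one_smul, zero_smul, add_zero, zero_add] at h0 h1
  have hN := chartNormal_ne_zero hΦ hpΦ
  have hn := eq_smul_cross hN h0 h1
  set c := ⟪S.normal j p, cross (chartFrame Φ 0 p) (chartFrame Φ 1 p)⟫ /
    ‖cross (chartFrame Φ 0 p) (chartFrame Φ 1 p)‖ ^ 2
  have hc : c ≠ 0 := by
    intro hc
    have := S.norm_normal j p (subset_closure hp)
    rw [hn, hc] at this
    simp at this
  rw [hn, inner_smul_left] at hv
  obtain ⟨a, b, rfl⟩ := ortho_decomp hN (by simpa [hc] using hv)
  exact hcone a b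

/-- The third coordinate of `Φ` vanishes on the face, so its differential `l` kills the tangent
plane and is a nonzero multiple of the inner product with the normal. The first two frame vectors
lie in the kernel of `l`; hence the normal is parallel to their vector product. -/
theorem IsFaceChart.normal_eq {j : Fin S.N} {Φ : OpenPartialHomeomorph E3 E3}
    (h : S.IsFaceChart j Φ) {p : E3} (hp : p ∈ S.face j) (hpΦ : p ∈ Φ.source) :
    S.normal j p = ⟪S.normal j p, chartUnitNormal Φ p⟫ • chartUnitNormal Φ p ∧
      ⟪S.normal j p, chartUnitNormal Φ p⟫ ^ 2 = 1 := by
  have hΦ := h.isSmoothChart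
  have hnorm := S.norm_normal j p (subset_closure hp)
  set n := S.normal j p
  set l : E3 →L[ℝ] ℝ := (EuclideanSpace.proj (2 : Fin 3) : E3 →L[ℝ] ℝ).comp (fderiv ℝ Φ p) with hl
  have hd : HasFDerivWithinAt (fun x => Φ x 2) l (S.face j) p :=
    ((EuclideanSpace.proj (2 : Fin 3) : E3 →L[ℝ] ℝ).hasFDerivAt.comp p
      (hasFDerivAt_chart hΦ hpΦ)).hasFDerivWithinAt
  have hd0 : HasFDerivWithinAt (fun x => Φ x 2) (0 : E3 →L[ℝ] ℝ) (S.face j) p := by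
    refine (hasFDerivWithinAt_const (0 : ℝ) p (S.face j)).congr_of_eventuallyEq ?_
      (h.eq_zero p hpΦ hp)
    filter_upwards [self_mem_nhdsWithin,
      mem_nhdsWithin_of_mem_nhds (Φ.open_source.mem_nhds hpΦ)] with x hx hxΦ
    exact h.eq_zero x hxΦ hx
  have hperp : ∀ v, ⟪n, v⟫ = 0 → l v = 0 := fun v hv =>
    hd.unique_on hd0 (mem_tangentConeAt_of_inner_eq_zero hp hv)
  have hlv : ∀ v, l v = ⟪n, v⟫ * l n := by
    intro v
    have := hperp (tangentProj n v) (inner_tangentProj hnorm v)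
    rw [tangentProj_apply, map_sub, map_smul, sub_eq_zero] at this
    simpa using this
  -- Otherwise `l` would vanish identically, although it equals 1 on the third frame vector.
  have hln : l n ≠ 0 := by
    intro h0
    have h1 := hlv (chartFrame Φ 2 p)
    rw [h0, mul_zero, hl, ContinuousLinearMap.comp_apply, chartFrame,
      fderiv_chart_frame hΦ hpΦ] at h1
    simp at h1
  have hf : ∀ i : Fin 3, i ≠ 2 → ⟪n, chartFrame Φ i p⟫ = 0 := by
    intro i hi
    have h1 := hlv (chartFrame Φ i p)
    rw [hl, ContinuousLinearMap.comp_apply, chartFrame, fderiv_chart_frame hΦ hpΦ] at h1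
    have h2 : (EuclideanSpace.proj (2 : Fin 3) : E3 →L[ℝ] ℝ) (EuclideanSpace.single i 1) = 0 := by
      simp [hi.symm]
    rw [h2] at h1
    exact (mul_eq_zero.mp h1.symm).resolve_right hln
  have hN := chartNormal_ne_zero hΦ hpΦ
  have hn := eq_smul_cross hN (hf 0 (by decide)) (hf 1 (by decide))
  rw [← chartNormal] at hn
  have hN' : ‖chartNormal Φ p‖ ≠ 0 := norm_ne_zero_iff.mpr hN
  have h1 : n = ⟪n, chartUnitNormal Φ p⟫ • chartUnitNormal Φ p := by
    conv_lhs => rw [hn]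
    rw [chartUnitNormal, inner_smul_right, smul_smul]
    congr 1
    field_simp
  refine ⟨h1, ?_⟩
  have h2 := congrArg (fun v => ‖v‖ ^ 2) h1
  simp only [norm_smul, norm_chartUnitNormal hΦ hpΦ, hnorm, mul_one, Real.norm_eq_abs, sq_abs] at h2
  linarith

/-- Near a point of the closure of a face, the normal is a chart normal up to a constant sign. -/
theorem IsFaceChart.exists_sign {j : Fin S.N} {Φ : OpenPartialHomeomorph E3 E3}
    (h : S.IsFaceChart j Φ) {p : E3} (hp : p ∈ closure (S.face j)) (hpΦ : p ∈ Φ.source) :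
    ∃ σ : ℝ, σ ^ 2 = 1 ∧
      ∀ᶠ x in 𝓝[closure (S.face j)] p, S.normal j x = σ • chartUnitNormal Φ x := by
  have hΦ := h.isSmoothChart
  set s := closure (S.face j) ∩ Φ.source with hs
  set f : E3 → ℝ := fun x => ⟪S.normal j x, chartUnitNormal Φ x⟫ with hf
  have hNc : ContinuousOn (chartUnitNormal Φ) s := fun x hx =>
    (contDiffAt_chartUnitNormal hΦ hx.2).continuousAt.continuousWithinAt
  have hnc : ContinuousOn (S.normal j) s := (S.normal_continuousOn j).mono inter_subset_left
  have hfc : ContinuousOn f s := hnc.inner hNc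
  -- Points of the face are dense in `s`, so the relation between the two unit normals passes to the
  -- closure by continuity.
  have hdense : ∀ x ∈ s, x ∈ closure (S.face j ∩ Φ.source) := fun x hx => by
    rw [inter_comm]
    exact Φ.open_source.inter_closure ⟨hx.2, hx.1⟩
  have hall : ∀ x ∈ s, S.normal j x = f x • chartUnitNormal Φ x ∧ f x ^ 2 = 1 := by
    intro x hx
    have hne : (𝓝[S.face j ∩ Φ.source] x).NeBot := mem_closure_iff_nhdsWithin_neBot.mp (hdense x hx)
    have hsub : S.face j ∩ Φ.source ⊆ s := inter_subset_inter_left _ subset_closure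
    have hev : ∀ᶠ y in 𝓝[S.face j ∩ Φ.source] x,
        S.normal j y = f y • chartUnitNormal Φ y ∧ f y ^ 2 = 1 := by
      filter_upwards [self_mem_nhdsWithin] with y hy
      exact h.normal_eq hy.1 hy.2
    have t1 := (hnc x hx).mono hsub
    have t2 := ((hfc x hx).smul (hNc x hx)).mono hsub
    have t3 := ((hfc x hx).pow 2).mono hsub
    refine ⟨tendsto_nhds_unique_of_eventuallyEq t1 t2 (hev.mono fun y hy => hy.1), ?_⟩
    exact tendsto_nhds_unique_of_eventuallyEq t3 tendsto_const_nhds (hev.mono fun y hy => hy.2)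
  refine ⟨f p, (hall p ⟨hp, hpΦ⟩).2, ?_⟩
  -- The function `f` takes only the values 1 and -1, so values at distance less than 1 coincide.
  have hnear : ∀ᶠ x in 𝓝[s] p, dist (f x) (f p) < 1 :=
    (hfc p ⟨hp, hpΦ⟩).eventually (Metric.ball_mem_nhds _ one_pos)
  rw [hs, nhdsWithin_inter_of_mem' (mem_nhdsWithin_of_mem_nhds (Φ.open_source.mem_nhds hpΦ))] at hnear
  filter_upwards [hnear, self_mem_nhdsWithin,
    mem_nhdsWithin_of_mem_nhds (Φ.open_source.mem_nhds hpΦ)] with x hx hxc hxΦ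
  rw [(hall x ⟨hxc, hxΦ⟩).1]
  congr 1
  have e1 := (hall x ⟨hxc, hxΦ⟩).2
  have e2 := (hall p ⟨hp, hpΦ⟩).2
  rw [Real.dist_eq, abs_lt] at hx
  rcases sq_eq_sq_iff_eq_or_eq_neg.mp (e1.trans e2.symm) with e | e
  · exact e
  · rw [e] at hx
    nlinarith

/-- Continuity of the normal is assumed, smoothness is not. It follows because locally the normal is
a constant sign times the smooth unit normal of a chart. -/
theorem normal_contDiffOn (j : Fin S.N) : ContDiffOn ℝ ∞ (S.normal j) (closure (S.face j)) := by
  intro p hp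
  obtain ⟨Φ, h, hpΦ⟩ := S.exists_isFaceChart hp
  obtain ⟨σ, -, hσ⟩ := h.exists_sign hp hpΦ
  refine ((contDiffAt_const (c := σ)).smul
    (contDiffAt_chartUnitNormal h.isSmoothChart hpΦ)).contDiffWithinAt.congr_of_eventuallyEq hσ ?_
  exact hσ.self_of_nhdsWithin hp

end PiecewiseSmoothSurface

end AnisotropicSurface

namespace AnisotropicSurface

namespace PiecewiseSmoothSurface

open scoped NNReal ENNReal

variable {S : PiecewiseSmoothSurface} {j : Fin S.N}
variable {F G H : Type*} [NormedAddCommGroup F] [NormedSpace ℝ F] [NormedAddCommGroup G]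
  [NormedSpace ℝ G] [NormedAddCommGroup H] [NormedSpace ℝ H]

/-! ### Fields on a face -/

theorem norm_normal_face {p : E3} (hp : p ∈ S.face j) : ‖S.normal j p‖ = 1 :=
  S.norm_normal j p (subset_closure hp)

variable (S j) in
/-- The tangential part of the derivative of a map within a face. -/
def tderiv (f : E3 → F) (p : E3) : E3 →L[ℝ] F :=
  (fderivWithin ℝ f (S.face j) p).comp (tangentProj (S.normal j p))

theorem fderivWithin_apply_eq {f : E3 → F} {D : E3 →L[ℝ] F} {p : E3} (hp : p ∈ S.face j)
    (hf : HasFDerivWithinAt f D (S.face j) p) {v : E3} (hv : ⟪S.normal j p, v⟫ = 0) :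
    fderivWithin ℝ f (S.face j) p v = D v :=
  hf.differentiableWithinAt.hasFDerivWithinAt.unique_on hf
    (mem_tangentConeAt_of_inner_eq_zero hp hv)

theorem tderiv_eq {f : E3 → F} {D : E3 →L[ℝ] F} {p : E3} (hp : p ∈ S.face j)
    (hf : HasFDerivWithinAt f D (S.face j) p) :
    S.tderiv j f p = D.comp (tangentProj (S.normal j p)) := by
  ext v
  exact fderivWithin_apply_eq hp hf (inner_tangentProj (norm_normal_face hp) v)

theorem tderiv_apply {f : E3 → F} {p v : E3} (hv : ⟪S.normal j p, v⟫ = 0) :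
    S.tderiv j f p v = fderivWithin ℝ f (S.face j) p v := by
  rw [tderiv, ContinuousLinearMap.comp_apply, tangentProj_eq_self hv]

theorem continuousOn_tangentProj : ContinuousOn (fun p => tangentProj (S.normal j p)) (S.face j) :=
  continuous_tangentProj.comp_continuousOn ((S.normal_continuousOn j).mono subset_closure)

variable (S j) in
/-- A map on a face, continuous up to the boundary and with continuous and bounded tangential
derivative on the face. -/
structure IsFaceField (f : E3 → F) : Prop where
  continuousOn : ContinuousOn f (closure (S.face j))
  differentiableOn : DifferentiableOn ℝ f (S.face j)
  continuousOn_tderiv : ContinuousOn (S.tderiv j f) (S.face j)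
  bounded : ∃ C, ∀ p ∈ S.face j, ‖S.tderiv j f p‖ ≤ C

/-- Tangential derivatives live on the open face, which is not compact. Local bounds near the points
of its compact closure give a global one. -/
theorem exists_bound_of_locally_bounded {g : E3 → ℝ}
    (h : ∀ p ∈ closure (S.face j), ∃ C, ∀ᶠ x in 𝓝[S.face j] p, g x ≤ C) :
    ∃ C, ∀ x ∈ S.face j, g x ≤ C := by
  have := (S.isCompact_closure_face j).induction_on
    (p := fun t => ∃ C, ∀ x ∈ t ∩ S.face j, g x ≤ C) ⟨0, by simp⟩
    (fun s t hst ⟨C, hC⟩ => ⟨C, fun x hx => hC x ⟨hst hx.1, hx.2⟩⟩)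
    (fun s t ⟨C, hC⟩ ⟨C', hC'⟩ => ⟨max C C', by
      rintro x ⟨hx | hx, hxf⟩
      · exact (hC x ⟨hx, hxf⟩).trans (le_max_left _ _)
      · exact (hC' x ⟨hx, hxf⟩).trans (le_max_right _ _)⟩)
    (fun p hp => by
      obtain ⟨C, hC⟩ := h p hp
      obtain ⟨u, hu, huC⟩ := eventually_nhdsWithin_iff.mp hC |>.exists_mem
      exact ⟨u, mem_nhdsWithin_of_mem_nhds hu, C, fun x hx => huC x hx.1 hx.2⟩)
  obtain ⟨C, hC⟩ := this
  exact ⟨C, fun x hx => hC x ⟨subset_closure hx, hx⟩⟩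

theorem IsFaceField.exists_bound {f : E3 → F} (hf : S.IsFaceField j f) :
    ∃ C, 0 ≤ C ∧ ∀ p ∈ closure (S.face j), ‖f p‖ ≤ C := by
  obtain ⟨C, hC⟩ := (S.isCompact_closure_face j).exists_bound_of_continuousOn hf.continuousOn
  exact ⟨max C 0, le_max_right _ _, fun p hp => (hC p hp).trans (le_max_left _ _)⟩

theorem IsFaceField.hasFDerivWithinAt {f : E3 → F} (hf : S.IsFaceField j f) {p : E3}
    (hp : p ∈ S.face j) : HasFDerivWithinAt f (fderivWithin ℝ f (S.face j) p) (S.face j) p :=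
  (hf.differentiableOn p hp).hasFDerivWithinAt

/-- At a point of the closure there is a local derivative within the closed face that is continuous
up to that point. It need not be unique, but composed with the tangential projection it is `tderiv`,
which inherits continuity inside the face and boundedness near the boundary. -/
theorem isFaceField_of_contDiffOn {f : E3 → F} (hf : ContDiffOn ℝ 1 f (closure (S.face j))) :
    S.IsFaceField j f := by
  have hloc : ∀ p ∈ closure (S.face j), ∃ f' : E3 → E3 →L[ℝ] F,
      (∀ᶠ x in 𝓝[S.face j] p, S.tderiv j f x = (f' x).comp (tangentProj (S.normal j x))) ∧
      ContinuousWithinAt f' (closure (S.face j)) p := by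
    intro p hp
    have h := hf p hp
    rw [show (1 : ℕ∞ω) = 0 + 1 by norm_num,
      contDiffWithinAt_succ_iff_hasFDerivWithinAt' (by norm_num)] at h
    obtain ⟨u, hu, -, -, f', hf', hf'c⟩ := h
    refine ⟨f', ?_, hf'c.continuousWithinAt⟩
    rw [insert_eq_of_mem hp] at hu
    filter_upwards [nhdsWithin_mono p subset_closure hu, self_mem_nhdsWithin] with x hxu hx
    exact tderiv_eq hx ((hf' x hxu).mono subset_closure)
  refine ⟨hf.continuousOn, (hf.differentiableOn one_ne_zero).mono subset_closure, ?_, ?_⟩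
  · intro p hp
    obtain ⟨f', h1, h2⟩ := hloc p (subset_closure hp)
    exact ((h2.mono subset_closure).clm_comp (continuousOn_tangentProj p hp)).congr_of_eventuallyEq
      h1 (h1.self_of_nhdsWithin hp)
  · refine exists_bound_of_locally_bounded fun p hp => ?_
    obtain ⟨f', h1, h2⟩ := hloc p hp
    refine ⟨(‖f' p‖ + 1) * 2, ?_⟩
    have h3 : ∀ᶠ x in 𝓝[S.face j] p, ‖f' x‖ < ‖f' p‖ + 1 :=
      (h2.mono subset_closure).norm.eventually (gt_mem_nhds (lt_add_one _))
    filter_upwards [h1, h3, self_mem_nhdsWithin] with x hx hx' hxf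
    rw [hx]
    refine (ContinuousLinearMap.opNorm_comp_le _ _).trans ?_
    have := norm_tangentProj_le (norm_normal_face hxf)
    gcongr

theorem isFaceField_of_contDiff {f : E3 → F} (hf : ContDiff ℝ ∞ f) : S.IsFaceField j f :=
  isFaceField_of_contDiffOn (hf.contDiffOn.of_le (by norm_num))

theorem isFaceField_normal : S.IsFaceField j (S.normal j) :=
  isFaceField_of_contDiffOn ((S.normal_contDiffOn j).of_le (by norm_num))

theorem IsFaceField.tderiv_bilinear (B : F →L[ℝ] G →L[ℝ] H) {f : E3 → F} {g : E3 → G}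
    (hf : S.IsFaceField j f) (hg : S.IsFaceField j g) {p : E3} (hp : p ∈ S.face j) :
    S.tderiv j (fun x => B (f x) (g x)) p =
      (B.flip (g p)).comp (S.tderiv j f p) + (B (f p)).comp (S.tderiv j g p) := by
  rw [tderiv_eq hp (B.hasFDerivWithinAt_of_bilinear (hf.hasFDerivWithinAt hp)
    (hg.hasFDerivWithinAt hp))]
  ext v
  simp [tderiv, add_comm]

theorem IsFaceField.bilinear (B : F →L[ℝ] G →L[ℝ] H) {f : E3 → F} {g : E3 → G}
    (hf : S.IsFaceField j f) (hg : S.IsFaceField j g) :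
    S.IsFaceField j (fun x => B (f x) (g x)) where
  continuousOn := (B.continuous.comp_continuousOn hf.continuousOn).clm_apply hg.continuousOn
  differentiableOn p hp := (B.hasFDerivWithinAt_of_bilinear (hf.hasFDerivWithinAt hp)
    (hg.hasFDerivWithinAt hp)).differentiableWithinAt
  continuousOn_tderiv := by
    have h1 : ContinuousOn (fun p => (B.flip (g p)).comp (S.tderiv j f p) +
        (B (f p)).comp (S.tderiv j g p)) (S.face j) :=
      ((B.flip.continuous.comp_continuousOn
        (hg.continuousOn.mono subset_closure)).clm_comp hf.continuousOn_tderiv).add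
      ((B.continuous.comp_continuousOn
        (hf.continuousOn.mono subset_closure)).clm_comp hg.continuousOn_tderiv)
    exact h1.congr fun p hp => hf.tderiv_bilinear B hg hp
  bounded := by
    obtain ⟨Cf, hCf0, hCf⟩ := hf.exists_bound
    obtain ⟨Cg, hCg0, hCg⟩ := hg.exists_bound
    obtain ⟨Df, hDf⟩ := hf.bounded
    obtain ⟨Dg, hDg⟩ := hg.bounded
    refine ⟨‖B.flip‖ * Cg * Df + ‖B‖ * Cf * Dg, fun p hp => ?_⟩
    have h1 := hCf p (subset_closure hp)
    have h2 := hCg p (subset_closure hp)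
    have h3 := hDf p hp
    have h4 := hDg p hp
    rw [hf.tderiv_bilinear B hg hp]
    refine (norm_add_le _ _).trans (add_le_add ?_ ?_)
    · refine (ContinuousLinearMap.opNorm_comp_le _ _).trans ?_
      have := B.flip.le_of_opNorm_le_of_le le_rfl h2
      gcongr
    · refine (ContinuousLinearMap.opNorm_comp_le _ _).trans ?_
      have := B.le_of_opNorm_le_of_le le_rfl h1
      gcongr

theorem IsFaceField.tderiv_add {f g : E3 → F} (hf : S.IsFaceField j f) (hg : S.IsFaceField j g)
    {p : E3} (hp : p ∈ S.face j) :
    S.tderiv j (fun x => f x + g x) p = S.tderiv j f p + S.tderiv j g p := by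
  have h : HasFDerivWithinAt (fun x => f x + g x) _ (S.face j) p :=
    (hf.hasFDerivWithinAt hp).add (hg.hasFDerivWithinAt hp)
  rw [tderiv_eq hp h]
  ext v
  simp [tderiv]

theorem IsFaceField.add {f g : E3 → F} (hf : S.IsFaceField j f) (hg : S.IsFaceField j g) :
    S.IsFaceField j (fun x => f x + g x) where
  continuousOn := hf.continuousOn.add hg.continuousOn
  differentiableOn := hf.differentiableOn.add hg.differentiableOn
  continuousOn_tderiv := (hf.continuousOn_tderiv.add hg.continuousOn_tderiv).congr fun _ hp =>
    hf.tderiv_add hg hp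
  bounded := by
    obtain ⟨C, hC⟩ := hf.bounded
    obtain ⟨C', hC'⟩ := hg.bounded
    refine ⟨C + C', fun p hp => ?_⟩
    rw [hf.tderiv_add hg hp]
    exact (norm_add_le _ _).trans (add_le_add (hC p hp) (hC' p hp))

theorem IsFaceField.smul {χ : E3 → ℝ} {f : E3 → F} (hχ : ContDiff ℝ ∞ χ) (hf : S.IsFaceField j f) :
    S.IsFaceField j (fun x => χ x • f x) :=
  IsFaceField.bilinear (ContinuousLinearMap.lsmul ℝ ℝ) (isFaceField_of_contDiff hχ) hf

theorem IsFaceField.cross {f g : E3 → E3} (hf : S.IsFaceField j f) (hg : S.IsFaceField j g) :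
    S.IsFaceField j (fun x => cross (f x) (g x)) :=
  hf.bilinear crossL hg

theorem tderiv_eq_zero {f : E3 → F} {p : E3} (hp : p ∈ S.face j)
    (h : ∀ᶠ x in 𝓝[S.face j] p, f x = 0) : S.tderiv j f p = 0 := by
  have h1 : HasFDerivWithinAt f (0 : E3 →L[ℝ] F) (S.face j) p :=
    (hasFDerivWithinAt_const (0 : F) p (S.face j)).congr_of_eventuallyEq h
      (h.self_of_nhdsWithin hp)
  rw [tderiv_eq hp h1, ContinuousLinearMap.zero_comp]

/-- The curl of a field on a face, in the direction of the normal. -/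
theorem inner_curlVec_eq_tderiv {f : E3 → E3} {p : E3} (hp : p ∈ S.face j) :
    ⟪curlVec (fderivWithin ℝ f (S.face j) p), S.normal j p⟫ =
      ⟪curlVec (S.tderiv j f p), S.normal j p⟫ :=
  inner_curlVec_congr (norm_normal_face hp) fun _ hv => (tderiv_apply hv).symm

/-! ### The area of faces -/

theorem exists_chart_box {Φ : OpenPartialHomeomorph E3 E3} (hΦ : IsSmoothChart Φ) {p : E3}
    (hp : p ∈ Φ.source) (h2 : Φ p 2 = 0) :
    ∃ U : Set E2, ∃ K : ℝ≥0, IsOpen U ∧ U ⊆ chartDomain Φ ∧ LipschitzOnWith K (chartParam Φ) U ∧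
      ∀ᶠ x in 𝓝 p, x ∈ Φ.source ∧ planeProj (Φ x) ∈ U := by
  have hu := planeProj_mem_chartDomain Φ hp h2
  obtain ⟨K, t, ht, hK⟩ := (hasStrictFDerivAt_chartParam hΦ hu).exists_lipschitzOnWith
  obtain ⟨U, hUt, hU, huU⟩ := mem_nhds_iff.mp
    (Filter.inter_mem ht ((isOpen_chartDomain Φ).mem_nhds hu))
  refine ⟨U, K, hU, hUt.trans inter_subset_right, hK.mono (hUt.trans inter_subset_left), ?_⟩
  have hc : ContinuousAt (fun x => planeProj (Φ x)) p :=
    planeProj.continuous.continuousAt.comp (contDiffAt_chart hΦ hp).continuousAt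
  exact (Φ.open_source.eventually_mem hp).and (hc.eventually (hU.mem_nhds huU))

theorem eq_zero_of_mem_closure {Φ : OpenPartialHomeomorph E3 E3} (h : S.IsFaceChart j Φ) {p : E3}
    (hp : p ∈ closure (S.face j)) (hpΦ : p ∈ Φ.source) : Φ p 2 = 0 := by
  have hne : (𝓝[S.face j] p).NeBot := mem_closure_iff_nhdsWithin_neBot.mp hp
  have h1 : Filter.Tendsto (fun x => Φ x 2) (𝓝 p) (𝓝 (Φ p 2)) :=
    (EuclideanSpace.proj (2 : Fin 3) : E3 →L[ℝ] ℝ).continuous.continuousAt.comp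
      (contDiffAt_chart h.isSmoothChart hpΦ).continuousAt
  refine tendsto_nhds_unique_of_eventuallyEq (l := 𝓝[S.face j] p) (h1.mono_left nhdsWithin_le_nhds)
    (tendsto_const_nhds (x := (0 : ℝ))) ?_
  filter_upwards [self_mem_nhdsWithin,
    mem_nhdsWithin_of_mem_nhds (Φ.open_source.mem_nhds hpΦ)] with x hx hxΦ
  exact h.eq_zero x hxΦ hx

variable (S j) in
/-- Near every point, the area of a face grows at most quadratically. -/
theorem measure_face_inter_ball_le (v : E3) : ∃ C : ℝ, 0 ≤ C ∧ ∃ r₀ > 0, ∀ r, 0 < r → r < r₀ →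
    μHE[2] (S.face j ∩ Metric.ball v r) ≤ ENNReal.ofReal (C * r ^ 2) := by
  by_cases hv : v ∈ closure (S.face j)
  · obtain ⟨Φ, h, hvΦ⟩ := S.exists_isFaceChart hv
    obtain ⟨U, K, -, hUD, hK, hev⟩ := exists_chart_box h.isSmoothChart hvΦ
      (eq_zero_of_mem_closure h hv hvΦ)
    have hc : ContDiffAt ℝ 1 (fun x => planeProj (Φ x)) v :=
      planeProj.contDiff.contDiffAt.comp v
        ((contDiffAt_chart h.isSmoothChart hvΦ).of_le (by norm_num))
    obtain ⟨k, t, ht, hk⟩ := hc.exists_lipschitzOnWith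
    obtain ⟨r₀, hr₀, hball⟩ := Metric.mem_nhds_iff.mp (Filter.inter_mem ht hev)
    set c := (MeasureTheory.volume (Metric.ball (0 : E2) 1)).toReal
    -- Here `k` and `K` are Lipschitz constants of the chart and of its parametrization. The piece
    -- of the face is the image of a plane set contained in a disc of radius `k * r`, and `c` is the
    -- area of the unit disc.
    refine ⟨K ^ 2 * (k ^ 2 * c), by positivity, r₀, hr₀, fun r hr hrr => ?_⟩
    set A := planeProj ∘ Φ '' (S.face j ∩ Metric.ball v r)
    have hsub : ∀ x ∈ S.face j ∩ Metric.ball v r,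
        x ∈ t ∧ x ∈ Φ.source ∧ planeProj (Φ x) ∈ U := fun x hx =>
      hball (Metric.ball_subset_ball hrr.le hx.2)
    have hvt : v ∈ t := mem_of_mem_nhds ht
    have hAU : A ⊆ U := by
      rintro _ ⟨x, hx, rfl⟩
      exact (hsub x hx).2.2
    have himg : S.face j ∩ Metric.ball v r ⊆ chartParam Φ '' A := by
      intro x hx
      exact ⟨_, ⟨x, hx, rfl⟩, chartParam_planeProj Φ (hsub x hx).2.1
        (h.eq_zero x (hsub x hx).2.1 hx.1)⟩
    have hAball : A ⊆ Metric.closedBall (planeProj (Φ v)) (k * r) := by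
      rintro _ ⟨x, hx, rfl⟩
      refine (hk.dist_le_mul x (hsub x hx).1 v hvt).trans ?_
      gcongr
      exact (Metric.mem_ball.mp hx.2).le
    have hm := euclideanHausdorffMeasure_image_le (f := (id : E2 → E2)) (g := chartParam Φ)
      (A := A) (K := K) fun x hx y hy => hK.dist_le_mul x (hAU hx) y (hAU hy)
    rw [image_id, EuclideanSpace.euclideanHausdorffMeasure_eq_volume] at hm
    calc μHE[2] (S.face j ∩ Metric.ball v r) ≤ (K : ℝ≥0∞) ^ 2 * MeasureTheory.volume A :=
          (measure_mono himg).trans hm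
      _ ≤ (K : ℝ≥0∞) ^ 2 * MeasureTheory.volume (Metric.closedBall (planeProj (Φ v)) (k * r)) := by gcongr
      _ = ENNReal.ofReal (K ^ 2 * (k ^ 2 * c) * r ^ 2) := by
          rw [Measure.addHaar_closedBall _ _ (by positivity), finrank_euclideanSpace_fin,
            ← ENNReal.ofReal_toReal (measure_ball_lt_top (μ := (MeasureTheory.volume : Measure E2))
              (x := 0) (r := 1)).ne, ← ENNReal.ofReal_mul (by positivity),
            ← ENNReal.ofReal_coe_nnreal, ← ENNReal.ofReal_pow (by positivity),
            ← ENNReal.ofReal_mul (by positivity)]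
          congr 1
          ring
  · obtain ⟨r₀, hr₀, hball⟩ := Metric.mem_nhds_iff.mp (isClosed_closure.isOpen_compl.mem_nhds hv)
    refine ⟨0, le_rfl, r₀, hr₀, fun r hr hrr => ?_⟩
    have : S.face j ∩ Metric.ball v r = ∅ := by
      ext x
      simp only [mem_inter_iff, mem_empty_iff_false, iff_false]
      rintro ⟨hx, hxb⟩
      exact hball (Metric.ball_subset_ball hrr.le hxb) (subset_closure hx)
    rw [this]
    simp

variable (S j) in
theorem measure_face_lt_top : μHE[2] (S.face j) < ⊤ := by
  have := (S.isCompact_closure_face j).induction_on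
    (p := fun t => μHE[2] (t ∩ S.face j) < ⊤) (by simp)
    (fun s t hst ht => (measure_mono (inter_subset_inter_left _ hst)).trans_lt ht)
    (fun s t hs ht => by
      rw [union_inter_distrib_right]
      exact (measure_union_le _ _).trans_lt (ENNReal.add_lt_top.mpr ⟨hs, ht⟩))
    (fun p _ => by
      obtain ⟨C, -, r₀, hr₀, h⟩ := S.measure_face_inter_ball_le j p
      refine ⟨Metric.ball p (r₀ / 2), mem_nhdsWithin_of_mem_nhds
        (Metric.ball_mem_nhds p (half_pos hr₀)), ?_⟩
      rw [inter_comm]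
      exact (h _ (half_pos hr₀) (half_lt_self hr₀)).trans_lt ENNReal.ofReal_lt_top)
  rwa [inter_eq_right.mpr subset_closure] at this

/-- The planar coordinates of a chart form a Lipschitz map, and the image of the piece of the face
contains a plane neighbourhood. Zero area of the piece would force zero area of that neighbourhood.
-/
theorem measure_face_inter_ball_pos {p : E3} (hp : p ∈ S.face j) {r : ℝ} (hr : 0 < r) :
    0 < μHE[2] (S.face j ∩ Metric.ball p r) := by
  obtain ⟨Φ, hΦ, hpΦ, h, -⟩ := S.face_chart' hp
  have h2 := (h p hpΦ).mp hp
  have hu := planeProj_mem_chartDomain Φ hpΦ h2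
  have hc : ContDiffAt ℝ 1 (fun x => planeProj (Φ x)) p :=
    planeProj.contDiff.contDiffAt.comp p ((contDiffAt_chart hΦ hpΦ).of_le (by norm_num))
  obtain ⟨k, t, ht, hk⟩ := hc.exists_lipschitzOnWith
  set A := S.face j ∩ Metric.ball p r ∩ t
  have hm := euclideanHausdorffMeasure_image_le (f := (id : E3 → E3)) (g := fun x => planeProj (Φ x))
    (A := A) (K := k) fun x hx y hy => hk.dist_le_mul x hx.2 y hy.2
  rw [image_id, EuclideanSpace.euclideanHausdorffMeasure_eq_volume] at hm
  have hnhds : (fun x => planeProj (Φ x)) '' A ∈ 𝓝 (planeProj (Φ p)) := by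
    have hcont : ContinuousAt (chartParam Φ) (planeProj (Φ p)) :=
      (contDiffAt_chartParam hΦ hu).continuousAt
    have hpre : chartParam Φ ⁻¹' (Metric.ball p r ∩ t) ∈ 𝓝 (planeProj (Φ p)) := by
      apply hcont
      rw [chartParam_planeProj Φ hpΦ h2]
      exact Filter.inter_mem (Metric.ball_mem_nhds p hr) ht
    filter_upwards [hpre, (isOpen_chartDomain Φ).mem_nhds hu] with u hu1 hu2
    have hs := chartParam_mem_source Φ hu2
    refine ⟨chartParam Φ u, ⟨⟨(h _ hs).mpr ?_, hu1.1⟩, hu1.2⟩, ?_⟩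
    · rw [apply_chartParam Φ hu2, planeIncl_two]
    · simp only [apply_chartParam Φ hu2, planeProj_planeIncl]
  have hpos := (Measure.measure_pos_of_mem_nhds MeasureTheory.volume hnhds).trans_le hm
  have hA : 0 < μHE[2] A := by
    rcases eq_zero_or_pos (μHE[2] A) with h0 | h0
    · rw [h0, mul_zero] at hpos
      exact (lt_irrefl _ hpos).elim
    · exact h0
  exact hA.trans_le (measure_mono inter_subset_left)

theorem integrableOn_face {g : E3 → ℝ} (hg : ContinuousOn g (S.face j)) {C : ℝ}
    (hC : ∀ p ∈ S.face j, |g p| ≤ C) : IntegrableOn g (S.face j) μHE[2] :=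
  IntegrableOn.of_bound (S.measure_face_lt_top j)
    (hg.aestronglyMeasurable (S.measurableSet_face j)) C
    ((ae_restrict_iff' (S.measurableSet_face j)).mpr (.of_forall hC))

end PiecewiseSmoothSurface

end AnisotropicSurface

namespace AnisotropicSurface

/-! ### Green's theorem on a half plane -/

/-- The point of the parameter plane with given coordinates. -/
def planePoint : ℝ × ℝ →L[ℝ] E2 :=
  (ContinuousLinearMap.fst ℝ ℝ ℝ).smulRight (EuclideanSpace.single 0 1) +
  (ContinuousLinearMap.snd ℝ ℝ ℝ).smulRight (EuclideanSpace.single 1 1)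

@[simp] theorem planePoint_zero (q : ℝ × ℝ) : planePoint q 0 = q.1 := by simp [planePoint]
@[simp] theorem planePoint_one (q : ℝ × ℝ) : planePoint q 1 = q.2 := by simp [planePoint]

theorem planePoint_eq : ⇑planePoint =
    (MeasurableEquiv.toLp 2 (Fin 2 → ℝ)) ∘ (MeasurableEquiv.finTwoArrow (α := ℝ)).symm := by
  funext q
  ext i
  fin_cases i <;> simp [MeasurableEquiv.finTwoArrow]

theorem measurePreserving_planePoint : MeasurePreserving planePoint := by
  rw [planePoint_eq]
  exact (PiLp.volume_preserving_toLp (Fin 2)).comp (volume_preserving_finTwoArrow ℝ).symm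

theorem measurableEmbedding_planePoint : MeasurableEmbedding planePoint := by
  rw [planePoint_eq]
  exact (MeasurableEquiv.measurableEmbedding _).comp (MeasurableEquiv.measurableEmbedding _)

theorem abs_coord_le_norm (u : E2) (i : Fin 2) : |u i| ≤ ‖u‖ := by
  simpa using PiLp.norm_apply_le u i

/-- This is the divergence theorem on a rectangle so large that `a` and `b` vanish on every side but
the one on the boundary line. Only continuity is required on that line and differentiability off it,
which is the regularity a face field has at an edge. -/
theorem integral_halfPlane_eq {a b : E2 → ℝ} {m R : ℝ}
    (ha : ContinuousOn a {u | m ≤ u 0}) (hb : ContinuousOn b {u | m ≤ u 0})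
    (hda : ∀ u : E2, m < u 0 → DifferentiableAt ℝ a u)
    (hdb : ∀ u : E2, m < u 0 → DifferentiableAt ℝ b u)
    (hsupp : ∀ u : E2, R ≤ ‖u‖ → m ≤ u 0 → a u = 0 ∧ b u = 0)
    (hi : IntegrableOn (fun u => fderiv ℝ b u (EuclideanSpace.single 0 1) -
      fderiv ℝ a u (EuclideanSpace.single 1 1)) {u | m < u 0}) :
    ∫ u in {u : E2 | m < u 0}, (fderiv ℝ b u (EuclideanSpace.single 0 1) -
      fderiv ℝ a u (EuclideanSpace.single 1 1)) = -∫ y, b (planePoint (m, y)) := by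
  set c : E2 → ℝ := fun u => fderiv ℝ b u (EuclideanSpace.single 0 1) -
      fderiv ℝ a u (EuclideanSpace.single 1 1) with hc
  -- This exceeds both `R` and `m`, so three sides of the rectangle lie outside the disc of radius
  -- `R`.
  set M : ℝ := max R 0 + |m| + 1 with hM
  have hMR : R < M := by
    have := le_max_left R 0; have := abs_nonneg m; linarith
  have hM0 : 0 < M := by
    have := le_max_right R 0; have := abs_nonneg m; linarith
  have hmM : m < M := by
    have := le_max_right R 0; have := le_abs_self m; linarith
  have hzero : ∀ u : E2, m < u 0 → R < ‖u‖ → c u = 0 := by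
    intro u hu0 hu
    have hev : ∀ᶠ v : E2 in 𝓝 u, m < v 0 ∧ R < ‖v‖ :=
      ((EuclideanSpace.proj (0 : Fin 2) : E2 →L[ℝ] ℝ).continuous.continuousAt.eventually
        (lt_mem_nhds hu0)).and (continuous_norm.continuousAt.eventually (lt_mem_nhds hu))
    have h1 : a =ᶠ[𝓝 u] fun _ => 0 := hev.mono fun v hv => (hsupp v hv.2.le hv.1.le).1
    have h2 : b =ᶠ[𝓝 u] fun _ => 0 := hev.mono fun v hv => (hsupp v hv.2.le hv.1.le).2
    simp [hc, h1.fderiv_eq, h2.fderiv_eq]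
  set box : Set (ℝ × ℝ) := Icc (m, -M) (M, M) with hbox
  have hboxm : ∀ q ∈ box, m ≤ planePoint q 0 := fun q hq => by
    rw [planePoint_zero]; exact hq.1.1
  have hlt : ∀ q ∈ Ioo m M ×ˢ Ioo (-M) M, m < planePoint q 0 := fun q hq => by
    rw [planePoint_zero]; exact hq.1.1
  have hopen : MeasurableSet {q : ℝ × ℝ | m < q.1} := measurableSet_lt measurable_const measurable_fst
  have hpre : planePoint ⁻¹' {u : E2 | m < u 0} = {q : ℝ × ℝ | m < q.1} := by ext q; simp
  have hint : IntegrableOn (fun q => c (planePoint q)) {q : ℝ × ℝ | m < q.1} := by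
    rw [← hpre]
    exact (measurePreserving_planePoint.integrableOn_comp_preimage
      measurableEmbedding_planePoint).mpr hi
  -- The side on the boundary line is dropped because nothing is known of the derivatives there; it
  -- is a null set.
  set box' : Set (ℝ × ℝ) := Ioc m M ×ˢ Icc (-M) M with hbox'
  have hbb : box' =ᵐ[volume] box := by
    rw [hbox, Icc_prod_eq, hbox', Measure.volume_eq_prod]
    exact Measure.set_prod_ae_eq Ioc_ae_eq_Icc (Filter.EventuallyEq.refl _ _)
  have hb'sub : box' ⊆ {q : ℝ × ℝ | m < q.1} := fun q hq => hq.1.1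
  have hint' : IntegrableOn (fun q => c (planePoint q)) box :=
    (hint.mono_set hb'sub).congr_set_ae hbb.symm
  have hgreen := integral_divergence_prod_Icc_of_hasFDerivAt_of_le
    (fun q => b (planePoint q)) (fun q => -a (planePoint q))
    (fun q => (fderiv ℝ b (planePoint q)).comp planePoint)
    (fun q => -(fderiv ℝ a (planePoint q)).comp planePoint) (m, -M) (M, M)
    ⟨hmM.le, by simp; linarith⟩
    (hb.comp planePoint.continuous.continuousOn hboxm)
    (ha.comp planePoint.continuous.continuousOn hboxm).neg
    (fun q hq => (hdb _ (hlt q hq)).hasFDerivAt.comp q planePoint.hasFDerivAt)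
    (fun q hq => ((hda _ (hlt q hq)).hasFDerivAt.comp q planePoint.hasFDerivAt).neg)
    (by
      refine hint'.congr_fun (fun q _ => ?_) measurableSet_Icc
      simp [hc, planePoint, sub_eq_add_neg])
  have hL : (∫ q in Icc (m, -M) (M, M), ((fderiv ℝ b (planePoint q)).comp planePoint) (1, 0) +
      (-(fderiv ℝ a (planePoint q)).comp planePoint) (0, 1)) = ∫ u in {u : E2 | m < u 0}, c u := by
    rw [← measurePreserving_planePoint.setIntegral_preimage_emb measurableEmbedding_planePoint, hpre,
      setIntegral_eq_of_subset_of_forall_sdiff_eq_zero hopen hb'sub, setIntegral_congr_set hbb]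
    · refine setIntegral_congr_fun measurableSet_Icc fun q _ => ?_
      simp [hc, planePoint, sub_eq_add_neg]
    · rintro q ⟨hq, hqb⟩
      refine hzero _ (by simpa using hq) ?_
      by_contra hcon
      apply hqb
      have h0 := (abs_coord_le_norm (planePoint q) 0).trans (not_lt.mp hcon)
      have h1 := (abs_coord_le_norm (planePoint q) 1).trans (not_lt.mp hcon)
      rw [planePoint_zero, abs_le] at h0
      rw [planePoint_one, abs_le] at h1
      exact ⟨⟨hq, by linarith⟩, ⟨by linarith, by linarith⟩⟩
  rw [hL] at hgreen
  have hz : ∀ x y : ℝ, m ≤ x → (R ≤ |x| ∨ R ≤ |y|) →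
      a (planePoint (x, y)) = 0 ∧ b (planePoint (x, y)) = 0 := by
    intro x y hx h
    refine hsupp _ ?_ (by simpa using hx)
    rcases h with h | h
    · exact h.trans (by simpa using abs_coord_le_norm (planePoint (x, y)) 0)
    · exact h.trans (by simpa using abs_coord_le_norm (planePoint (x, y)) 1)
  have e1 : ∫ x in m..M, -a (planePoint (x, M)) = 0 := by
    refine intervalIntegral.integral_zero_ae (.of_forall fun x hx => ?_)
    rw [uIoc_of_le hmM.le] at hx
    rw [(hz x M hx.1.le (Or.inr (hMR.le.trans (le_abs_self M)))).1, neg_zero]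
  have e2 : ∫ x in m..M, -a (planePoint (x, -M)) = 0 := by
    refine intervalIntegral.integral_zero_ae (.of_forall fun x hx => ?_)
    rw [uIoc_of_le hmM.le] at hx
    rw [(hz x (-M) hx.1.le (Or.inr (by rw [abs_neg]; exact hMR.le.trans (le_abs_self M)))).1,
      neg_zero]
  have e3 : ∫ y in (-M)..M, b (planePoint (M, y)) = 0 :=
    intervalIntegral.integral_zero_ae (.of_forall fun y _ =>
      (hz M y hmM.le (Or.inl (hMR.le.trans (le_abs_self M)))).2)
  have e4 : ∫ y in (-M)..M, b (planePoint (m, y)) = ∫ y, b (planePoint (m, y)) := by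
    rw [intervalIntegral.integral_of_le (by linarith)]
    refine setIntegral_eq_integral_of_forall_compl_eq_zero fun y hy => (hz m y le_rfl (Or.inr ?_)).2
    by_contra hcon
    apply hy
    rw [not_le, abs_lt] at hcon
    exact ⟨by linarith, by linarith⟩
  simp only at hgreen
  rw [hgreen, e1, e2, e3, e4]
  ring

end AnisotropicSurface

namespace AnisotropicSurface

/-! ### Stokes' theorem in a chart -/

theorem exists_bound_of_continuous {V W : Type*} [NormedAddCommGroup V] [NormedSpace ℝ V]
    [FiniteDimensional ℝ V] [NormedAddCommGroup W] {f : V → W} (hf : Continuous f) (C : ℝ) :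
    ∃ C', ∀ x, ‖x‖ ≤ C → ‖f x‖ ≤ C' := by
  have : ProperSpace V := FiniteDimensional.proper ℝ V
  obtain ⟨C', hC'⟩ := (isCompact_closedBall (0 : V) C).exists_bound_of_continuousOn hf.continuousOn
  exact ⟨C', fun x hx => hC' x (by simpa using hx)⟩

namespace PiecewiseSmoothSurface

open scoped NNReal ENNReal

variable {S : PiecewiseSmoothSurface} {j : Fin S.N}

theorem continuousOn_curl {Z : E3 → E3} (hZ : S.IsFaceField j Z) :
    ContinuousOn (fun x => ⟪curlVec (fderivWithin ℝ Z (S.face j) x), S.normal j x⟫) (S.face j) :=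
  ((continuous_curlVec.comp_continuousOn hZ.continuousOn_tderiv).inner
    ((S.normal_continuousOn j).mono subset_closure)).congr fun _ hx => inner_curlVec_eq_tderiv hx

theorem exists_bound_curl {Z : E3 → E3} (hZ : S.IsFaceField j Z) :
    ∃ C, ∀ x ∈ S.face j, |⟪curlVec (fderivWithin ℝ Z (S.face j) x), S.normal j x⟫| ≤ C := by
  obtain ⟨C, hC⟩ := hZ.bounded
  obtain ⟨C', hC'⟩ := exists_bound_of_continuous continuous_curlVec C
  refine ⟨C', fun x hx => ?_⟩
  rw [inner_curlVec_eq_tderiv hx]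
  refine (abs_real_inner_le_norm _ _).trans ?_
  rw [norm_normal_face hx, mul_one]
  exact hC' _ (hC x hx)

theorem integrableOn_curl {Z : E3 → E3} (hZ : S.IsFaceField j Z) :
    IntegrableOn (fun x => ⟪curlVec (fderivWithin ℝ Z (S.face j) x), S.normal j x⟫) (S.face j)
      μHE[2] := by
  obtain ⟨C, hC⟩ := exists_bound_curl hZ
  exact integrableOn_face (continuousOn_curl hZ) hC

/-- A chart in which the face is, in a small ball, a half disc (`m` may be so small that the half
disc is a full disc). -/
structure IsHalfDiscChart (S : PiecewiseSmoothSurface) (j : Fin S.N)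
    (Φ : OpenPartialHomeomorph E3 E3) (p : E3) (r m σ : ℝ) (U : Set E2) (K : ℝ≥0) : Prop where
  isSmoothChart : IsSmoothChart Φ
  pos : 0 < r
  isOpen : IsOpen U
  subset : U ⊆ chartDomain Φ
  lipschitz : LipschitzOnWith K (chartParam Φ) U
  mem_source : ∀ x ∈ Metric.closedBall p r, x ∈ Φ.source
  mem_domain : ∀ x ∈ Metric.closedBall p r, planeProj (Φ x) ∈ U
  mem_face_iff : ∀ x ∈ Metric.closedBall p r, x ∈ S.face j ↔ Φ x 2 = 0 ∧ m < Φ x 0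
  sign_sq : σ ^ 2 = 1
  normal_eq : ∀ x ∈ Metric.closedBall p r, x ∈ S.face j → S.normal j x = σ • chartUnitNormal Φ x

/-- The parameters of the points in the ball. -/
def ballDomain (Φ : OpenPartialHomeomorph E3 E3) (p : E3) (r : ℝ) : Set E2 :=
  chartDomain Φ ∩ chartParam Φ ⁻¹' Metric.ball p r

open Classical in
/-- The coefficients of the one-form `⟨Z, dx⟩` in the parameter plane. -/
def formCoeff (Φ : OpenPartialHomeomorph E3 E3) (p : E3) (r : ℝ) (Z : E3 → E3) (i : Fin 2)
    (u : E2) : ℝ :=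
  if u ∈ ballDomain Φ p r then
    ⟪Z (chartParam Φ u), chartDeriv Φ u (EuclideanSpace.single i 1)⟫ else 0

section halfDisc

variable {Φ : OpenPartialHomeomorph E3 E3} {p : E3} {r m σ : ℝ} {U : Set E2} {K : ℝ≥0}

theorem isOpen_ballDomain (hΦ : IsSmoothChart Φ) : IsOpen (ballDomain Φ p r) := by
  have hc : ContinuousOn (chartParam Φ) (chartDomain Φ) := fun u hu =>
    (contDiffAt_chartParam hΦ hu).continuousAt.continuousWithinAt
  exact hc.isOpen_inter_preimage (isOpen_chartDomain Φ) Metric.isOpen_ball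

theorem formCoeff_of_mem {Z : E3 → E3} {i : Fin 2} {u : E2} (hu : u ∈ ballDomain Φ p r) :
    formCoeff Φ p r Z i u =
      ⟪Z (chartParam Φ u), chartDeriv Φ u (EuclideanSpace.single i 1)⟫ := by
  simp [formCoeff, hu]

variable (h : IsHalfDiscChart S j Φ p r m σ U K)
include h

theorem IsHalfDiscChart.chartParam_mem_face {u : E2} (hu : u ∈ ballDomain Φ p r) (hm : m < u 0) :
    chartParam Φ u ∈ S.face j := by
  rw [h.mem_face_iff _ (Metric.ball_subset_closedBall hu.2), apply_chartParam Φ hu.1,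
    planeIncl_two, planeIncl_zero]
  exact ⟨rfl, hm⟩

theorem IsHalfDiscChart.chartParam_mem_closure {u : E2} (hu : u ∈ ballDomain Φ p r)
    (hm : m ≤ u 0) : chartParam Φ u ∈ closure (S.face j) := by
  have hcont : Filter.Tendsto (fun t : ℝ => u + t • (EuclideanSpace.single 0 1 : E2)) (𝓝[>] 0)
      (𝓝 u) := by
    have hc : Continuous fun t : ℝ => u + t • (EuclideanSpace.single 0 1 : E2) := by fun_prop
    exact (hc.tendsto' 0 u (by simp)).mono_left nhdsWithin_le_nhds
  refine mem_closure_of_tendsto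
    ((contDiffAt_chartParam h.isSmoothChart hu.1).continuousAt.tendsto.comp hcont) ?_
  have hmem := hcont.eventually ((isOpen_ballDomain h.isSmoothChart).mem_nhds hu)
  filter_upwards [hmem, self_mem_nhdsWithin] with t ht htpos
  refine h.chartParam_mem_face ht ?_
  have : (0 : ℝ) < t := htpos
  simp
  linarith

/-- The parameters of the points of the half as large closed ball form a compact set. -/
theorem IsHalfDiscChart.isCompact_half :
    IsCompact {u ∈ chartDomain Φ | chartParam Φ u ∈ Metric.closedBall p (r / 2)} := by
  have hr : r / 2 ≤ r := by linarith [h.pos]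
  have hc : ContinuousOn Φ (Metric.closedBall p r) := fun x hx =>
    (contDiffAt_chart h.isSmoothChart (h.mem_source x hx)).continuousAt.continuousWithinAt
  have hc' : ContinuousOn Φ (Metric.closedBall p (r / 2)) :=
    hc.mono (Metric.closedBall_subset_closedBall hr)
  have hcl : IsClosed (Metric.closedBall p (r / 2) ∩ (fun x => Φ x 2) ⁻¹' {0}) :=
    ContinuousOn.preimage_isClosed_of_isClosed
      ((EuclideanSpace.proj (2 : Fin 3) : E3 →L[ℝ] ℝ).continuous.comp_continuousOn hc')
      Metric.isClosed_closedBall isClosed_singleton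
  have hcomp : IsCompact (Metric.closedBall p (r / 2) ∩ (fun x => Φ x 2) ⁻¹' {0}) :=
    (isCompact_closedBall p (r / 2)).of_isClosed_subset hcl inter_subset_left
  convert hcomp.image_of_continuousOn
    (planeProj.continuous.comp_continuousOn (hc'.mono inter_subset_left)) using 1
  ext u
  constructor
  · rintro ⟨hu, hup⟩
    refine ⟨chartParam Φ u, ⟨hup, ?_⟩, ?_⟩
    · simp [apply_chartParam Φ hu]
    · simp [apply_chartParam Φ hu]
  · rintro ⟨x, ⟨hx, hx2⟩, rfl⟩
    have hs := h.mem_source x (Metric.closedBall_subset_closedBall hr hx)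
    refine ⟨planeProj_mem_chartDomain Φ hs hx2, ?_⟩
    simp only [Function.comp_apply]
    rwa [chartParam_planeProj Φ hs hx2]

theorem IsHalfDiscChart.half_subset {u : E2} (hu : u ∈ chartDomain Φ)
    (hp : chartParam Φ u ∈ Metric.closedBall p (r / 2)) : u ∈ ballDomain Φ p r := by
  have h1 : r / 2 < r := half_lt_self h.pos
  have h2 : chartParam Φ u ∈ Metric.ball p r := Metric.closedBall_subset_ball h1 hp
  exact mem_sep hu h2

variable {Z : E3 → E3} (hZ : S.IsFaceField j Z)
  (hsupp : ∀ x ∈ closure (S.face j), x ∉ Metric.ball p (r / 2) → Z x = 0)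
include hsupp

theorem IsHalfDiscChart.formCoeff_eq_zero (i : Fin 2) {u : E2} (hm : m ≤ u 0)
    (hu : u ∉ {u ∈ chartDomain Φ | chartParam Φ u ∈ Metric.closedBall p (r / 2)}) :
    formCoeff Φ p r Z i u = 0 := by
  by_cases hQ : u ∈ ballDomain Φ p r
  · rw [formCoeff_of_mem hQ, hsupp _ (h.chartParam_mem_closure hQ hm), inner_zero_left]
    exact fun hb => hu ⟨hQ.1, Metric.ball_subset_closedBall hb⟩
  · simp [formCoeff, hQ]

include hZ

theorem IsHalfDiscChart.continuousOn_formCoeff (i : Fin 2) :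
    ContinuousOn (formCoeff Φ p r Z i) {u | m ≤ u 0} := by
  intro u hu
  by_cases hQ : u ∈ ballDomain Φ p r
  · have hQn := (isOpen_ballDomain h.isSmoothChart).mem_nhds hQ
    have hmaps : MapsTo (chartParam Φ) ({u | m ≤ u 0} ∩ ballDomain Φ p r) (closure (S.face j)) :=
      fun v hv => h.chartParam_mem_closure hv.2 hv.1
    have h1 : ContinuousWithinAt (fun u => Z (chartParam Φ u))
        ({u | m ≤ u 0} ∩ ballDomain Φ p r) u :=
      (hZ.continuousOn _ (h.chartParam_mem_closure hQ hu)).comp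
        (contDiffAt_chartParam h.isSmoothChart hQ.1).continuousAt.continuousWithinAt hmaps
    have h2 : ContinuousWithinAt (fun u => chartDeriv Φ u (EuclideanSpace.single i 1))
        ({u | m ≤ u 0} ∩ ballDomain Φ p r) u :=
      ((contDiffAt_chartDeriv h.isSmoothChart hQ.1).continuousAt.clm_apply
        continuousAt_const).continuousWithinAt
    have h3 := h1.inner (𝕜 := ℝ) h2
    rw [continuousWithinAt_inter hQn] at h3
    refine h3.congr_of_eventuallyEq ?_ (formCoeff_of_mem hQ)
    filter_upwards [mem_nhdsWithin_of_mem_nhds hQn] with v hv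
    exact formCoeff_of_mem hv
  · have hS := h.isCompact_half.isClosed.isOpen_compl.mem_nhds
      (show u ∈ _ from fun hu' => hQ (h.half_subset hu'.1 hu'.2))
    refine (continuousWithinAt_const (b := (0 : ℝ))).congr_of_eventuallyEq ?_
      (by simp [formCoeff, hQ])
    filter_upwards [mem_nhdsWithin_of_mem_nhds hS, self_mem_nhdsWithin] with v hv hvm
    exact h.formCoeff_eq_zero hsupp i hvm hv

omit hsupp in
theorem IsHalfDiscChart.hasFDerivAt_comp {u : E2} (hQ : u ∈ ballDomain Φ p r) (hm : m < u 0) :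
    HasFDerivAt (fun u => Z (chartParam Φ u))
      ((fderivWithin ℝ Z (S.face j) (chartParam Φ u)).comp (chartDeriv Φ u)) u := by
  have hmem := h.chartParam_mem_face hQ hm
  refine HasFDerivWithinAt.comp_hasFDerivAt u (hZ.hasFDerivWithinAt hmem)
    (hasFDerivAt_chartParam h.isSmoothChart hQ.1) ?_
  filter_upwards [(isOpen_ballDomain h.isSmoothChart).mem_nhds hQ,
    (EuclideanSpace.proj (0 : Fin 2) : E2 →L[ℝ] ℝ).continuous.continuousAt.eventually
      (lt_mem_nhds hm)] with v hv hvm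
  exact h.chartParam_mem_face hv hvm

omit hsupp in
theorem IsHalfDiscChart.hasFDerivAt_formCoeff (i : Fin 2) {u : E2} (hQ : u ∈ ballDomain Φ p r)
    (hm : m < u 0) : DifferentiableAt ℝ (formCoeff Φ p r Z i) u ∧
    ∀ v, fderiv ℝ (formCoeff Φ p r Z i) u v =
      ⟪Z (chartParam Φ u), fderiv ℝ (chartDeriv Φ) u v (EuclideanSpace.single i 1)⟫ +
      ⟪fderivWithin ℝ Z (S.face j) (chartParam Φ u) (chartDeriv Φ u v),
        chartDeriv Φ u (EuclideanSpace.single i 1)⟫ := by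
  have h1 := h.hasFDerivAt_comp hZ hQ hm
  have h2 : HasFDerivAt (chartDeriv Φ) (fderiv ℝ (chartDeriv Φ) u) u :=
    ((contDiffAt_chartDeriv h.isSmoothChart hQ.1).differentiableAt (by norm_num)).hasFDerivAt
  have h3 := h2.clm_apply (hasFDerivAt_const (EuclideanSpace.single i (1 : ℝ)) u)
  have heq : formCoeff Φ p r Z i =ᶠ[𝓝 u]
      fun u => ⟪Z (chartParam Φ u), chartDeriv Φ u (EuclideanSpace.single i 1)⟫ := by
    filter_upwards [(isOpen_ballDomain h.isSmoothChart).mem_nhds hQ] with v hv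
    exact formCoeff_of_mem hv
  have h4 := (h1.inner ℝ h3).congr_of_eventuallyEq heq
  refine ⟨h4.differentiableAt, fun v => ?_⟩
  rw [h4.fderiv]
  simp [fderivInnerCLM_apply]

omit hsupp in
/-- The exterior derivative of the form, and the curl. -/
theorem IsHalfDiscChart.curl_formCoeff {u : E2} (hQ : u ∈ ballDomain Φ p r) (hm : m < u 0) :
    fderiv ℝ (formCoeff Φ p r Z 1) u (EuclideanSpace.single 0 1) -
      fderiv ℝ (formCoeff Φ p r Z 0) u (EuclideanSpace.single 1 1) =
    σ * (areaFactor (chartDeriv Φ u) *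
      ⟪curlVec (fderivWithin ℝ Z (S.face j) (chartParam Φ u)), S.normal j (chartParam Φ u)⟫) := by
  have hmem := h.chartParam_mem_face hQ hm
  have hs := chartParam_mem_source Φ hQ.1
  rw [(h.hasFDerivAt_formCoeff hZ 1 hQ hm).2, (h.hasFDerivAt_formCoeff hZ 0 hQ hm).2]
  -- The terms with second derivatives of the parametrization cancel in the exterior derivative.
  have hsymm : fderiv ℝ (chartDeriv Φ) u (EuclideanSpace.single 0 1) (EuclideanSpace.single 1 1) =
      fderiv ℝ (chartDeriv Φ) u (EuclideanSpace.single 1 1) (EuclideanSpace.single 0 1) := by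
    refine second_derivative_symmetric_of_eventually (f := chartParam Φ) ?_
      ((contDiffAt_chartDeriv h.isSmoothChart hQ.1).differentiableAt (by norm_num)).hasFDerivAt _ _
    filter_upwards [(isOpen_chartDomain Φ).mem_nhds hQ.1] with v hv
    exact hasFDerivAt_chartParam h.isSmoothChart hv
  rw [hsymm, h.normal_eq _ (Metric.ball_subset_closedBall hQ.2) hmem, areaFactor_chartDeriv hQ.1,
    chartUnitNormal, inner_smul_right, inner_smul_right, chartNormal, inner_curlVec_cross,
    chartDeriv_single_zero hQ.1, chartDeriv_single_one hQ.1, ← chartNormal]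
  have hN : ‖chartNormal Φ (chartParam Φ u)‖ ≠ 0 :=
    norm_ne_zero_iff.mpr (chartNormal_ne_zero h.isSmoothChart hs)
  have hσ := h.sign_sq
  field_simp
  rw [hσ]
  ring

omit hZ in
theorem IsHalfDiscChart.fderiv_formCoeff_eq_zero (i : Fin 2) {u : E2} (hm : m < u 0)
    (hu : u ∉ {u ∈ chartDomain Φ | chartParam Φ u ∈ Metric.closedBall p (r / 2)}) :
    formCoeff Φ p r Z i =ᶠ[𝓝 u] fun _ => 0 := by
  filter_upwards [h.isCompact_half.isClosed.isOpen_compl.mem_nhds (show u ∈ _ from hu),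
    (EuclideanSpace.proj (0 : Fin 2) : E2 →L[ℝ] ℝ).continuous.continuousAt.eventually
      (lt_mem_nhds hm)] with v hv hvm
  exact h.formCoeff_eq_zero hsupp i (le_of_lt hvm) hv

/-- Stokes' theorem in a half disc. -/
theorem IsHalfDiscChart.integral_curl :
    ∫ x in S.face j, ⟪curlVec (fderivWithin ℝ Z (S.face j) x), S.normal j x⟫ ∂μHE[2] =
      -σ * ∫ y, formCoeff Φ p r Z 1 (planePoint (m, y)) := by
  set g : E3 → ℝ := fun x => ⟪curlVec (fderivWithin ℝ Z (S.face j) x), S.normal j x⟫ with hg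
  set T := {u ∈ chartDomain Φ | chartParam Φ u ∈ Metric.closedBall p (r / 2)} with hT
  set c : E2 → ℝ := fun u => fderiv ℝ (formCoeff Φ p r Z 1) u (EuclideanSpace.single 0 1) -
      fderiv ℝ (formCoeff Φ p r Z 0) u (EuclideanSpace.single 1 1) with hc
  have hΦ := h.isSmoothChart
  have hmeas : MeasurableSet {u : E2 | m < u 0} :=
    measurableSet_lt measurable_const (by fun_prop)
  have hopen : IsOpen {u : E2 | m < u 0} := isOpen_lt continuous_const (by fun_prop)
  have hc0 : ∀ u : E2, m < u 0 → u ∉ T → c u = 0 := fun u hu huT => by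
    simp only [hc]
    rw [(h.fderiv_formCoeff_eq_zero hsupp 1 hu huT).fderiv_eq,
      (h.fderiv_formCoeff_eq_zero hsupp 0 hu huT).fderiv_eq]
    simp
  set A := ballDomain Φ p r ∩ {u : E2 | m < u 0} with hA
  have hAopen : IsOpen A := (isOpen_ballDomain hΦ).inter hopen
  have hAU : A ⊆ U := by
    rintro u ⟨hu, -⟩
    have := h.mem_domain _ (Metric.ball_subset_closedBall hu.2)
    rwa [apply_chartParam Φ hu.1, planeProj_planeIncl] at this
  have hcA : ∀ u ∈ A, c u = σ * (areaFactor (chartDeriv Φ u) * g (chartParam Φ u)) := fun u hu =>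
    h.curl_formCoeff hZ hu.1 hu.2
  have hTA : T ∩ {u : E2 | m < u 0} ⊆ A := fun u hu => ⟨h.half_subset hu.1.1 hu.1.2, hu.2⟩
  have himage : chartParam Φ '' A = S.face j ∩ Metric.ball p r := by
    ext x
    constructor
    · rintro ⟨u, hu, rfl⟩
      exact ⟨h.chartParam_mem_face hu.1 hu.2, hu.1.2⟩
    · rintro ⟨hx, hxb⟩
      have hxb' := Metric.ball_subset_closedBall hxb
      obtain ⟨h2, h0⟩ := (h.mem_face_iff x hxb').mp hx
      have hs := h.mem_source x hxb'
      have hpx := chartParam_planeProj Φ hs h2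
      refine ⟨planeProj (Φ x), ⟨⟨planeProj_mem_chartDomain Φ hs h2, ?_⟩, ?_⟩, hpx⟩
      · rw [mem_preimage, hpx]; exact hxb
      · simpa using h0
  have hg0 : ∀ x ∈ S.face j \ (S.face j ∩ Metric.ball p r), g x = 0 := by
    rintro x ⟨hx, hxb⟩
    have hxb' : x ∉ Metric.closedBall p (r / 2) := fun hcon => hxb ⟨hx,
      Metric.closedBall_subset_ball (by linarith [h.pos]) hcon⟩
    have : S.tderiv j Z x = 0 := by
      refine tderiv_eq_zero hx ?_
      filter_upwards [mem_nhdsWithin_of_mem_nhds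
        (Metric.isClosed_closedBall.isOpen_compl.mem_nhds hxb'), self_mem_nhdsWithin] with y hy hyf
      exact hsupp y (subset_closure hyf) fun hcon => hy (Metric.ball_subset_closedBall hcon)
    simp only [hg]
    rw [inner_curlVec_eq_tderiv hx, this]
    simp [curlVec, inner_eq]
  -- Derivatives of the coefficients may fail to extend to the boundary line, so integrability is
  -- obtained from the bound on the curl over the face, together with the compactness of `T`.
  have hint : IntegrableOn c {u : E2 | m < u 0} := by
    have hcont : ContinuousOn c A := by
      refine ContinuousOn.congr ?_ hcA
      refine continuousOn_const.mul ((continuous_areaFactor.comp_continuousOn fun u hu =>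
        (contDiffAt_chartDeriv hΦ hu.1.1).continuousAt.continuousWithinAt).mul ?_)
      exact (continuousOn_curl hZ).comp (fun u hu =>
        (contDiffAt_chartParam hΦ hu.1.1).continuousAt.continuousWithinAt)
        fun u hu => h.chartParam_mem_face hu.1 hu.2
    obtain ⟨C, hC⟩ := exists_bound_curl hZ
    obtain ⟨C', hC'⟩ := h.isCompact_half.exists_bound_of_continuousOn
      (f := fun u => areaFactor (chartDeriv Φ u)) (continuous_areaFactor.comp_continuousOn fun u hu =>
        (contDiffAt_chartDeriv hΦ hu.1).continuousAt.continuousWithinAt)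
    have hTm : MeasurableSet (T ∩ {u : E2 | m < u 0}) :=
      h.isCompact_half.isClosed.measurableSet.inter hmeas
    have h1 : IntegrableOn c (T ∩ {u : E2 | m < u 0}) := by
      refine IntegrableOn.of_bound ((measure_mono inter_subset_left).trans_lt
        h.isCompact_half.measure_lt_top) ((hcont.mono hTA).aestronglyMeasurable hTm) (C' * C) ?_
      refine (ae_restrict_iff' hTm).mpr (.of_forall fun u hu => ?_)
      have hcu := hC' u hu.1
      have hgu := hC _ (h.chartParam_mem_face (hTA hu).1 hu.2)
      have hσ : |σ| = 1 := by
        have := h.sign_sq; rw [← sq_abs] at this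
        nlinarith [abs_nonneg σ]
      rw [hcA u (hTA hu), Real.norm_eq_abs, abs_mul, abs_mul, hσ, one_mul]
      exact mul_le_mul hcu hgu (abs_nonneg _) ((norm_nonneg _).trans hcu)
    exact h1.of_forall_sdiff_eq_zero hmeas fun u hu => hc0 u hu.1 fun hT => hu.2 ⟨hT, hu.1⟩
  obtain ⟨R, hR⟩ : ∃ R, ∀ u ∈ T, ‖u‖ < R := by
    obtain ⟨R, hR⟩ := h.isCompact_half.isBounded.exists_norm_le
    exact ⟨R + 1, fun u hu => (hR u hu).trans_lt (lt_add_one R)⟩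
  have hdiff : ∀ i, ∀ u : E2, m < u 0 → DifferentiableAt ℝ (formCoeff Φ p r Z i) u := by
    intro i u hu
    by_cases hQ : u ∈ ballDomain Φ p r
    · exact (h.hasFDerivAt_formCoeff hZ i hQ hu).1
    · exact ((h.fderiv_formCoeff_eq_zero hsupp i hu
        fun hu' => hQ (h.half_subset hu'.1 hu'.2)).differentiableAt_iff).mpr
        (differentiableAt_const _)
  have hgreen := integral_halfPlane_eq (h.continuousOn_formCoeff hZ hsupp 0)
    (h.continuousOn_formCoeff hZ hsupp 1) (hdiff 0) (hdiff 1) (R := R)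
    (fun u hu hm => ⟨h.formCoeff_eq_zero hsupp 0 hm fun hT => (hR u hT).not_ge hu,
      h.formCoeff_eq_zero hsupp 1 hm fun hT => (hR u hT).not_ge hu⟩) hint
  rw [setIntegral_eq_of_subset_of_forall_sdiff_eq_zero (S.measurableSet_face j) inter_subset_left
    hg0, ← himage, setIntegral_image_eq h.isOpen ((injOn_chartParam Φ).mono h.subset) h.lipschitz
    (fun u hu => hasStrictFDerivAt_chartParam hΦ (h.subset hu))
    (fun u hu => areaFactor_chartDeriv_ne_zero hΦ (h.subset hu))
    (fun u hu => (contDiffAt_chartDeriv hΦ (h.subset hu)).continuousAt.continuousWithinAt)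
    hAopen.measurableSet hAU]
  have hcA' : ∫ u in A, areaFactor (chartDeriv Φ u) * g (chartParam Φ u) = σ * ∫ u in A, c u := by
    rw [← integral_const_mul]
    refine setIntegral_congr_fun hAopen.measurableSet fun u hu => ?_
    rw [hcA u hu, ← mul_assoc, ← pow_two, h.sign_sq, one_mul]
  have hext : ∫ u in A, c u = ∫ u in {u : E2 | m < u 0}, c u :=
    (setIntegral_eq_of_subset_of_forall_sdiff_eq_zero hmeas inter_subset_right fun u hu =>
      hc0 u hu.1 fun hT => hu.2 (hTA ⟨hT, hu.1⟩)).symm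
  rw [hcA', hext, hgreen]
  ring

end halfDisc

end PiecewiseSmoothSurface

end AnisotropicSurface

namespace AnisotropicSurface

namespace PiecewiseSmoothSurface

open scoped NNReal ENNReal

variable {S : PiecewiseSmoothSurface} {j : Fin S.N}

/-! ### Stokes' theorem on a face -/

variable (S) in
/-- The tangent of an edge. -/
def edgeTangent (i : Fin S.L) (t : ℝ) : E3 := derivWithin (S.edge i) (Icc 0 1) t

variable (S) in
/-- The orientation of the edge `i` as a part of the boundary of the face `j`. -/
def boundarySign (j : Fin S.N) (i : Fin S.L) : ℝ :=
  (if S.left i = j then 1 else 0) - (if S.right i = j then 1 else 0)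

variable (S) in
/-- The integral of the normal component of the curl over a face. -/
def curlFlux (j : Fin S.N) (Z : E3 → E3) : ℝ :=
  ∫ x in S.face j, ⟪curlVec (fderivWithin ℝ Z (S.face j) x), S.normal j x⟫ ∂μHE[2]

variable (S) in
/-- The line integral of a vector field along an edge. -/
def edgeIntegral (i : Fin S.L) (Z : E3 → E3) : ℝ :=
  ∫ t in Ioo (0 : ℝ) 1, ⟪Z (S.edge i t), S.edgeTangent i t⟫

theorem hasDerivAt_edge (i : Fin S.L) {t : ℝ} (ht : t ∈ Ioo (0 : ℝ) 1) :
    HasDerivAt (S.edge i) (S.edgeTangent i t) t :=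
  ((S.edge_contDiffOn i).differentiableOn (by norm_num) t (Ioo_subset_Icc_self ht)
    |>.hasDerivWithinAt).hasDerivAt (Icc_mem_nhds ht.1 ht.2)

theorem continuousOn_edgeTangent (i : Fin S.L) : ContinuousOn (S.edgeTangent i) (Icc 0 1) :=
  (S.edge_contDiffOn i).continuousOn_derivWithin (uniqueDiffOn_Icc zero_lt_one) le_rfl

/-- The orientation condition exhibits a tangent vector of the face at each point of the open edge,
and a nonempty tangent cone forces the point into the closure. The end points follow by continuity.
-/
theorem edge_mem_closure {i : Fin S.L} (h : S.left i = j ∨ S.right i = j) {t : ℝ}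
    (ht : t ∈ Icc (0 : ℝ) 1) : S.edge i t ∈ closure (S.face j) := by
  have hio : ∀ t ∈ Ioo (0 : ℝ) 1, S.edge i t ∈ closure (S.face j) := by
    intro t ht
    rcases h with rfl | rfl
    · exact mem_closure_of_nonempty_tangentConeAt ⟨_, S.left_oriented i t ht⟩
    · exact mem_closure_of_nonempty_tangentConeAt ⟨_, S.right_oriented i t ht⟩
  have hcl : t ∈ closure (Ioo (0 : ℝ) 1) := by rwa [closure_Ioo zero_ne_one]
  have hcont : ContinuousWithinAt (S.edge i) (Ioo 0 1) t :=
    ((S.edge_contDiffOn i).continuousOn t ht).mono Ioo_subset_Icc_self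
  have := hcont.mem_closure hcl (t := closure (S.face j)) hio
  rwa [closure_closure] at this

theorem eventually_forall_closedBall {p : E3} {P : E3 → Prop} (h : ∀ᶠ x in 𝓝 p, P x) :
    ∀ᶠ r in 𝓝[>] (0 : ℝ), ∀ x ∈ Metric.closedBall p r, P x := by
  obtain ⟨r, hr, hP⟩ := Metric.nhds_basis_closedBall.eventually_iff.mp h
  filter_upwards [Ioo_mem_nhdsGT hr] with s hs x hx
  exact hP (Metric.closedBall_subset_closedBall hs.2.le hx)

theorem exists_isHalfDiscChart {Φ : OpenPartialHomeomorph E3 E3} (hΦ : S.IsFaceChart j Φ) {p : E3}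
    (hp : p ∈ closure (S.face j)) (hpΦ : p ∈ Φ.source) {m : ℝ}
    (hm : ∀ᶠ x in 𝓝 p, x ∈ S.face j ↔ Φ x 2 = 0 ∧ m < Φ x 0) :
    ∃ σ U K, ∀ᶠ r in 𝓝[>] (0 : ℝ), IsHalfDiscChart S j Φ p r m σ U K ∧
      ∀ x ∈ Metric.closedBall p r, x ∈ closure (S.face j) →
        S.normal j x = σ • chartUnitNormal Φ x := by
  obtain ⟨σ, hσ, hn⟩ := hΦ.exists_sign hp hpΦ
  obtain ⟨U, K, hU, hUs, hK, hbox⟩ :=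
    exists_chart_box hΦ.isSmoothChart hpΦ (eq_zero_of_mem_closure hΦ hp hpΦ)
  refine ⟨σ, U, K, ?_⟩
  filter_upwards [eventually_forall_closedBall hbox, eventually_forall_closedBall hm,
    eventually_forall_closedBall (eventually_nhdsWithin_iff.mp hn), self_mem_nhdsWithin]
    with r h1 h2 h3 hr
  exact ⟨⟨hΦ.isSmoothChart, hr, hU, hUs, hK, fun x hx => (h1 x hx).1, fun x hx => (h1 x hx).2, h2,
    hσ, fun x hx hxj => h3 x hx (subset_closure hxj)⟩, h3⟩

/-- The half disc formula is used with its boundary line shifted to `m = Φ p 0 - 1`. A small ball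
around `p` does not meet that line, so the boundary term is zero. -/
theorem exists_curlFlux_eq_zero {p : E3} (hp : p ∈ S.face j) :
    ∃ r > 0, ∀ Z, S.IsFaceField j Z →
      (∀ x ∈ closure (S.face j), x ∉ Metric.ball p (r / 2) → Z x = 0) → S.curlFlux j Z = 0 := by
  obtain ⟨Φ, hΦ, hpΦ, hiff, -⟩ := S.face_chart' hp
  have hface : S.IsFaceChart j Φ := ⟨hΦ, fun x hx => (hiff x hx).mp⟩
  have hlt : ∀ᶠ x in 𝓝 p, Φ p 0 - 1 < Φ x 0 := by
    have : ContinuousAt (fun x => Φ x 0) p :=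
      (EuclideanSpace.proj (0 : Fin 3) : E3 →L[ℝ] ℝ).continuous.continuousAt.comp
        (contDiffAt_chart hΦ hpΦ).continuousAt
    exact this.eventually (lt_mem_nhds (by linarith))
  obtain ⟨σ, U, K, h⟩ := exists_isHalfDiscChart hface (subset_closure hp) hpΦ
    (m := Φ p 0 - 1) (by
      filter_upwards [hlt, Φ.open_source.mem_nhds hpΦ] with x hx hxs
      rw [hiff x hxs]
      exact ⟨fun h => ⟨h, hx⟩, fun h => h.1⟩)
  obtain ⟨r, ⟨hr, -⟩, hlt', hr0⟩ :=
    (h.and ((eventually_forall_closedBall hlt).and self_mem_nhdsWithin)).exists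
  refine ⟨r, hr0, fun Z hZ hsupp => ?_⟩
  rw [curlFlux, hr.integral_curl hZ hsupp]
  have : ∀ y, formCoeff Φ p r Z 1 (planePoint (Φ p 0 - 1, y)) = 0 := by
    intro y
    rw [formCoeff, if_neg]
    intro hy
    have := hlt' _ (Metric.ball_subset_closedBall hy.2)
    rw [apply_chartParam Φ hy.1] at this
    simp at this
  simp [this]

/-- The velocity of a curve in the boundary line of a half disc chart. -/
theorem exists_edge_coordinate {Φ : OpenPartialHomeomorph E3 E3} (hΦ : IsSmoothChart Φ)
    {i : Fin S.L} (hedge : ∀ x ∈ Φ.source, x ∈ S.edge i '' Ioo 0 1 ↔ Φ x 2 = 0 ∧ Φ x 0 = 0) {t : ℝ}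
    (ht : t ∈ Ioo (0 : ℝ) 1) (hs : S.edge i t ∈ Φ.source) :
    ∃ s' : ℝ, HasDerivAt (fun τ => Φ (S.edge i τ) 1) s' t ∧
      S.edgeTangent i t = s' • chartFrame Φ 1 (S.edge i t) := by
  have hd := hasDerivAt_edge i ht
  have h1 : HasDerivAt (fun τ => Φ (S.edge i τ) 1)
      ((fderiv ℝ Φ (S.edge i t) (S.edgeTangent i t)) 1) t :=
    (EuclideanSpace.proj (1 : Fin 3) : E3 →L[ℝ] ℝ).hasFDerivAt.comp_hasDerivAt t
      ((hasFDerivAt_chart hΦ hs).comp_hasDerivAt t hd)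
  refine ⟨_, h1, ?_⟩
  set s' := (fderiv ℝ Φ (S.edge i t) (S.edgeTangent i t)) 1
  -- In the chart the edge runs along the second coordinate axis, so locally it is the image of its
  -- own second coordinate.
  have heq : ∀ᶠ τ in 𝓝 t, S.edge i τ = Φ.symm (Φ (S.edge i τ) 1 • EuclideanSpace.single 1 1) := by
    filter_upwards [hd.continuousAt.eventually (Φ.open_source.mem_nhds hs),
      Ioo_mem_nhds ht.1 ht.2] with τ hτ hτ'
    obtain ⟨h2, h0⟩ := (hedge _ hτ).mp (mem_image_of_mem _ hτ')
    have : Φ (S.edge i τ) 1 • EuclideanSpace.single 1 1 = Φ (S.edge i τ) := by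
      ext k; fin_cases k <;> simp [h0, h2]
    rw [this, Φ.left_inv hτ]
  have hval : Φ (S.edge i t) 1 • (EuclideanSpace.single 1 1 : E3) = Φ (S.edge i t) := by
    obtain ⟨h2, h0⟩ := (hedge _ hs).mp (mem_image_of_mem _ ht)
    ext k; fin_cases k <;> simp [h0, h2]
  have h2 : HasDerivAt (fun τ => Φ (S.edge i τ) 1 • (EuclideanSpace.single 1 1 : E3))
      (s' • EuclideanSpace.single 1 1) t := h1.smul_const _
  have hsymm : HasFDerivAt Φ.symm (fderiv ℝ Φ.symm (Φ (S.edge i t)))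
      (Φ (S.edge i t) 1 • (EuclideanSpace.single 1 1 : E3)) := by
    rw [hval]
    exact ((contDiffAt_chart_symm hΦ (Φ.map_source hs)).differentiableAt (by norm_num)).hasFDerivAt
  have h3 := (hsymm.comp_hasDerivAt t h2).congr_of_eventuallyEq heq
  rw [hd.unique h3, map_smul, chartFrame]

/-- The sign of the boundary orientation in a half disc chart. -/
theorem orientation_sign {Φ : OpenPartialHomeomorph E3 E3} (hΦ : IsSmoothChart Φ) {x T : E3}
    (hx : x ∈ Φ.source) (hmin : IsLocalMinOn (fun y => Φ y 0) (S.face j) x) {s σ s' : ℝ}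
    (hn : S.normal j x = σ • chartUnitNormal Φ x) (hT : T = s' • chartFrame Φ 1 x)
    (hs : s • cross (S.normal j x) T ∈ posTangentConeAt (S.face j) x) : s * σ * s' ≤ 0 := by
  have hd : HasFDerivAt (fun y => Φ y 0)
      ((EuclideanSpace.proj (0 : Fin 3) : E3 →L[ℝ] ℝ).comp (fderiv ℝ Φ x)) x :=
    (EuclideanSpace.proj (0 : Fin 3) : E3 →L[ℝ] ℝ).hasFDerivAt.comp x (hasFDerivAt_chart hΦ hx)
  -- The first coordinate of `Φ` is minimal over the face at `x`, so its derivative is nonnegative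
  -- in the direction pointing into the face.
  have h0 := hmin.hasFDerivWithinAt_nonneg hd.hasFDerivWithinAt hs
  have hf : ∀ k : Fin 3, fderiv ℝ Φ x (chartFrame Φ k x) = EuclideanSpace.single k 1 := fun k =>
    fderiv_chart_frame hΦ hx _
  -- The double vector product is expanded in the frame. Its component along the first frame vector
  -- is a negative multiple of `s * σ * s'`, and the derivative of the first coordinate picks out
  -- exactly this component.
  have hc : s • cross (S.normal j x) T = (s * σ * s' * ‖chartNormal Φ x‖⁻¹) •
      (⟪chartFrame Φ 0 x, chartFrame Φ 1 x⟫ • chartFrame Φ 1 x -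
        ⟪chartFrame Φ 1 x, chartFrame Φ 1 x⟫ • chartFrame Φ 0 x) := by
    rw [← cross_cross, ← chartNormal, hn, hT, chartUnitNormal, ← crossL_apply, ← crossL_apply]
    simp only [map_smul, smul_apply, smul_smul]
    congr 1
    ring
  rw [hc] at h0
  simp only [ContinuousLinearMap.comp_apply, map_smul, map_sub, hf] at h0
  simp at h0
  have hN := norm_pos_iff.mpr (chartNormal_ne_zero hΦ hx)
  have hF : 0 < ‖chartFrame Φ 1 x‖ ^ 2 := by
    refine pow_pos (norm_pos_iff.mpr fun hcon => ?_) 2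
    have := chartNormal_ne_zero hΦ hx
    rw [chartNormal, hcon, ← crossL_apply, map_zero] at this
    exact this rfl
  have hpos : 0 < ‖chartNormal Φ x‖⁻¹ * ‖chartFrame Φ 1 x‖ ^ 2 := by positivity
  by_contra! hcon
  nlinarith [mul_pos hcon hpos]

/-- The boundary term of the half disc formula is an integral over the second chart coordinate.
Substituting the coordinate of the edge point turns it into the line integral, and the absolute
value of the Jacobian is resolved by `orientation_sign`. -/
theorem exists_curlFlux_eq_edgeIntegral {i : Fin S.L} {t₀ : ℝ} (ht₀ : t₀ ∈ Ioo (0 : ℝ) 1)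
    (hj : S.left i = j ∨ S.right i = j)
    {Φ : OpenPartialHomeomorph E3 E3} (hΦ : IsSmoothChart Φ) (hpΦ : S.edge i t₀ ∈ Φ.source)
    (hface : ∀ x ∈ Φ.source, x ∈ S.face j ↔ Φ x 2 = 0 ∧ 0 < Φ x 0)
    (hedge : ∀ x ∈ Φ.source, x ∈ S.edge i '' Ioo 0 1 ↔ Φ x 2 = 0 ∧ Φ x 0 = 0) {s : ℝ}
    (hs : s ^ 2 = 1) (hcone : ∀ t ∈ Ioo (0 : ℝ) 1,
      s • cross (S.normal j (S.edge i t)) (S.edgeTangent i t) ∈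
        posTangentConeAt (S.face j) (S.edge i t)) :
    ∀ᶠ r in 𝓝[>] (0 : ℝ), ∀ Z, S.IsFaceField j Z →
      (∀ x ∈ closure (S.face j), x ∉ Metric.ball (S.edge i t₀) (r / 2) → Z x = 0) →
      S.curlFlux j Z = s * S.edgeIntegral i Z := by
  set p := S.edge i t₀ with hp
  have hpcl : p ∈ closure (S.face j) := edge_mem_closure hj (Ioo_subset_Icc_self ht₀)
  obtain ⟨σ, U, K, h⟩ := exists_isHalfDiscChart (m := 0)
    ⟨hΦ, fun x hx hxj => ((hface x hx).mp hxj).1⟩ hpcl hpΦ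
    (Filter.mem_of_superset (Φ.open_source.mem_nhds hpΦ) hface)
  filter_upwards [h] with r ⟨hr, hn⟩ Z hZ hsupp
  rw [curlFlux, hr.integral_curl hZ hsupp]
  set T := {t ∈ Ioo (0 : ℝ) 1 | S.edge i t ∈ Metric.ball p r} with hT
  have hTs : ∀ t ∈ T, S.edge i t ∈ Φ.source := fun t ht =>
    hr.mem_source _ (Metric.ball_subset_closedBall ht.2)
  have hTopen : IsOpen T := by
    have : ContinuousOn (S.edge i) (Ioo 0 1) := fun t ht =>
      (hasDerivAt_edge i ht).continuousAt.continuousWithinAt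
    exact this.isOpen_inter_preimage isOpen_Ioo Metric.isOpen_ball
  choose! s' hs' hs'T using fun t (ht : t ∈ T) => exists_edge_coordinate hΦ hedge ht.1 (hTs t ht)
  have hcoord : ∀ t ∈ T, chartParam Φ (planePoint (0, Φ (S.edge i t) 1)) = S.edge i t ∧
      planePoint (0, Φ (S.edge i t) 1) ∈ ballDomain Φ p r := by
    intro t ht
    obtain ⟨h2, h0⟩ := (hedge _ (hTs t ht)).mp (mem_image_of_mem _ ht.1)
    have h1 : planePoint (0, Φ (S.edge i t) 1) = planeProj (Φ (S.edge i t)) := by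
      ext k; fin_cases k <;> simp [h0]
    rw [h1]
    have h3 := chartParam_planeProj Φ (hTs t ht) h2
    exact ⟨h3, planeProj_mem_chartDomain Φ (hTs t ht) h2, by rw [mem_preimage, h3]; exact ht.2⟩
  have hinj : InjOn (fun t => Φ (S.edge i t) 1) T := by
    intro a ha b hb hab
    refine S.edge_injOn i ha.1 hb.1 ?_
    rw [← (hcoord a ha).1, ← (hcoord b hb).1]
    simp only at hab
    rw [hab]
  -- Every point of the boundary line inside the ball belongs to the open edge, so the integrand
  -- vanishes off the image of `T`.
  have hleft : ∫ y, formCoeff Φ p r Z 1 (planePoint (0, y)) =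
      ∫ y in (fun t => Φ (S.edge i t) 1) '' T, formCoeff Φ p r Z 1 (planePoint (0, y)) := by
    symm
    refine setIntegral_eq_integral_of_forall_compl_eq_zero fun y hy => ?_
    rw [formCoeff, if_neg]
    intro hmem
    have h1 := apply_chartParam Φ hmem.1
    have h2 := chartParam_mem_source Φ hmem.1
    obtain ⟨t, ht, htx⟩ := (hedge _ h2).mpr (by rw [h1]; simp)
    refine hy ⟨t, ⟨ht, ?_⟩, ?_⟩
    · rw [htx]; exact hmem.2
    · simp only [htx, h1]; simp
  rw [hleft, integral_image_eq_integral_abs_deriv_smul hTopen.measurableSet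
    (fun t ht => (hs' t ht).hasDerivWithinAt) hinj, edgeIntegral,
    setIntegral_eq_of_subset_of_forall_sdiff_eq_zero measurableSet_Ioo (s := T) (fun t ht => ht.1) ?_,
    ← integral_const_mul, ← integral_const_mul]
  · refine setIntegral_congr_fun hTopen.measurableSet fun t ht => ?_
    obtain ⟨h1, h2⟩ := hcoord t ht
    have hsign : s * σ * s' t ≤ 0 := by
      refine orientation_sign hΦ (hTs t ht) ?_ (hn _ (Metric.ball_subset_closedBall ht.2)
        (edge_mem_closure hj (Ioo_subset_Icc_self ht.1))) (hs'T t ht) (hcone t ht.1)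
      have h0 := ((hedge _ (hTs t ht)).mp (mem_image_of_mem _ ht.1)).2
      filter_upwards [mem_nhdsWithin_of_mem_nhds (Φ.open_source.mem_nhds (hTs t ht)),
        self_mem_nhdsWithin] with x hx hxj
      rw [h0]
      exact ((hface x hx).mp hxj).2.le
    -- Since `s` and `σ` are signs and `s * σ * s' t ≤ 0`, the absolute value of `s' t` is `-(s * σ
    -- * s' t)`.
    have habs : -σ * |s' t| = s * s' t := by
      have hσ := hr.sign_sq
      have h1 : |s' t| = -(s * σ * s' t) := by
        rw [← abs_of_nonpos hsign, abs_mul, abs_mul]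
        have e1 : |s| = 1 := by rw [← sq_abs] at hs; nlinarith [abs_nonneg s]
        have e2 : |σ| = 1 := by rw [← sq_abs] at hσ; nlinarith [abs_nonneg σ]
        rw [e1, e2]; ring
      rw [h1]
      linear_combination s * s' t * hσ
    simp only
    rw [formCoeff_of_mem h2, chartDeriv_single_one h2.1, h1, hs'T t ht, inner_smul_right,
      smul_eq_mul, ← mul_assoc, habs]
    ring
  · intro t ht
    rw [hsupp _ (edge_mem_closure hj (Ioo_subset_Icc_self ht.1)) fun hb => ht.2 ⟨ht.1,
      Metric.ball_subset_ball (by linarith [hr.pos]) hb⟩, inner_zero_left]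

end PiecewiseSmoothSurface

end AnisotropicSurface

namespace AnisotropicSurface

/-! ### From local to global in Stokes' theorem: partition of unity and removal of the vertices. -/

theorem abs_inner_curlVec_le (D : E3 →L[ℝ] E3) {n : E3} (hn : ‖n‖ = 1) :
    |⟪curlVec D, n⟫| ≤ 2 * ‖D‖ := by
  obtain ⟨a, -, -, ha, -, hna⟩ := exists_frame hn
  have hc : cross a (cross n a) = n := by
    rw [cross_anticomm' (cross n a) a, cross_cross, ha, real_inner_self_eq_norm_sq, hna]
    simp
  have hb : ‖cross n a‖ = 1 := by
    have := norm_cross_sq n a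
    rw [hn, hna, ha] at this
    nlinarith [norm_nonneg (cross n a)]
  have h1 : |⟪D a, cross n a⟫| ≤ ‖D‖ := by
    refine (abs_real_inner_le_norm _ _).trans ?_
    rw [hb, mul_one]
    exact D.unit_le_opNorm a hna.le
  have h2 : |⟪D (cross n a), a⟫| ≤ ‖D‖ := by
    refine (abs_real_inner_le_norm _ _).trans ?_
    rw [hna, mul_one]
    exact D.unit_le_opNorm _ hb.le
  rw [← hc, inner_curlVec_cross, two_mul]
  rw [abs_le] at h1 h2 ⊢
  constructor <;> linarith [h1.1, h1.2, h2.1, h2.2]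

namespace PiecewiseSmoothSurface

open scoped NNReal ENNReal

variable {S : PiecewiseSmoothSurface} {j : Fin S.N}

variable (S) in
/-- The difference of the two sides of Stokes' theorem. -/
def stokesDefect (j : Fin S.N) (Z : E3 → E3) : ℝ :=
  S.curlFlux j Z - ∑ i, S.boundarySign j i * S.edgeIntegral i Z

theorem boundarySign_eq_zero {i : Fin S.L} (h : ¬(S.left i = j ∨ S.right i = j)) :
    S.boundarySign j i = 0 := by
  push Not at h
  simp [boundarySign, h.1, h.2]

theorem boundarySign_left (i : Fin S.L) : S.boundarySign (S.left i) i = 1 := by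
  simp [boundarySign, (S.left_ne_right i).symm]

theorem boundarySign_right (i : Fin S.L) : S.boundarySign (S.right i) i = -1 := by
  simp [boundarySign, S.left_ne_right i]

/-- Edges that do not bound the face `j` carry the sign 0. Statements about a field on this face are
thus needed only along edges contained in its closure. -/
theorem boundarySign_mul_congr {i : Fin S.L} {a b : ℝ}
    (h : (S.left i = j ∨ S.right i = j) → a = b) :
    S.boundarySign j i * a = S.boundarySign j i * b := by
  by_cases hi : S.left i = j ∨ S.right i = j
  · rw [h hi]
  · simp [boundarySign_eq_zero hi]

theorem edgeIntegral_congr {i : Fin S.L} {Z Z' : E3 → E3} (hi : S.left i = j ∨ S.right i = j)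
    (h : EqOn Z Z' (closure (S.face j))) : S.edgeIntegral i Z = S.edgeIntegral i Z' :=
  setIntegral_congr_fun measurableSet_Ioo fun t ht => by
    simp only [h (edge_mem_closure hi (Ioo_subset_Icc_self ht))]

theorem stokesDefect_congr {Z Z' : E3 → E3} (h : EqOn Z Z' (closure (S.face j))) :
    S.stokesDefect j Z = S.stokesDefect j Z' := by
  have h1 : S.curlFlux j Z = S.curlFlux j Z' :=
    setIntegral_congr_fun (S.measurableSet_face j) fun x hx => by
      simp only [fderivWithin_congr (h.mono subset_closure) (h (subset_closure hx))]
  rw [stokesDefect, stokesDefect, h1]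
  congr 1
  exact Finset.sum_congr rfl fun i _ => boundarySign_mul_congr fun hi => edgeIntegral_congr hi h

theorem stokesDefect_eq_zero_of_eqOn_zero {Z : E3 → E3}
    (h : ∀ x ∈ closure (S.face j), Z x = 0) : S.stokesDefect j Z = 0 := by
  rw [stokesDefect_congr (Z' := fun _ => 0) h]
  simp [stokesDefect, curlFlux, edgeIntegral, curlVec, inner_eq]

theorem integrableOn_edge {i : Fin S.L} {Z : E3 → E3}
    (hZ : ContinuousOn (fun t => Z (S.edge i t)) (Icc 0 1)) :
    IntegrableOn (fun t => ⟪Z (S.edge i t), S.edgeTangent i t⟫) (Ioo (0 : ℝ) 1) :=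
  ((hZ.inner (𝕜 := ℝ) (continuousOn_edgeTangent i)).integrableOn_Icc).mono_set Ioo_subset_Icc_self

theorem IsFaceField.continuousOn_edge {Z : E3 → E3} (hZ : S.IsFaceField j Z) {i : Fin S.L}
    (hi : S.left i = j ∨ S.right i = j) : ContinuousOn (fun t => Z (S.edge i t)) (Icc 0 1) :=
  hZ.continuousOn.comp (S.edge_contDiffOn i).continuousOn fun _ ht => edge_mem_closure hi ht

theorem stokesDefect_add {Z Z' : E3 → E3} (hZ : S.IsFaceField j Z) (hZ' : S.IsFaceField j Z') :
    S.stokesDefect j (fun x => Z x + Z' x) = S.stokesDefect j Z + S.stokesDefect j Z' := by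
  have h1 : S.curlFlux j (fun x => Z x + Z' x) = S.curlFlux j Z + S.curlFlux j Z' := by
    rw [curlFlux, curlFlux, curlFlux, ← integral_add (integrableOn_curl hZ) (integrableOn_curl hZ')]
    refine setIntegral_congr_fun (S.measurableSet_face j) fun x hx => ?_
    rw [inner_curlVec_eq_tderiv hx, inner_curlVec_eq_tderiv hx, inner_curlVec_eq_tderiv hx,
      hZ.tderiv_add hZ' hx]
    simp [curlVec, inner_eq]
    ring
  have h2 : ∀ i, S.boundarySign j i * S.edgeIntegral i (fun x => Z x + Z' x) =
      S.boundarySign j i * S.edgeIntegral i Z + S.boundarySign j i * S.edgeIntegral i Z' := by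
    intro i
    rw [← mul_add]
    refine boundarySign_mul_congr fun hi => ?_
    rw [edgeIntegral, edgeIntegral, edgeIntegral, ← integral_add
      (integrableOn_edge (hZ.continuousOn_edge hi)) (integrableOn_edge (hZ'.continuousOn_edge hi))]
    exact integral_congr_ae (.of_forall fun t => inner_add_left _ _ _)
  rw [stokesDefect, stokesDefect, stokesDefect, h1, Finset.sum_congr rfl fun i _ => h2 i,
    Finset.sum_add_distrib]
  ring

variable (S) in
/-- The end points of the edges. -/
def vertices : Set E3 := {v | ∃ i, ∃ t ∈ ({0, 1} : Set ℝ), v = S.edge i t}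

theorem finite_vertices : S.vertices.Finite := by
  have : S.vertices = ⋃ i, S.edge i '' {0, 1} := by
    ext v; simp [vertices, eq_comm]
  rw [this]
  exact finite_iUnion fun i => (toFinite _).image _

theorem vertices_notMem_edge {v : E3} (hv : v ∈ S.vertices) {i : Fin S.L} {t : ℝ}
    (ht : t ∈ Ioo (0 : ℝ) 1) : S.edge i t ≠ v := by
  obtain ⟨k, s, hs, rfl⟩ := hv
  intro h
  rcases hs with rfl | rfl
  · exact (S.vertex_notMem k i).1 ⟨t, ht, h⟩
  · exact (S.vertex_notMem k i).2 ⟨t, ht, h⟩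

/-- A field supported in this neighbourhood meets no other edge, so a single edge integral survives.
It serves both the localized Stokes theorem and the test fields on edges. -/
theorem exists_nhds_edgeIntegral_eq_zero {i : Fin S.L} {t : ℝ} (ht : t ∈ Ioo (0 : ℝ) 1) :
    ∀ᶠ x in 𝓝 (S.edge i t), ∀ k ≠ i, x ∉ S.edge k '' Icc 0 1 := by
  rw [Filter.eventually_all]
  intro k
  by_cases hk : k = i
  · simp [hk]
  · have : S.edge i t ∉ S.edge k '' Icc 0 1 := by
      rintro ⟨s, hs, hst⟩
      by_cases hs' : s ∈ Ioo (0 : ℝ) 1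
      · exact (S.edge_disjoint hk).ne_of_mem ⟨s, hs', rfl⟩ ⟨t, ht, rfl⟩ hst
      · refine vertices_notMem_edge (v := S.edge k s) ⟨k, s, ?_, rfl⟩ ht hst.symm
        rw [← Icc_sdiff_Ioo_same zero_le_one]
        exact ⟨hs, hs'⟩
    filter_upwards [(S.isCompact_edge k).isClosed.isOpen_compl.mem_nhds this] with x hx _
    exact hx

/-- Inside the face both sides vanish for fields of small support. At an open edge the half disc
formula matches the one remaining line integral, with the sign given by the side of the edge on
which the face lies. Vertices are left aside. -/
theorem exists_nhds_stokesDefect_eq_zero {p : E3} (hp : p ∈ closure (S.face j)) :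
    p ∈ S.vertices ∨ ∃ r > 0, ∀ Z, S.IsFaceField j Z →
      (∀ x ∈ closure (S.face j), x ∉ Metric.ball p r → Z x = 0) → S.stokesDefect j Z = 0 := by
  rcases S.closure_face_cases hp with hp | ⟨i, t, ht, rfl, h⟩ | h
  · right
    obtain ⟨r, hr, h⟩ := exists_curlFlux_eq_zero hp
    have hne : ∀ᶠ x in 𝓝 p, ∀ i, x ∉ S.edge i '' Icc 0 1 := by
      rw [Filter.eventually_all]
      exact fun i => (S.isCompact_edge i).isClosed.isOpen_compl.mem_nhds
        (disjoint_left.mp (S.face_edge_disjoint j i) hp)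
    obtain ⟨s, hs, hs0, hs1⟩ := ((eventually_forall_closedBall hne).and
      (Ioo_mem_nhdsGT (half_pos hr))).exists
    refine ⟨s, hs0, fun Z hZ hsupp => ?_⟩
    rw [stokesDefect, h Z hZ fun x hx hxb => hsupp x hx fun hb =>
      hxb (Metric.ball_subset_ball hs1.le hb), zero_sub, neg_eq_zero]
    refine Finset.sum_eq_zero fun i _ => ?_
    rw [boundarySign_mul_congr (b := 0), mul_zero]
    intro hi
    refine setIntegral_eq_zero_of_forall_eq_zero fun t ht => ?_
    rw [hsupp _ (edge_mem_closure hi (Ioo_subset_Icc_self ht)) fun hb => hs _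
      (Metric.ball_subset_closedBall hb) i (mem_image_of_mem _ (Ioo_subset_Icc_self ht)),
      inner_zero_left]
  · right
    have key : ∀ᶠ r in 𝓝[>] (0 : ℝ), ∀ Z, S.IsFaceField j Z →
        (∀ x ∈ closure (S.face j), x ∉ Metric.ball (S.edge i t) (r / 2) → Z x = 0) →
        S.curlFlux j Z = S.boundarySign j i * S.edgeIntegral i Z := by
      obtain ⟨Φ, Ψ, hΦ, hΨ, hpΦ, hpΨ, h1, h2, -⟩ := S.edge_chart i t ht
      rcases h with rfl | rfl
      · rw [boundarySign_left]
        refine exists_curlFlux_eq_edgeIntegral ht (.inl rfl) hΦ hpΦ (fun x hx => (h1 x hx).1)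
          (fun x hx => (h1 x hx).2) (by norm_num) fun t ht => ?_
        rw [one_smul]
        exact S.left_oriented i t ht
      · rw [boundarySign_right]
        refine exists_curlFlux_eq_edgeIntegral ht (.inr rfl) hΨ hpΨ (fun x hx => (h2 x hx).1)
          (fun x hx => (h2 x hx).2) (by norm_num) fun t ht => ?_
        rw [neg_one_smul]
        exact S.right_oriented i t ht
    obtain ⟨r, h1, h2, hr⟩ := (key.and ((eventually_forall_closedBall
      (exists_nhds_edgeIntegral_eq_zero ht)).and self_mem_nhdsWithin)).exists
    refine ⟨r / 2, half_pos hr, fun Z hZ hsupp => ?_⟩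
    rw [stokesDefect, h1 Z hZ hsupp, Finset.sum_eq_single i, sub_self]
    · intro k _ hk
      rw [boundarySign_mul_congr (b := 0), mul_zero]
      intro hi
      refine setIntegral_eq_zero_of_forall_eq_zero fun t ht => ?_
      rw [hsupp _ (edge_mem_closure hi (Ioo_subset_Icc_self ht)) fun hb => h2 _
        (Metric.ball_subset_closedBall (Metric.ball_subset_ball (half_le_self (le_of_lt hr)) hb)) k
          hk (mem_image_of_mem _ (Ioo_subset_Icc_self ht)), inner_zero_left]
    · simp
  · exact .inl h

theorem stokesDefect_sum {ι : Type*} (s : Finset ι) {Z : ι → E3 → E3}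
    (hZ : ∀ k, S.IsFaceField j (Z k)) (h0 : ∀ k, S.stokesDefect j (Z k) = 0) :
    S.IsFaceField j (fun x => ∑ k ∈ s, Z k x) ∧
      S.stokesDefect j (fun x => ∑ k ∈ s, Z k x) = 0 := by
  classical
  induction s using Finset.induction_on with
  | empty =>
    simp only [Finset.sum_empty]
    exact ⟨isFaceField_of_contDiff contDiff_const, stokesDefect_eq_zero_of_eqOn_zero fun _ _ => rfl⟩
  | insert a s ha ih =>
    simp only [Finset.sum_insert ha]
    exact ⟨(hZ a).add ih.1, by rw [stokesDefect_add (hZ a) ih.1, h0, ih.2, add_zero]⟩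

/-- The field is cut by a partition of unity subordinate to balls in which the local theorem holds.
Balls around vertices are harmless since the field is zero there. -/
theorem stokesDefect_eq_zero_of_eventually {Z : E3 → E3} (hZ : S.IsFaceField j Z)
    (hv : ∀ v ∈ S.vertices, ∀ᶠ x in 𝓝 v, x ∈ closure (S.face j) → Z x = 0) :
    S.stokesDefect j Z = 0 := by
  have hloc : ∀ p ∈ closure (S.face j), ∃ r > 0, ∀ χ : E3 → ℝ, ContDiff ℝ ∞ χ →
      tsupport χ ⊆ Metric.ball p r → S.stokesDefect j (fun x => χ x • Z x) = 0 := by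
    intro p hp
    rcases exists_nhds_stokesDefect_eq_zero hp with hp | ⟨r, hr, h⟩
    · obtain ⟨r, hr, h⟩ := Metric.eventually_nhds_iff_ball.mp (hv p hp)
      refine ⟨r, hr, fun χ hχ hsupp => stokesDefect_eq_zero_of_eqOn_zero fun x hx => ?_⟩
      by_cases hxb : x ∈ Metric.ball p r
      · rw [h x hxb hx, smul_zero]
      · rw [image_eq_zero_of_notMem_tsupport fun hcon => hxb (hsupp hcon), zero_smul]
    · refine ⟨r, hr, fun χ hχ hsupp => h _ (hZ.smul hχ) fun x _ hxb => ?_⟩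
      rw [image_eq_zero_of_notMem_tsupport fun hcon => hxb (hsupp hcon), zero_smul]
  choose! r hr hstokes using hloc
  obtain ⟨t, htf, htc⟩ := (S.isCompact_closure_face j).elim_nhds_subcover
    (fun p => Metric.ball p (r p)) fun p hp => Metric.ball_mem_nhds p (hr p hp)
  obtain ⟨f, hf⟩ := SmoothPartitionOfUnity.exists_isSubordinate 𝓘(ℝ, E3)
    (isClosed_closure (s := S.face j)) (fun p : t => Metric.ball (p : E3) (r p))
    (fun _ => Metric.isOpen_ball) (by simpa [iUnion_subtype] using htc)
  have hsum := (stokesDefect_sum Finset.univ (fun k : t => hZ.smul (f k).contMDiff.contDiff)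
    fun k => hstokes k (htf k k.2) _ (f k).contMDiff.contDiff (hf k)).2
  rw [← hsum]
  refine stokesDefect_congr fun x hx => ?_
  rw [← Finset.sum_smul, ← finsum_eq_sum_of_fintype, f.sum_eq_one hx, one_smul]

/-- Dominated convergence: the cutoffs are bounded by 1 and tend to zero pointwise along the open
edge, which does not pass through `v`. -/
theorem tendsto_edgeIntegral_smul {Z : E3 → E3} (hZ : S.IsFaceField j Z) {i : Fin S.L}
    (hi : S.left i = j ∨ S.right i = j) {β : ℕ → E3 → ℝ} (hβs : ∀ n, ContDiff ℝ ∞ (β n))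
    (hβ : ∀ n x, ‖β n x‖ ≤ 1) {v : E3} (hv : v ∈ S.vertices)
    (hlim : ∀ x, x ≠ v → ∀ᶠ n in Filter.atTop, β n x = 0) :
    Filter.Tendsto (fun n => S.edgeIntegral i (fun x => β n x • Z x)) Filter.atTop (𝓝 0) := by
  obtain ⟨A, hA0, hA⟩ := hZ.exists_bound
  have hint : IntegrableOn (fun t => ‖S.edgeTangent i t‖) (Ioo (0 : ℝ) 1) :=
    ((continuousOn_edgeTangent i).norm.integrableOn_Icc).mono_set Ioo_subset_Icc_self
  have h0 : ∫ _ in Ioo (0 : ℝ) 1, (0 : ℝ) = 0 := integral_zero _ _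
  rw [← h0]
  refine tendsto_integral_of_dominated_convergence (fun t => A * ‖S.edgeTangent i t‖)
    (fun n => (integrableOn_edge (Z := fun x => β n x • Z x)
      ((hZ.smul (hβs n)).continuousOn_edge hi)).aestronglyMeasurable)
    (hint.const_mul A) (fun n => ?_) ?_
  · refine (ae_restrict_iff' measurableSet_Ioo).mpr (.of_forall fun t ht => ?_)
    refine (abs_real_inner_le_norm _ _).trans ?_
    rw [norm_smul]
    refine mul_le_mul_of_nonneg_right ?_ (norm_nonneg _)
    have h1 := hA _ (edge_mem_closure hi (Ioo_subset_Icc_self ht))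
    have h2 := hβ n (S.edge i t)
    have h3 := norm_nonneg (Z (S.edge i t))
    nlinarith
  · refine (ae_restrict_iff' measurableSet_Ioo).mpr (.of_forall fun t ht => ?_)
    refine tendsto_const_nhds.congr' ?_
    filter_upwards [hlim _ (vertices_notMem_edge hv ht)] with n hn
    rw [hn, zero_smul, inner_zero_left]

set_option maxHeartbeats 400000 in
/-- A vertex is removable in Stokes' theorem. -/
theorem stokesDefect_eq_zero_of_cutoff {Z : E3 → E3} (hZ : S.IsFaceField j Z) {v : E3}
    (hv : v ∈ S.vertices) (h : ∀ χ : E3 → ℝ, ContDiff ℝ ∞ χ → (∀ᶠ x in 𝓝 v, χ x = 0) →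
      S.stokesDefect j (fun x => χ x • Z x) = 0) : S.stokesDefect j Z = 0 := by
  set b : ContDiffBump (0 : E3) := ⟨1, 2, one_pos, one_lt_two⟩ with hb
  -- The cutoff `β n` is 1 within distance `1 / (n + 1)` of `v` and 0 beyond `2 / (n + 1)`.
  set β : ℕ → E3 → ℝ := fun n x => b (((n : ℝ) + 1) • (x - v)) with hβ
  have hβs : ∀ n, ContDiff ℝ ∞ (β n) := fun n =>
    b.contDiff.comp ((contDiff_id.sub contDiff_const).const_smul ((n : ℝ) + 1))
  have hN : ∀ n : ℕ, (0 : ℝ) < (n : ℝ) + 1 := fun n => by positivity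
  have hβ0 : ∀ (n : ℕ) x, 2 / ((n : ℝ) + 1) ≤ dist x v → β n x = 0 := by
    intro n x hx
    refine b.zero_of_le_dist ?_
    rw [dist_zero_right, norm_smul, Real.norm_of_nonneg (hN n).le, ← dist_eq_norm]
    rw [div_le_iff₀' (hN n)] at hx
    exact hx
  -- The part `(1 - β n) • Z` vanishes near the vertex and has no defect, so the whole defect is
  -- carried by `β n • Z` for every `n`.
  have hdefect : ∀ n, S.stokesDefect j Z = S.stokesDefect j (fun x => β n x • Z x) := by
    intro n
    have h1 : ContDiff ℝ ∞ (fun x => 1 - β n x) := contDiff_const.sub (hβs n)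
    have h2 := h _ h1 (by
      have : ∀ᶠ x in 𝓝 v, dist x v < 1 / ((n : ℝ) + 1) :=
        Metric.ball_mem_nhds v (one_div_pos.mpr (hN n))
      filter_upwards [this] with x hx
      rw [hβ, sub_eq_zero, eq_comm]
      refine b.one_of_mem_closedBall ?_
      rw [mem_closedBall_zero_iff, norm_smul, Real.norm_of_nonneg (hN n).le, ← dist_eq_norm]
      rw [lt_div_iff₀' (hN n)] at hx
      exact hx.le)
    have h3 := stokesDefect_add (hZ.smul h1) (hZ.smul (hβs n))
    rw [h2, zero_add] at h3
    rw [← h3]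
    refine stokesDefect_congr fun x _ => ?_
    rw [← add_smul, sub_add_cancel, one_smul]
  obtain ⟨C, hC0, r₀, hr₀, harea⟩ := measure_face_inter_ball_le (S := S) (j := j) v
  obtain ⟨A, hA0, hA⟩ := hZ.exists_bound
  obtain ⟨B, hB⟩ := hZ.bounded
  obtain ⟨G, hG⟩ := (b.contDiff (n := 1).continuous_fderiv
    (by norm_num)).bounded_above_of_compact_support (b.hasCompactSupport.fderiv ℝ)
  have hG0 : 0 ≤ G := (norm_nonneg _).trans (hG 0)
  -- Product rule: `A` bounds `Z`, `2 * G` bounds the tangential derivative of the unscaled bump (2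
  -- for the norm of the projection), and `B` bounds the tangential derivative of `Z`. Scaling the
  -- bump costs a factor `n + 1`.
  set M := A * (2 * G) + |B| with hM
  have hM0 : 0 ≤ M := by positivity
  have htd : ∀ n : ℕ, ∀ x ∈ S.face j, ‖S.tderiv j (fun x => β n x • Z x) x‖ ≤ ((n : ℝ) + 1) * M := by
    intro n x hx
    have h1 : S.tderiv j (fun x => β n x • Z x) x = _ :=
      IsFaceField.tderiv_bilinear (ContinuousLinearMap.lsmul ℝ ℝ)
        (isFaceField_of_contDiff (hβs n)) hZ hx
    have h2 : ‖S.tderiv j (β n) x‖ ≤ ((n : ℝ) + 1) * (2 * G) := by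
      have hd : HasFDerivAt (β n) ((fderiv ℝ b (((n : ℝ) + 1) • (x - v))).comp
          (((n : ℝ) + 1) • ContinuousLinearMap.id ℝ E3)) x :=
        (b.contDiff (n := 1).differentiable (by norm_num) _).hasFDerivAt.comp x
          (((hasFDerivAt_id x).sub_const v).const_smul ((n : ℝ) + 1))
      rw [tderiv_eq hx hd.hasFDerivWithinAt, ContinuousLinearMap.comp_smul,
        ContinuousLinearMap.comp_id, ContinuousLinearMap.smul_comp, norm_smul,
        Real.norm_of_nonneg (hN n).le]
      refine mul_le_mul_of_nonneg_left ?_ (hN n).le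
      refine (ContinuousLinearMap.opNorm_comp_le _ _).trans ?_
      rw [mul_comm]
      exact mul_le_mul (norm_tangentProj_le (norm_normal_face hx)) (hG _) (norm_nonneg _) (by simp)
    have h3 : ‖β n x‖ ≤ 1 := by
      rw [Real.norm_of_nonneg b.nonneg]; exact b.le_one
    have h4 : ‖S.tderiv j Z x‖ ≤ |B| := (hB x hx).trans (le_abs_self B)
    have h5 := hA x (subset_closure hx)
    rw [h1]
    refine (norm_add_le _ _).trans ?_
    have e1 : ‖((ContinuousLinearMap.lsmul ℝ ℝ).flip (Z x)).comp (S.tderiv j (β n) x)‖ ≤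
        A * (((n : ℝ) + 1) * (2 * G)) := by
      refine (ContinuousLinearMap.opNorm_comp_le _ _).trans (mul_le_mul ?_ h2 (norm_nonneg _) hA0)
      refine ContinuousLinearMap.opNorm_le_bound _ hA0 fun c => ?_
      simp only [ContinuousLinearMap.flip_apply, ContinuousLinearMap.lsmul_apply, norm_smul]
      rw [mul_comm]
      gcongr
    have e2 : ‖(ContinuousLinearMap.lsmul ℝ ℝ (β n x)).comp (S.tderiv j Z x)‖ ≤
        1 * |B| := by
      refine (ContinuousLinearMap.opNorm_comp_le _ _).trans (mul_le_mul ?_ h4 (norm_nonneg _)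
        zero_le_one)
      refine ContinuousLinearMap.opNorm_le_bound _ zero_le_one fun c => ?_
      rw [ContinuousLinearMap.lsmul_apply, norm_smul]
      gcongr
    refine (add_le_add e1 e2).trans ?_
    have := abs_nonneg B
    have hn : (0 : ℝ) ≤ n := by positivity
    rw [hM]
    nlinarith
  have hflux : Filter.Tendsto (fun n => S.curlFlux j (fun x => β n x • Z x)) Filter.atTop
      (𝓝 0) := by
    -- The curl is at most `2 * ((n + 1) * M)` and the area at most `C * (3 / (n + 1)) ^ 2`, whence
    -- the constant 18.
    have hlim : Filter.Tendsto (fun n : ℕ => 18 * M * C * (1 / ((n : ℝ) + 1))) Filter.atTop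
        (𝓝 0) := by
      simpa using tendsto_one_div_add_atTop_nhds_zero_nat.const_mul (18 * M * C)
    refine squeeze_zero_norm' ?_ hlim
    have hsmall : ∀ᶠ n : ℕ in Filter.atTop, 3 * (1 / ((n : ℝ) + 1)) < r₀ := by
      have := (tendsto_one_div_add_atTop_nhds_zero_nat (𝕜 := ℝ)).const_mul 3
      rw [mul_zero] at this
      exact this.eventually (gt_mem_nhds hr₀)
    filter_upwards [hsmall] with n hn
    have hNn := hN n
    have h3 : 3 * (1 / ((n : ℝ) + 1)) = 3 / ((n : ℝ) + 1) := by ring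
    rw [h3] at hn
    have hpos : 0 < 3 / ((n : ℝ) + 1) := by positivity
    have hsub : S.face j ∩ Metric.ball v (3 / ((n : ℝ) + 1)) ⊆ S.face j := inter_subset_left
    -- The radius 3 instead of 2 leaves a margin: outside the larger ball the field vanishes in a
    -- whole neighbourhood, and so does its derivative.
    have hzero : ∀ x ∈ S.face j \ (S.face j ∩ Metric.ball v (3 / ((n : ℝ) + 1))),
        ⟪curlVec (fderivWithin ℝ (fun x => β n x • Z x) (S.face j) x), S.normal j x⟫ = 0 := by
      rintro x ⟨hx, hxb⟩
      have hfar : 2 / ((n : ℝ) + 1) < dist x v := by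
        have : ¬ dist x v < 3 / ((n : ℝ) + 1) := fun hlt => hxb ⟨hx, hlt⟩
        refine lt_of_lt_of_le ?_ (not_lt.mp this)
        gcongr
        norm_num
      have : S.tderiv j (fun x => β n x • Z x) x = 0 := by
        refine tderiv_eq_zero hx (mem_nhdsWithin_of_mem_nhds ?_)
        filter_upwards [(continuous_id.dist continuous_const).continuousAt.eventually
          (lt_mem_nhds hfar)] with y hy
        rw [hβ0 n y (le_of_lt hy), zero_smul]
      rw [inner_curlVec_eq_tderiv hx, this]
      simp [curlVec, inner_eq]
    have hmeas := harea _ hpos hn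
    have hreal : (μHE[2] : Measure E3).real (S.face j ∩ Metric.ball v (3 / ((n : ℝ) + 1))) ≤
        C * (3 / ((n : ℝ) + 1)) ^ 2 :=
      ENNReal.toReal_le_of_le_ofReal (by positivity) hmeas
    rw [curlFlux, setIntegral_eq_of_subset_of_forall_sdiff_eq_zero (S.measurableSet_face j) hsub
      hzero]
    refine (norm_setIntegral_le_of_norm_le_const (C := 2 * (((n : ℝ) + 1) * M))
      (hmeas.trans_lt ENNReal.ofReal_lt_top) fun x hx => ?_).trans ?_
    · rw [Real.norm_eq_abs, inner_curlVec_eq_tderiv hx.1]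
      refine (abs_inner_curlVec_le _ (norm_normal_face hx.1)).trans ?_
      have := htd n x hx.1
      linarith
    · refine (mul_le_mul_of_nonneg_left hreal (by positivity)).trans (le_of_eq ?_)
      field_simp
      ring
  have hedge : ∀ i, Filter.Tendsto (fun n => S.boundarySign j i *
      S.edgeIntegral i (fun x => β n x • Z x)) Filter.atTop (𝓝 0) := by
    intro i
    by_cases hi : S.left i = j ∨ S.right i = j
    · rw [← mul_zero (S.boundarySign j i)]
      refine Filter.Tendsto.const_mul _ (tendsto_edgeIntegral_smul hZ hi hβs
        (fun n x => by rw [Real.norm_of_nonneg b.nonneg]; exact b.le_one) hv fun x hx => ?_)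
      have hsmall : ∀ᶠ n : ℕ in Filter.atTop, 2 * (1 / ((n : ℝ) + 1)) < dist x v := by
        have := (tendsto_one_div_add_atTop_nhds_zero_nat (𝕜 := ℝ)).const_mul 2
        rw [mul_zero] at this
        exact this.eventually (gt_mem_nhds (dist_pos.mpr hx))
      filter_upwards [hsmall] with n hn
      rw [hβ0 n _ (by rw [mul_one_div] at hn; exact hn.le)]
    · simp [boundarySign_eq_zero hi]
  have hlim : Filter.Tendsto (fun n => S.stokesDefect j (fun x => β n x • Z x)) Filter.atTop
      (𝓝 0) := by
    simpa [stokesDefect] using hflux.sub (tendsto_finsetSum Finset.univ fun i _ => hedge i)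
  have hconst : Filter.Tendsto (fun n => S.stokesDefect j (fun x => β n x • Z x)) Filter.atTop
      (𝓝 (S.stokesDefect j Z)) := tendsto_const_nhds.congr hdefect
  exact tendsto_nhds_unique hconst hlim

/-- Stokes' theorem on a face. -/
theorem curlFlux_eq_sum {Z : E3 → E3} (hZ : S.IsFaceField j Z) :
    S.curlFlux j Z = ∑ i, S.boundarySign j i * S.edgeIntegral i Z := by
  -- Induction on the finite set `F` of vertices near which `Z` may be nonzero; one cutoff removes
  -- one vertex from it.
  have key : ∀ F : Set E3, F.Finite → F ⊆ S.vertices → ∀ Z, S.IsFaceField j Z →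
      (∀ v ∈ S.vertices, v ∉ F → ∀ᶠ x in 𝓝 v, x ∈ closure (S.face j) → Z x = 0) →
      S.stokesDefect j Z = 0 := by
    intro F hF
    induction F, hF using Set.Finite.induction_on with
    | empty => exact fun _ Z hZ h => stokesDefect_eq_zero_of_eventually hZ fun v hv => h v hv id
    | @insert a F _ _ ih =>
      intro hsub Z hZ h
      refine stokesDefect_eq_zero_of_cutoff hZ (hsub (mem_insert _ _)) fun χ hχ hχ0 => ?_
      refine ih ((subset_insert _ _).trans hsub) _ (hZ.smul hχ) fun v hv hvF => ?_
      by_cases hva : v = a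
      · subst hva
        filter_upwards [hχ0] with x hx _
        rw [hx, zero_smul]
      · filter_upwards [h v hv fun hm => hm.elim hva hvF] with x hx hxj
        rw [hx hxj, smul_zero]
  exact sub_eq_zero.mp (key S.vertices finite_vertices subset_rfl Z hZ fun v hv hv' =>
    absurd hv hv')

end PiecewiseSmoothSurface

end AnisotropicSurface

namespace AnisotropicSurface

namespace PiecewiseSmoothSurface

variable {S : PiecewiseSmoothSurface} {j : Fin S.N}

/-! ### Integration by parts on the surface -/

theorem surfaceDiv_eq (Y : E3 → E3) (p : E3) :
    S.surfaceDiv j Y p = LinearMap.trace ℝ E3 (S.tderiv j Y p : E3 →ₗ[ℝ] E3) :=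
  trace_sub_inner _ _

theorem IsFaceField.continuousOn_surfaceDiv {Y : E3 → E3} (hY : S.IsFaceField j Y) :
    ContinuousOn (S.surfaceDiv j Y) (S.face j) :=
  (continuous_trace.comp_continuousOn hY.continuousOn_tderiv).congr fun p _ => surfaceDiv_eq Y p

theorem IsFaceField.exists_bound_surfaceDiv {Y : E3 → E3} (hY : S.IsFaceField j Y) :
    ∃ C, ∀ p ∈ S.face j, |S.surfaceDiv j Y p| ≤ C := by
  obtain ⟨C, hC⟩ := hY.bounded
  obtain ⟨C', hC'⟩ := exists_bound_of_continuous continuous_trace C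
  exact ⟨C', fun p hp => by rw [surfaceDiv_eq]; exact hC' _ (hC p hp)⟩

theorem integrableOn_surfaceDiv_mul {Y W : E3 → E3} (hY : S.IsFaceField j Y)
    (hW : S.IsFaceField j W) :
    IntegrableOn (fun p => S.surfaceDiv j Y p * ⟪W p, S.normal j p⟫) (S.face j) μHE[2] := by
  obtain ⟨C, hC⟩ := hY.exists_bound_surfaceDiv
  obtain ⟨B, hB0, hB⟩ := hW.exists_bound
  refine integrableOn_face (C := C * B) (hY.continuousOn_surfaceDiv.mul
    ((hW.continuousOn.mono subset_closure).inner ((S.normal_continuousOn j).mono subset_closure)))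
    fun p hp => ?_
  rw [abs_mul]
  have h1 := hC p hp
  refine mul_le_mul h1 ?_ (abs_nonneg _) ((abs_nonneg _).trans h1)
  refine (abs_real_inner_le_norm _ _).trans ?_
  rw [norm_normal_face hp, mul_one]
  exact hB p (subset_closure hp)

variable (S) in
/-- The tangential variation of the integral of `⟪Y, ν⟫`. -/
def areaVariation (j : Fin S.N) (Y W : E3 → E3) : ℝ :=
  ∫ p in S.face j, ⟪Y p, areaPolar (ContinuousLinearMap.id ℝ E3)
    (fderivWithin ℝ W (S.face j) p) (S.normal j p)⟫ ∂μHE[2]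

/-- The algebraic identity `inner_curlVec_crossField` is applied to tangential derivatives. The
hypothesis `hperp` kills its last term `⟪D' W, n⟫`, leaving a divergence and a curl to which Stokes'
theorem applies. -/
theorem inner_curlVec_cross_field {Y W : E3 → E3} (hY : S.IsFaceField j Y)
    (hW : S.IsFaceField j W) {p : E3} (hp : p ∈ S.face j)
    (hperp : ∀ v, ⟪S.tderiv j Y p v, S.normal j p⟫ = 0) :
    ⟪Y p, areaPolar (ContinuousLinearMap.id ℝ E3) (fderivWithin ℝ W (S.face j) p) (S.normal j p)⟫ =
      S.surfaceDiv j Y p * ⟪W p, S.normal j p⟫ -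
      ⟪curlVec (fderivWithin ℝ (fun x => cross (W x) (Y x)) (S.face j) p), S.normal j p⟫ := by
  have h1 : S.tderiv j (fun x => cross (W x) (Y x)) p = _ := hW.tderiv_bilinear crossL hY hp
  have h2 : areaPolar (ContinuousLinearMap.id ℝ E3) (fderivWithin ℝ W (S.face j) p) (S.normal j p) =
      areaPolar (ContinuousLinearMap.id ℝ E3) (S.tderiv j W p) (S.normal j p) :=
    areaPolar_congr (norm_normal_face hp) (fun _ _ => rfl) fun v hv => (tderiv_apply hv).symm
  rw [inner_curlVec_eq_tderiv hp, h1, inner_curlVec_crossField, hperp, h2, surfaceDiv_eq]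
  ring

theorem areaVariation_eq {Y W : E3 → E3} (hY : S.IsFaceField j Y) (hW : S.IsFaceField j W)
    (hperp : ∀ p ∈ S.face j, ∀ v, ⟪S.tderiv j Y p v, S.normal j p⟫ = 0) :
    S.areaVariation j Y W =
      ∫ p in S.face j, S.surfaceDiv j Y p * ⟪W p, S.normal j p⟫ ∂μHE[2] -
      ∑ i, S.boundarySign j i * S.edgeIntegral i (fun x => cross (W x) (Y x)) := by
  rw [← curlFlux_eq_sum (hW.cross hY), curlFlux, ← integral_sub (integrableOn_surfaceDiv_mul hY hW)
    (integrableOn_curl (hW.cross hY))]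
  exact setIntegral_congr_fun (S.measurableSet_face j) fun p hp =>
    inner_curlVec_cross_field hY hW hp (hperp p hp)

variable (S) in
/-- The work of the jump of the field `Y` across an edge. -/
def edgeWork (i : Fin S.L) (Y : Fin S.N → E3 → E3) (W : E3 → E3) : ℝ :=
  ∫ t in Ioo (0 : ℝ) 1, ⟪W (S.edge i t), cross (Y (S.left i) (S.edge i t) -
    Y (S.right i) (S.edge i t)) (S.edgeTangent i t)⟫

/-- After exchanging the sums over faces and edges, each edge collects the contribution of its left
face minus that of its right face. The triple product identity then frees `W` and leaves the jump of
`Y` crossed with the tangent. -/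
theorem sum_areaVariation {Y : Fin S.N → E3 → E3} {W : E3 → E3}
    (hY : ∀ j, S.IsFaceField j (Y j)) (hW : ∀ j, S.IsFaceField j W)
    (hperp : ∀ j, ∀ p ∈ S.face j, ∀ v, ⟪S.tderiv j (Y j) p v, S.normal j p⟫ = 0) :
    ∑ j, S.areaVariation j (Y j) W =
      ∑ j, ∫ p in S.face j, S.surfaceDiv j (Y j) p * ⟪W p, S.normal j p⟫ ∂μHE[2] -
      ∑ i, S.edgeWork i Y W := by
  rw [Finset.sum_congr rfl fun j _ => areaVariation_eq (hY j) (hW j) (hperp j),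
    Finset.sum_sub_distrib, Finset.sum_comm]
  congr 1
  refine Finset.sum_congr rfl fun i _ => ?_
  have hterm : ∀ j, S.boundarySign j i * S.edgeIntegral i (fun x => cross (W x) (Y j x)) =
      (if S.left i = j then S.edgeIntegral i (fun x => cross (W x) (Y j x)) else 0) -
      (if S.right i = j then S.edgeIntegral i (fun x => cross (W x) (Y j x)) else 0) := by
    intro j
    rw [boundarySign, sub_mul]
    simp
  rw [Finset.sum_congr rfl fun j _ => hterm j, Finset.sum_sub_distrib, Finset.sum_ite_eq,
    Finset.sum_ite_eq, if_pos (Finset.mem_univ _), if_pos (Finset.mem_univ _), edgeIntegral,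
    edgeIntegral, ← integral_sub
      (integrableOn_edge (Z := fun x => cross (W x) (Y (S.left i) x))
        (((hW _).cross (hY _)).continuousOn_edge (.inl rfl)))
      (integrableOn_edge (Z := fun x => cross (W x) (Y (S.right i) x))
        (((hW _).cross (hY _)).continuousOn_edge (.inr rfl))), edgeWork]
  refine integral_congr_ae (.of_forall fun t => ?_)
  simp only
  rw [inner_cross_left_eq, inner_cross_left_eq, ← inner_sub_right]
  simp only [← crossL_apply, map_sub, sub_apply]

variable (S) in
/-- The flux of a vector field through the surface. -/
def flux (W : E3 → E3) : ℝ := ∑ j, ∫ p in S.face j, ⟪W p, S.normal j p⟫ ∂μHE[2]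

theorem tderiv_id {p : E3} (hp : p ∈ S.face j) :
    S.tderiv j (fun x => x) p = tangentProj (S.normal j p) := by
  rw [tderiv_eq (f := fun x => x) hp (hasFDerivWithinAt_id p _), ContinuousLinearMap.id_comp]

/-- The position field has no jump across edges, and its surface divergence is the trace of the
tangential projection, `3 - ‖ν‖² = 2`. -/
theorem sum_areaVariation_id {W : E3 → E3} (hW : ∀ j, S.IsFaceField j W) :
    ∑ j, S.areaVariation j (fun x => x) W = 2 * S.flux W := by
  rw [sum_areaVariation (Y := fun _ x => x) (fun j => isFaceField_of_contDiff contDiff_id) hW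
    (fun j p hp v => by
      rw [tderiv_id hp, real_inner_comm, inner_tangentProj (norm_normal_face hp)])]
  have h1 : ∀ i, S.edgeWork i (fun _ x => x) W = 0 := fun i => by
    simp [edgeWork, ← crossL_apply]
  rw [Finset.sum_eq_zero fun i _ => h1 i, sub_zero, flux, Finset.mul_sum]
  refine Finset.sum_congr rfl fun j _ => ?_
  rw [← integral_const_mul]
  refine setIntegral_congr_fun (S.measurableSet_face j) fun p hp => ?_
  rw [surfaceDiv_eq, tderiv_id hp, trace_eq]
  have hn := norm_normal_face hp
  have hn2 : S.normal j p 0 ^ 2 + S.normal j p 1 ^ 2 + S.normal j p 2 ^ 2 = 1 := by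
    have := EuclideanSpace.norm_sq_eq (S.normal j p)
    rw [hn, Fin.sum_univ_three] at this
    simpa using this.symm
  congr 1
  simp [tangentProj_apply, inner_eq]
  linear_combination (-1) * hn2

theorem normal_ne_zero {p : E3} (hp : p ∈ closure (S.face j)) : S.normal j p ≠ 0 := by
  intro h
  have := S.norm_normal j p hp
  simp [h] at this

variable {γ : S2 → ℝ} (hγ' : ContMDiff (𝓡 2) 𝓘(ℝ, ℝ) 3 γ)
include hγ'

theorem contDiffOn_cahnHoffman : ContDiffOn ℝ 1 (S.cahnHoffman γ j) (closure (S.face j)) :=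
  fun p hp => ((contDiffAt_gradient_homExt hγ' (normal_ne_zero hp)).of_le
    (by norm_num)).comp_contDiffWithinAt p ((S.normal_contDiffOn j p hp).of_le (by norm_num))

theorem isFaceField_cahnHoffman : S.IsFaceField j (S.cahnHoffman γ j) :=
  isFaceField_of_contDiffOn (contDiffOn_cahnHoffman hγ')

/-- By the chain rule the derivative of `ξ` has values in the range of the Hessian of the extension
at `ν`, which is orthogonal to `ν`. -/
theorem inner_tderiv_cahnHoffman {p : E3} (hp : p ∈ S.face j) (v : E3) :
    ⟪S.tderiv j (S.cahnHoffman γ j) p v, S.normal j p⟫ = 0 := by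
  have hne := normal_ne_zero (subset_closure hp)
  have h1 : HasFDerivAt (gradient (homExt γ)) _ (S.normal j p) :=
    ((contDiffAt_gradient_homExt hγ' hne).differentiableAt (by norm_num)).hasFDerivAt
  have h2 := h1.comp_hasFDerivWithinAt p ((isFaceField_normal (S := S) (j := j)).hasFDerivWithinAt hp)
  rw [tderiv_eq (f := S.cahnHoffman γ j) hp h2, real_inner_comm]
  exact inner_fderiv_gradient_homExt hγ' hne _

theorem sum_areaVariation_cahnHoffman {W : E3 → E3} (hW : ∀ j, S.IsFaceField j W) :
    ∑ j, S.areaVariation j (S.cahnHoffman γ j) W =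
      -∑ j, ∫ p in S.face j, S.anisotropicMeanCurvature γ j p * ⟪W p, S.normal j p⟫ ∂μHE[2] -
      ∑ i, S.edgeWork i (S.cahnHoffman γ) W := by
  rw [sum_areaVariation (Y := S.cahnHoffman γ) (fun j => isFaceField_cahnHoffman hγ') hW
    fun j p hp v => inner_tderiv_cahnHoffman hγ' hp v, ← Finset.sum_neg_distrib]
  congr 1
  refine Finset.sum_congr rfl fun j _ => ?_
  rw [← integral_neg]
  simp [anisotropicMeanCurvature]

end PiecewiseSmoothSurface

end AnisotropicSurface

namespace AnisotropicSurface

namespace PiecewiseSmoothSurface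

variable {S : PiecewiseSmoothSurface} {j : Fin S.N}

/-! ### Families of maps -/

/-- Near each of its points, a face is a smooth retract of the space. -/
theorem exists_retraction {p : E3} (hp : p ∈ S.face j) : ∃ ρ : E3 → E3, ContDiffAt ℝ ∞ ρ p ∧
    ρ p = p ∧ (∀ᶠ x in 𝓝 p, ρ x ∈ S.face j) ∧ ∀ᶠ x in 𝓝 p, x ∈ S.face j → ρ x = x := by
  obtain ⟨Φ, hΦ, hpΦ, hiff, -⟩ := S.face_chart' hp
  have h2 := (hiff p hpΦ).mp hp
  have hdom := planeProj_mem_chartDomain Φ hpΦ h2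
  have hc : ContDiffAt ℝ ∞ (fun x => planeProj (Φ x)) p :=
    planeProj.contDiff.contDiffAt.comp p (contDiffAt_chart hΦ hpΦ)
  refine ⟨fun x => chartParam Φ (planeProj (Φ x)), ?_, chartParam_planeProj Φ hpΦ h2, ?_, ?_⟩
  · exact ContDiffAt.comp (g := chartParam Φ) p (contDiffAt_chartParam hΦ hdom) hc
  · filter_upwards [hc.continuousAt.eventually ((isOpen_chartDomain Φ).mem_nhds hdom)] with x hx
    rw [hiff _ (chartParam_mem_source Φ hx), apply_chartParam Φ hx, planeIncl_two]
  · filter_upwards [Φ.open_source.mem_nhds hpΦ] with x hx hxj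
    exact chartParam_planeProj Φ hx ((hiff x hx).mp hxj)

/-- The velocity of a family of maps. -/
def velocity (X : ℝ → E3 → E3) (ε : ℝ) (p : E3) : E3 := deriv (fun s => X s p) ε

variable (S) in
/-- The velocity of the tangential derivative of a family of maps. -/
def tderivVelocity (j : Fin S.N) (X : ℝ → E3 → E3) (ε : ℝ) (p : E3) : E3 →L[ℝ] E3 :=
  deriv (fun s => S.tderiv j (X s) p) ε

variable (S) in
/-- The family `X` is smooth on the closed face `j`. -/
def SmoothOnFace (j : Fin S.N) (δ : ℝ) (X : ℝ → E3 → E3) : Prop :=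
  ContDiffOn ℝ ∞ (fun q : ℝ × E3 => X q.1 q.2) (Ioo (-δ) δ ×ˢ closure (S.face j))

variable {δ : ℝ} {X : ℝ → E3 → E3}

/-- Composing with a local smooth retraction onto the face replaces derivatives within the face by
derivatives on an open set of `ℝ × E3`, where the usual calculus is available. -/
theorem SmoothOnFace.exists_extension (hX : S.SmoothOnFace j δ X) {ε : ℝ} (hε : ε ∈ Ioo (-δ) δ)
    {p : E3} (hp : p ∈ S.face j) : ∃ h : ℝ × E3 → E3, ContDiffAt ℝ ∞ h (ε, p) ∧
      ∀ᶠ q : ℝ × E3 in 𝓝 (ε, p), q.2 ∈ S.face j → h q = X q.1 q.2 := by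
  obtain ⟨ρ, hρ, hρp, hρf, hρe⟩ := exists_retraction hp
  refine ⟨fun q => X q.1 (ρ q.2), ?_, ?_⟩
  · have hg : ContDiffAt ℝ ∞ (fun q : ℝ × E3 => (q.1, ρ q.2)) (ε, p) :=
      contDiffAt_fst.prodMk (ContDiffAt.comp (ε, p) hρ contDiffAt_snd)
    have hmem : (ε, ρ p) ∈ Ioo (-δ) δ ×ˢ closure (S.face j) :=
      ⟨hε, by rw [hρp]; exact subset_closure hp⟩
    have := ContDiffWithinAt.comp_of_preimage_mem_nhdsWithin (s := univ) (ε, p)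
      (f := fun q : ℝ × E3 => (q.1, ρ q.2)) (hX _ hmem) hg.contDiffWithinAt ?_
    · exact contDiffWithinAt_univ.mp this
    · rw [nhdsWithin_univ]
      filter_upwards [continuous_fst.continuousAt.eventually (isOpen_Ioo.mem_nhds hε),
        continuous_snd.continuousAt.eventually hρf] with q h1 h2
      exact ⟨h1, subset_closure h2⟩
  · filter_upwards [continuous_snd.continuousAt.eventually hρe] with q hq hqj
    simp only [hq hqj]

/-- The tangential derivative, the velocities and the mixed derivative in terms of a smooth
extension. -/
theorem eventually_extension {h : ℝ × E3 → E3} {q₀ : ℝ × E3} (hh : ContDiffAt ℝ ∞ h q₀)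
    (heq : ∀ᶠ q : ℝ × E3 in 𝓝 q₀, q.2 ∈ S.face j → h q = X q.1 q.2) :
    ∀ᶠ q : ℝ × E3 in 𝓝 q₀, q.2 ∈ S.face j →
      S.tderiv j (X q.1) q.2 = ((fderiv ℝ h q).comp (.inr ℝ ℝ E3)).comp
        (tangentProj (S.normal j q.2)) ∧
      HasDerivAt (fun s => X s q.2) (fderiv ℝ h q (1, 0)) q.1 := by
  have hd : ∀ᶠ q in 𝓝 q₀, DifferentiableAt ℝ h q :=
    ((hh.of_le (m := 1) (by norm_num)).eventually (by norm_num)).mono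
      fun q hq => hq.differentiableAt (by norm_num)
  filter_upwards [heq.eventually_nhds, hd] with q hq hdq hqj
  constructor
  · have h1 : HasFDerivAt (fun x => h (q.1, x)) ((fderiv ℝ h q).comp (.inr ℝ ℝ E3)) q.2 :=
      hdq.hasFDerivAt.comp q.2 (hasFDerivAt_prodMk_right q.1 q.2)
    have hev : ∀ᶠ x in 𝓝[S.face j] q.2, X q.1 x = h (q.1, x) := by
      rw [eventually_nhdsWithin_iff]
      have hc : ContinuousAt (fun x : E3 => (q.1, x)) q.2 := by fun_prop
      exact (hc.eventually hq).mono fun x hx hxj => (hx hxj).symm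
    exact tderiv_eq hqj (h1.hasFDerivWithinAt.congr_of_eventuallyEq hev
      (hev.self_of_nhdsWithin hqj))
  · have h1 : HasDerivAt (fun s => h (s, q.2)) (fderiv ℝ h q (1, 0)) q.1 :=
      hdq.hasFDerivAt.comp_hasDerivAt q.1 ((hasDerivAt_id q.1).prodMk (hasDerivAt_const q.1 q.2))
    refine h1.congr_of_eventuallyEq ?_
    have hc : ContinuousAt (fun s : ℝ => (s, q.2)) q.1 := by fun_prop
    exact (hc.eventually hq).mono fun s hs => (hs hqj).symm

/-- Everything is read off from a local smooth extension. The last assertion, that time derivative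
and tangential derivative commute, is the symmetry of its second derivative. -/
theorem SmoothOnFace.pointwise (hX : S.SmoothOnFace j δ X) {ε : ℝ} (hε : ε ∈ Ioo (-δ) δ)
    {p : E3} (hp : p ∈ S.face j) :
    HasDerivAt (fun s => X s p) (velocity X ε p) ε ∧
    HasDerivAt (fun s => S.tderiv j (X s) p) (S.tderivVelocity j X ε p) ε ∧
    ContinuousWithinAt (X ε) (S.face j) p ∧
    ContinuousWithinAt (velocity X ε) (S.face j) p ∧
    ContinuousWithinAt (S.tderiv j (X ε)) (S.face j) p ∧
    ContinuousWithinAt (S.tderivVelocity j X ε) (S.face j) p ∧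
    S.tderivVelocity j X ε p = S.tderiv j (velocity X ε) p := by
  obtain ⟨h, hh, heq⟩ := hX.exists_extension hε hp
  have hev := eventually_extension hh heq
  have hh1 : ContDiffAt ℝ 1 (fderiv ℝ h) (ε, p) := hh.fderiv_right (WithTop.coe_le_coe.mpr (le_top : (1 + 1 : ℕ∞) ≤ ⊤))
  have hd2 : ∀ᶠ q in 𝓝 (ε, p), HasFDerivAt (fderiv ℝ h) (fderiv ℝ (fderiv ℝ h) q) q :=
    (hh1.eventually (by norm_num)).mono fun q hq =>
      (hq.differentiableAt (by norm_num)).hasFDerivAt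
  have hcE : ContinuousAt (fun x : E3 => (ε, x)) p := by fun_prop
  have htp : ContinuousWithinAt (fun x => tangentProj (S.normal j x)) (S.face j) p :=
    continuousOn_tangentProj p hp
  have hvel : ∀ᶠ x in 𝓝[S.face j] p, velocity X ε x = fderiv ℝ h (ε, x) (1, 0) := by
    rw [eventually_nhdsWithin_iff]
    exact (hcE.eventually hev).mono fun x hx hxj => (hx hxj).2.deriv
  have htd : ∀ᶠ x in 𝓝[S.face j] p, S.tderiv j (X ε) x =
      ((fderiv ℝ h (ε, x)).comp (.inr ℝ ℝ E3)).comp (tangentProj (S.normal j x)) := by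
    rw [eventually_nhdsWithin_iff]
    exact (hcE.eventually hev).mono fun x hx hxj => (hx hxj).1
  have htv : ∀ᶠ q : ℝ × E3 in 𝓝 (ε, p), q.2 ∈ S.face j →
      HasDerivAt (fun s => S.tderiv j (X s) q.2)
      (((fderiv ℝ (fderiv ℝ h) q (1, 0)).comp (.inr ℝ ℝ E3)).comp
        (tangentProj (S.normal j q.2))) q.1 := by
    filter_upwards [hev.eventually_nhds, hd2] with q hq hdq hqj
    have h1 : HasDerivAt (fun s => fderiv ℝ h (s, q.2)) (fderiv ℝ (fderiv ℝ h) q (1, 0)) q.1 :=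
      hdq.comp_hasDerivAt q.1 ((hasDerivAt_id q.1).prodMk (hasDerivAt_const q.1 q.2))
    have h2 := (h1.clm_comp (hasDerivAt_const q.1 (ContinuousLinearMap.inr ℝ ℝ E3))).clm_comp
      (hasDerivAt_const q.1 (tangentProj (S.normal j q.2)))
    simp only [ContinuousLinearMap.comp_zero, add_zero] at h2
    refine h2.congr_of_eventuallyEq ?_
    have hc : ContinuousAt (fun s : ℝ => (s, q.2)) q.1 := by fun_prop
    exact (hc.eventually hq).mono fun s hs => (hs hqj).1
  have htvel : ∀ᶠ x in 𝓝[S.face j] p, S.tderivVelocity j X ε x =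
      ((fderiv ℝ (fderiv ℝ h) (ε, x) (1, 0)).comp (.inr ℝ ℝ E3)).comp
        (tangentProj (S.normal j x)) := by
    rw [eventually_nhdsWithin_iff]
    exact (hcE.eventually htv).mono fun x hx hxj => (hx hxj).deriv
  have hc1 : ContinuousWithinAt (fun x => fderiv ℝ h (ε, x)) (S.face j) p :=
    (ContinuousAt.comp (x := p) (g := fderiv ℝ h) hh1.continuousAt hcE).continuousWithinAt
  have hc2 : ContinuousWithinAt (fun x => fderiv ℝ (fderiv ℝ h) (ε, x)) (S.face j) p :=
    (ContinuousAt.comp (x := p) (g := fderiv ℝ (fderiv ℝ h))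
      (hh1.fderiv_right (m := 0) (by norm_num)).continuousAt hcE).continuousWithinAt
  have hc0 : ContinuousWithinAt (fun x => h (ε, x)) (S.face j) p :=
    (ContinuousAt.comp (x := p) (g := h) hh.continuousAt hcE).continuousWithinAt
  have hX0 : ∀ᶠ x in 𝓝[S.face j] p, X ε x = h (ε, x) := by
    rw [eventually_nhdsWithin_iff]
    exact (hcE.eventually heq).mono fun x hx hxj => (hx hxj).symm
  refine ⟨?_, ?_, ?_, ?_, ?_, ?_, ?_⟩
  · exact (hev.self_of_nhds hp).2.differentiableAt.hasDerivAt
  · exact (htv.self_of_nhds hp).differentiableAt.hasDerivAt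
  · exact hc0.congr_of_eventuallyEq hX0 (hX0.self_of_nhdsWithin hp)
  · exact (hc1.clm_apply continuousWithinAt_const).congr_of_eventuallyEq hvel
      (hvel.self_of_nhdsWithin hp)
  · exact ((hc1.clm_comp continuousWithinAt_const).clm_comp htp).congr_of_eventuallyEq htd
      (htd.self_of_nhdsWithin hp)
  · exact (((hc2.clm_apply continuousWithinAt_const).clm_comp continuousWithinAt_const).clm_comp
      htp).congr_of_eventuallyEq htvel (htvel.self_of_nhdsWithin hp)
  · have h1 : HasFDerivAt (fun x => fderiv ℝ h (ε, x))
        ((fderiv ℝ (fderiv ℝ h) (ε, p)).comp (.inr ℝ ℝ E3)) p :=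
      hd2.self_of_nhds.comp p (hasFDerivAt_prodMk_right ε p)
    have h2 := h1.clm_apply (hasFDerivAt_const ((1, 0) : ℝ × E3) p)
    rw [tderiv_eq hp (h2.hasFDerivWithinAt.congr_of_eventuallyEq hvel
      (hvel.self_of_nhdsWithin hp)), htvel.self_of_nhdsWithin hp]
    congr 1
    ext1 v
    have hsymm := (hh.isSymmSndFDerivAt (by simpa using ENat.LEInfty.out)).eq (1, 0) (0, v)
    simpa using hsymm

end PiecewiseSmoothSurface

end AnisotropicSurface

namespace AnisotropicSurface

namespace PiecewiseSmoothSurface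

variable {S : PiecewiseSmoothSurface} {j : Fin S.N}

/-! ### Bounds up to the boundary of a face -/

theorem _root_.ContDiffWithinAt.exists_hasFDerivWithinAt {E F : Type*} [NormedAddCommGroup E]
    [NormedSpace ℝ E] [NormedAddCommGroup F] [NormedSpace ℝ F] {f : E → F} {s : Set E} {x : E}
    (n : ℕ) (hf : ContDiffWithinAt ℝ (n + 1) f s x) (hx : x ∈ s) :
    ∃ f' : E → E →L[ℝ] F, (∀ᶠ y in 𝓝[s] x, HasFDerivWithinAt f (f' y) s y) ∧
      ContDiffWithinAt ℝ n f' s x := by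
  obtain ⟨u, hu, -, -, f', hf', hc⟩ :=
    (contDiffWithinAt_succ_iff_hasFDerivWithinAt' (by simp)).mp hf
  rw [insert_eq_of_mem hx] at hu
  exact ⟨f', Filter.mem_of_superset hu hf', hc⟩

variable {δ : ℝ} {X : ℝ → E3 → E3}

theorem eventually_slab {q : ℝ × E3} (hq : q ∈ Ioo (-δ) δ ×ˢ closure (S.face j))
    {P : ℝ × E3 → Prop} (h : ∀ᶠ q' in 𝓝[Ioo (-δ) δ ×ˢ closure (S.face j)] q, P q') :
    ∀ᶠ s in 𝓝 q.1, P (s, q.2) := by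
  have hc : ContinuousAt (fun s : ℝ => (s, q.2)) q.1 := by fun_prop
  filter_upwards [hc.eventually (eventually_nhdsWithin_iff.mp h), isOpen_Ioo.mem_nhds hq.1]
    with s hs hsI
  exact hs ⟨hsI, hq.2⟩

/-- The slab is open in the direction of the parameter, so a derivative within it restricts to an
unrestricted derivative in `ε`. -/
theorem hasDerivAt_slab {F : Type*} [NormedAddCommGroup F] [NormedSpace ℝ F] {f : ℝ × E3 → F}
    {D : ℝ × E3 →L[ℝ] F} {q : ℝ × E3} (hq : q ∈ Ioo (-δ) δ ×ˢ closure (S.face j))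
    (h : HasFDerivWithinAt f D (Ioo (-δ) δ ×ˢ closure (S.face j)) q) :
    HasDerivAt (fun s => f (s, q.2)) (D (1, 0)) q.1 :=
  h.comp_hasDerivAt q.1 ((hasDerivAt_id q.1).prodMk (hasDerivAt_const q.1 q.2))
    (eventually_slab hq self_mem_nhdsWithin)

theorem tderiv_slab {q : ℝ × E3} (hq : q.1 ∈ Ioo (-δ) δ) (hqj : q.2 ∈ S.face j)
    {D : ℝ × E3 →L[ℝ] E3} (h : HasFDerivWithinAt (fun q : ℝ × E3 => X q.1 q.2) D
      (Ioo (-δ) δ ×ˢ closure (S.face j)) q) :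
    S.tderiv j (X q.1) q.2 = (D.comp (.inr ℝ ℝ E3)).comp (tangentProj (S.normal j q.2)) := by
  have h1 : HasFDerivWithinAt (fun x : E3 => (q.1, x)) (.inr ℝ ℝ E3) (S.face j) q.2 :=
    (hasFDerivAt_prodMk_right q.1 q.2).hasFDerivWithinAt
  have hm : MapsTo (fun x : E3 => (q.1, x)) (S.face j) (Ioo (-δ) δ ×ˢ closure (S.face j)) :=
    fun x hx => ⟨hq, subset_closure hx⟩
  exact tderiv_eq (f := X q.1) hqj (HasFDerivWithinAt.comp (g := fun q : ℝ × E3 => X q.1 q.2) q.2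
    h h1 hm)

theorem ContinuousWithinAt.exists_bound {E F : Type*} [TopologicalSpace E] [NormedAddCommGroup F]
    {f : E → F} {s : Set E} {x : E} (h : ContinuousWithinAt f s x) :
    ∃ C, 0 ≤ C ∧ ∀ᶠ y in 𝓝[s] x, ‖f y‖ ≤ C :=
  ⟨‖f x‖ + 1, by positivity, (h.norm.eventually (gt_mem_nhds (lt_add_one _))).mono
    fun _ hy => le_of_lt hy⟩

theorem norm_comp_inr_tangentProj_le (D : ℝ × E3 →L[ℝ] E3) {n : E3} (hn : ‖n‖ = 1) :
    ‖(D.comp (.inr ℝ ℝ E3)).comp (tangentProj n)‖ ≤ ‖D‖ * 2 := by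
  refine (ContinuousLinearMap.opNorm_comp_le _ _).trans (mul_le_mul ?_ (norm_tangentProj_le hn)
    (norm_nonneg _) (norm_nonneg _))
  refine (ContinuousLinearMap.opNorm_comp_le _ _).trans ?_
  exact mul_le_of_le_one_right (norm_nonneg _) (ContinuousLinearMap.norm_inr_le_one ℝ ℝ E3)

/-- At boundary points the retraction is not available. Instead, local first and second derivatives
`X1` and `X2` within the slab are used: they are continuous at the boundary point, hence bounded
near it, and they determine the velocities and tangential derivatives on the face. -/
theorem SmoothOnFace.boundary (hX : S.SmoothOnFace j δ X) (hδ : 0 < δ) {p : E3}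
    (hp : p ∈ closure (S.face j)) : ContDiffWithinAt ℝ 1 (velocity X 0) (closure (S.face j)) p ∧
    ∃ C, ∀ᶠ q : ℝ × E3 in 𝓝[Ioo (-δ) δ ×ˢ closure (S.face j)] (0, p), q.2 ∈ S.face j →
      ‖X q.1 q.2‖ + ‖velocity X q.1 q.2‖ + ‖S.tderiv j (X q.1) q.2‖ +
        ‖S.tderivVelocity j X q.1 q.2‖ ≤ C := by
  set D := Ioo (-δ) δ ×ˢ closure (S.face j) with hD
  have h0 : (0 : ℝ) ∈ Ioo (-δ) δ := ⟨by linarith, hδ⟩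
  have hq₀ : ((0 : ℝ), p) ∈ D := ⟨h0, hp⟩
  obtain ⟨X1, hX1, hX1c⟩ := ContDiffWithinAt.exists_hasFDerivWithinAt 2
    ((hX _ hq₀).of_le (WithTop.coe_le_coe.mpr (le_top : (2 + 1 : ℕ∞) ≤ ⊤))) hq₀
  obtain ⟨X2, hX2, hX2c⟩ := ContDiffWithinAt.exists_hasFDerivWithinAt 1
    (hX1c.of_le (by norm_num)) hq₀
  have hvel : ∀ᶠ q in 𝓝[D] ((0 : ℝ), p), velocity X q.1 q.2 = X1 q (1, 0) := by
    filter_upwards [hX1, self_mem_nhdsWithin] with q hq hqD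
    exact (hasDerivAt_slab hqD hq).deriv
  constructor
  · have hmaps : MapsTo (fun x : E3 => ((0 : ℝ), x)) (closure (S.face j)) D := fun x hx => ⟨h0, hx⟩
    have hg : ContDiffWithinAt ℝ 1 (fun x : E3 => ((0 : ℝ), x)) (closure (S.face j)) p :=
      (contDiff_const.prodMk contDiff_id).contDiffWithinAt
    have h1 : ContDiffWithinAt ℝ 1 (fun x => X1 (0, x)) (closure (S.face j)) p :=
      ContDiffWithinAt.comp p (hX1c.of_le (by norm_num)) hg hmaps
    have hev : ∀ᶠ x in 𝓝[closure (S.face j)] p, velocity X 0 x = X1 (0, x) (1, 0) :=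
      (hg.continuousWithinAt.tendsto_nhdsWithin hmaps).eventually hvel
    exact (h1.clm_apply contDiffWithinAt_const).congr_of_eventuallyEq hev
      (hev.self_of_nhdsWithin hp)
  · obtain ⟨C0, hC0, hb0⟩ := ContinuousWithinAt.exists_bound (hX _ hq₀).continuousWithinAt
    obtain ⟨C1, hC1, hb1⟩ := ContinuousWithinAt.exists_bound hX1c.continuousWithinAt
    obtain ⟨C2, hC2, hb2⟩ := ContinuousWithinAt.exists_bound hX2c.continuousWithinAt
    refine ⟨C0 + C1 + C1 * 2 + C2 * 2, ?_⟩
    filter_upwards [hb0, hb1, hb2, hX1, hX2, hvel, eventually_eventually_nhdsWithin.mpr hX1,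
      self_mem_nhdsWithin] with q e0 e1 e2 d1 d2 hv hev hqD hqj
    have hn := norm_normal_face hqj
    have h10 : ‖((1 : ℝ), (0 : E3))‖ ≤ 1 := by simp [Prod.norm_def]
    have t1 : ‖velocity X q.1 q.2‖ ≤ C1 := by
      rw [hv]
      exact ((X1 q).le_of_opNorm_le_of_le e1 h10).trans (by rw [mul_one])
    have t2 : ‖S.tderiv j (X q.1) q.2‖ ≤ C1 * 2 := by
      rw [tderiv_slab hqD.1 hqj d1]
      exact (norm_comp_inr_tangentProj_le _ hn).trans (by gcongr)
    have t3 : ‖S.tderivVelocity j X q.1 q.2‖ ≤ C2 * 2 := by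
      have hd : HasDerivAt (fun s => S.tderiv j (X s) q.2)
          (((X2 q (1, 0)).comp (.inr ℝ ℝ E3)).comp (tangentProj (S.normal j q.2))) q.1 := by
        have h2 := ((hasDerivAt_slab hqD d2).clm_comp
          (hasDerivAt_const q.1 (ContinuousLinearMap.inr ℝ ℝ E3))).clm_comp
          (hasDerivAt_const q.1 (tangentProj (S.normal j q.2)))
        simp only [ContinuousLinearMap.comp_zero, add_zero] at h2
        refine h2.congr_of_eventuallyEq ?_
        filter_upwards [eventually_slab hqD hev, isOpen_Ioo.mem_nhds hqD.1] with s hs hsI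
        exact tderiv_slab (q := (s, q.2)) hsI hqj hs
      rw [tderivVelocity, hd.deriv]
      refine (norm_comp_inr_tangentProj_le _ hn).trans ?_
      have := (X2 q).le_of_opNorm_le_of_le e2 h10
      rw [mul_one] at this
      gcongr
    exact add_le_add (add_le_add (add_le_add e0 t1) t2) t3

theorem SmoothOnFace.isFaceField_velocity (hX : S.SmoothOnFace j δ X) (hδ : 0 < δ) :
    S.IsFaceField j (velocity X 0) :=
  isFaceField_of_contDiffOn fun _ hp => (hX.boundary hδ hp).1

/-- Compactness of the closed face yields one time interval and one bound for all its points, which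
is the domination needed to differentiate under the integral. -/
theorem SmoothOnFace.exists_bound (hX : S.SmoothOnFace j δ X) (hδ : 0 < δ) :
    ∃ C, ∃ δ' ∈ Ioc 0 δ, ∀ ε ∈ Ioo (-δ') δ', ∀ p ∈ S.face j,
      ‖X ε p‖ + ‖velocity X ε p‖ + ‖S.tderiv j (X ε) p‖ + ‖S.tderivVelocity j X ε p‖ ≤ C := by
  have key := (S.isCompact_closure_face j).induction_on
    (p := fun t => ∃ C, ∃ δ' ∈ Ioc 0 δ, ∀ ε ∈ Ioo (-δ') δ', ∀ p ∈ t, p ∈ S.face j →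
      ‖X ε p‖ + ‖velocity X ε p‖ + ‖S.tderiv j (X ε) p‖ + ‖S.tderivVelocity j X ε p‖ ≤ C)
    ⟨0, δ, ⟨hδ, le_rfl⟩, by simp⟩
    (fun s t hst ⟨C, δ', hδ', h⟩ => ⟨C, δ', hδ', fun ε hε p hp => h ε hε p (hst hp)⟩)
    (fun s t ⟨C, δ', hδ', h⟩ ⟨C₁, δ₁, hδ₁, h₁⟩ => ⟨max C C₁, min δ' δ₁,
      ⟨lt_min hδ'.1 hδ₁.1, (min_le_left _ _).trans hδ'.2⟩, fun ε hε p hp hpj => by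
        rcases hp with hp | hp
        · exact (h ε ⟨(neg_le_neg (min_le_left _ _)).trans_lt hε.1,
            hε.2.trans_le (min_le_left _ _)⟩ p hp hpj).trans (le_max_left _ _)
        · exact (h₁ ε ⟨(neg_le_neg (min_le_right _ _)).trans_lt hε.1,
            hε.2.trans_le (min_le_right _ _)⟩ p hp hpj).trans (le_max_right _ _)⟩)
    (fun p hp => by
      obtain ⟨C, hC⟩ := (hX.boundary hδ hp).2
      rw [eventually_nhdsWithin_iff, nhds_prod_eq, Filter.eventually_prod_iff] at hC
      obtain ⟨pa, ha, pb, hb, hab⟩ := hC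
      obtain ⟨r, hr, hpa⟩ := Metric.eventually_nhds_iff_ball.mp ha
      refine ⟨{x | pb x}, mem_nhdsWithin_of_mem_nhds hb, C, min r δ,
        ⟨lt_min hr hδ, min_le_right _ _⟩, fun ε hε x hx hxj => ?_⟩
      have h1 : pa ε := hpa ε (by
        rw [Real.ball_eq_Ioo, zero_sub, zero_add]
        exact ⟨(neg_le_neg (min_le_left _ _)).trans_lt hε.1, hε.2.trans_le (min_le_left _ _)⟩)
      have h2 : ε ∈ Ioo (-δ) δ :=
        ⟨(neg_le_neg (min_le_right _ _)).trans_lt hε.1, hε.2.trans_le (min_le_right _ _)⟩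
      exact hab h1 hx ⟨h2, subset_closure hxj⟩ hxj)
  obtain ⟨C, δ', hδ', h⟩ := key
  exact ⟨C, δ', hδ', fun ε hε p hp => h ε hε p (subset_closure hp) hp⟩

end PiecewiseSmoothSurface

end AnisotropicSurface

namespace AnisotropicSurface

namespace PiecewiseSmoothSurface

variable {S : PiecewiseSmoothSurface} {j : Fin S.N}

/-! ### The first variation -/

theorem hasDerivAt_integral_face {δ : ℝ} (hδ : 0 < δ) {F F' : ℝ → E3 → ℝ} {C C₀ : ℝ}
    (hF : ∀ ε ∈ Ioo (-δ) δ, ContinuousOn (F ε) (S.face j)) (hF' : ContinuousOn (F' 0) (S.face j))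
    (hd : ∀ ε ∈ Ioo (-δ) δ, ∀ p ∈ S.face j, HasDerivAt (fun s => F s p) (F' ε p) ε)
    (hC : ∀ ε ∈ Ioo (-δ) δ, ∀ p ∈ S.face j, |F' ε p| ≤ C) (hC₀ : ∀ p ∈ S.face j, |F 0 p| ≤ C₀) :
    HasDerivAt (fun ε => ∫ p in S.face j, F ε p ∂μHE[2]) (∫ p in S.face j, F' 0 p ∂μHE[2]) 0 := by
  have h0 : (0 : ℝ) ∈ Ioo (-δ) δ := ⟨by linarith, hδ⟩
  have hm := S.measurableSet_face j
  have : IsFiniteMeasure ((μHE[2] : Measure E3).restrict (S.face j)) :=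
    ⟨by rw [Measure.restrict_apply_univ]; exact S.measure_face_lt_top j⟩
  refine (hasDerivAt_integral_of_dominated_loc_of_deriv_le (bound := fun _ => C)
    (isOpen_Ioo.mem_nhds h0) ?_ (integrableOn_face (hF 0 h0) hC₀)
    (hF'.aestronglyMeasurable hm) ?_ (integrable_const C) ?_).2
  · filter_upwards [isOpen_Ioo.mem_nhds h0] with ε hε
    exact (hF ε hε).aestronglyMeasurable hm
  · exact (ae_restrict_iff' hm).mpr (.of_forall fun p hp ε hε => hC ε hε p hp)
  · exact (ae_restrict_iff' hm).mpr (.of_forall fun p hp ε hε => hd ε hε p hp)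

theorem areaVector_eq {X : E3 → E3} {p : E3} (hp : p ∈ S.face j) :
    S.areaVector X j p = areaMap (S.tderiv j X p) (S.normal j p) :=
  areaMap_congr (norm_normal_face hp) fun _ hv => (tderiv_apply hv).symm

/-- The velocity of the area vector of a family of maps. -/
def areaVelocity (S : PiecewiseSmoothSurface) (j : Fin S.N) (X : ℝ → E3 → E3) (ε : ℝ) (p : E3) :
    E3 :=
  areaPolar (S.tderiv j (X ε) p) (S.tderivVelocity j X ε p) (S.normal j p)

variable {δ : ℝ} {X : ℝ → E3 → E3}

theorem SmoothOnFace.hasDerivAt_areaVector (hX : S.SmoothOnFace j δ X) {ε : ℝ}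
    (hε : ε ∈ Ioo (-δ) δ) {p : E3} (hp : p ∈ S.face j) :
    HasDerivAt (fun s => S.areaVector (X s) j p) (S.areaVelocity j X ε p) ε := by
  have h := hasDerivAt_areaMap (hX.pointwise hε hp).2.1 (S.normal j p)
  exact h.congr_of_eventuallyEq (.of_forall fun s => areaVector_eq hp)

theorem SmoothOnFace.continuousOn_areaVector (hX : S.SmoothOnFace j δ X) {ε : ℝ}
    (hε : ε ∈ Ioo (-δ) δ) : ContinuousOn (S.areaVector (X ε) j) (S.face j) := by
  have h : ContinuousOn (fun p => (S.tderiv j (X ε) p, S.normal j p)) (S.face j) :=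
    ContinuousOn.prodMk (fun p hp => (hX.pointwise hε hp).2.2.2.2.1)
      ((S.normal_continuousOn j).mono subset_closure)
  exact (continuous_areaMap.comp_continuousOn h).congr fun p hp => areaVector_eq hp

theorem SmoothOnFace.continuousOn_areaVelocity (hX : S.SmoothOnFace j δ X) {ε : ℝ}
    (hε : ε ∈ Ioo (-δ) δ) : ContinuousOn (S.areaVelocity j X ε) (S.face j) := by
  have h1 : ContinuousOn (S.tderiv j (X ε)) (S.face j) := fun p hp =>
    (hX.pointwise hε hp).2.2.2.2.1
  have h2 : ContinuousOn (S.tderivVelocity j X ε) (S.face j) := fun p hp =>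
    (hX.pointwise hε hp).2.2.2.2.2.1
  have h3 : ContinuousOn (S.normal j) (S.face j) := (S.normal_continuousOn j).mono subset_closure
  intro p hp
  exact ContinuousAt.comp_continuousWithinAt
    (g := fun q : (E3 →L[ℝ] E3) × (E3 →L[ℝ] E3) × E3 => areaPolar q.1 q.2.1 q.2.2)
    (f := fun p => (S.tderiv j (X ε) p, S.tderivVelocity j X ε p, S.normal j p))
    continuous_areaPolar.continuousAt ((h1 p hp).prodMk ((h2 p hp).prodMk (h3 p hp)))

theorem SmoothOnFace.exists_bound_areaVelocity (hX : S.SmoothOnFace j δ X) (hδ : 0 < δ) :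
    ∃ C, 0 ≤ C ∧ ∃ δ' ∈ Ioc 0 δ, ∀ ε ∈ Ioo (-δ') δ', ∀ p ∈ S.face j,
      ‖X ε p‖ ≤ C ∧ ‖velocity X ε p‖ ≤ C ∧ ‖S.areaVector (X ε) j p‖ ≤ C ∧
      ‖S.areaVelocity j X ε p‖ ≤ C := by
  obtain ⟨C, δ', hδ', h⟩ := hX.exists_bound hδ
  obtain ⟨C₁, h₁⟩ := exists_bound_of_continuous continuous_areaMap (max C 1)
  obtain ⟨C₂, h₂⟩ := exists_bound_of_continuous continuous_areaPolar (max C 1)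
  refine ⟨|C| + |C₁| + |C₂|, by positivity, δ', hδ', fun ε hε p hp => ?_⟩
  have hb := h ε hε p hp
  have hn := norm_normal_face hp
  have e1 := norm_nonneg (X ε p)
  have e2 := norm_nonneg (velocity X ε p)
  have e3 := norm_nonneg (S.tderiv j (X ε) p)
  have e4 := norm_nonneg (S.tderivVelocity j X ε p)
  have f0 := le_abs_self C
  have f1 := le_abs_self C₁
  have f2 := le_abs_self C₂
  have g0 := abs_nonneg C
  have g1 := abs_nonneg C₁
  have g2 := abs_nonneg C₂
  have a1 := h₁ (S.tderiv j (X ε) p, S.normal j p) (by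
    rw [Prod.norm_def, hn]
    exact max_le_max (by linarith) le_rfl)
  have a2 := h₂ (S.tderiv j (X ε) p, S.tderivVelocity j X ε p, S.normal j p) (by
    rw [Prod.norm_def, Prod.norm_def, hn]
    exact max_le ((by linarith : _ ≤ C).trans (le_max_left _ _))
      (max_le_max (by linarith) le_rfl))
  rw [areaVector_eq hp]
  exact ⟨by linarith, by linarith, by linarith [a1], by
    change ‖areaPolar _ _ _‖ ≤ _
    linarith [a2]⟩

theorem tderiv_eq_tangentProj {Y : E3 → E3} (h : ∀ x ∈ S.face j, Y x = x) {p : E3}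
    (hp : p ∈ S.face j) : S.tderiv j Y p = tangentProj (S.normal j p) := by
  rw [← tderiv_id hp, tderiv, tderiv, fderivWithin_congr h (h p hp)]

theorem areaVector_eq_normal {Y : E3 → E3} (h : ∀ x ∈ S.face j, Y x = x) {p : E3}
    (hp : p ∈ S.face j) : S.areaVector Y j p = S.normal j p := by
  rw [areaVector_eq hp, tderiv_eq_tangentProj h hp]
  exact (areaMap_congr (norm_normal_face hp) fun v hv => tangentProj_eq_self hv).trans
    (areaMap_one _)

theorem SmoothOnFace.areaVelocity_zero (hX : S.SmoothOnFace j δ X) (hδ : 0 < δ)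
    (h0 : ∀ x ∈ S.face j, X 0 x = x) {p : E3} (hp : p ∈ S.face j) :
    S.areaVelocity j X 0 p = areaPolar (ContinuousLinearMap.id ℝ E3)
      (fderivWithin ℝ (velocity X 0) (S.face j) p) (S.normal j p) := by
  have h := (hX.pointwise (ε := 0) ⟨by linarith, hδ⟩ hp).2.2.2.2.2.2
  rw [areaVelocity, h, tderiv_eq_tangentProj h0 hp]
  exact areaPolar_congr (norm_normal_face hp) (fun v hv => tangentProj_eq_self hv)
    fun v hv => tderiv_apply hv

theorem IsVariation.smoothOnFace (hX : S.IsVariation δ X) (j : Fin S.N) : S.SmoothOnFace j δ X :=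
  hX.smooth j

theorem IsVariation.initial_face (hX : S.IsVariation δ X) {x : E3} (hx : x ∈ S.face j) :
    X 0 x = x := hX.initial x (S.face_subset j hx)

theorem Ioo_subset_of_mem_Ioc {δ' : ℝ} (h : δ' ∈ Ioc 0 δ) : Ioo (-δ') δ' ⊆ Ioo (-δ) δ :=
  Ioo_subset_Ioo (neg_le_neg h.2) h.2

/-- The derivative of the volume. -/
theorem IsVariation.hasDerivAt_volume (hX : S.IsVariation δ X) :
    HasDerivAt (fun ε => S.volume (X ε)) (S.flux (velocity X 0)) 0 := by
  have hδ := hX.pos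
  have h0 : (0 : ℝ) ∈ Ioo (-δ) δ := ⟨by linarith, hδ⟩
  have hW : ∀ j, S.IsFaceField j (velocity X 0) := fun j =>
    (hX.smoothOnFace j).isFaceField_velocity hδ
  have key : ∀ j, HasDerivAt (fun ε => ∫ p in S.face j, ⟪X ε p, S.areaVector (X ε) j p⟫ ∂μHE[2])
      (∫ p in S.face j, ⟪velocity X 0 p, S.normal j p⟫ ∂μHE[2] +
        S.areaVariation j (fun x => x) (velocity X 0)) 0 := by
    intro j
    have hXj := hX.smoothOnFace j
    obtain ⟨C, hC0, δ', hδ', hC⟩ := hXj.exists_bound_areaVelocity hδ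
    have hsub := Ioo_subset_of_mem_Ioc hδ'
    have h0' : (0 : ℝ) ∈ Ioo (-δ') δ' := ⟨by linarith [hδ'.1], hδ'.1⟩
    have hcA : ContinuousOn (fun p => ⟪velocity X 0 p, S.areaVector (X 0) j p⟫) (S.face j) :=
      ContinuousOn.inner (fun p hp => (hXj.pointwise h0 hp).2.2.2.1) (hXj.continuousOn_areaVector h0)
    have hcB : ContinuousOn (fun p => ⟪X 0 p, S.areaVelocity j X 0 p⟫) (S.face j) :=
      ContinuousOn.inner (fun p hp => (hXj.pointwise h0 hp).2.2.1) (hXj.continuousOn_areaVelocity h0)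
    have hinner : ∀ {u v : E3}, ‖u‖ ≤ C → ‖v‖ ≤ C → |⟪u, v⟫| ≤ C * C := fun hu hv =>
      (abs_real_inner_le_norm _ _).trans (mul_le_mul hu hv (norm_nonneg _) hC0)
    have h := hasDerivAt_integral_face (j := j) hδ'.1 (C := C * C + C * C) (C₀ := C * C)
      (F := fun ε p => ⟪X ε p, S.areaVector (X ε) j p⟫)
      (F' := fun ε p => ⟪X ε p, S.areaVelocity j X ε p⟫ + ⟪velocity X ε p, S.areaVector (X ε) j p⟫)
      (fun ε hε => ContinuousOn.inner (fun p hp => (hXj.pointwise (hsub hε) hp).2.2.1)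
        (hXj.continuousOn_areaVector (hsub hε))) (hcB.add hcA)
      (fun ε hε p hp => (hXj.pointwise (hsub hε) hp).1.inner ℝ
        (hXj.hasDerivAt_areaVector (hsub hε) hp))
      (fun ε hε p hp => by
        obtain ⟨b1, b2, b3, b4⟩ := hC ε hε p hp
        exact (abs_add_le _ _).trans (add_le_add (hinner b1 b4) (hinner b2 b3)))
      (fun p hp => by
        obtain ⟨b1, b2, b3, b4⟩ := hC 0 h0' p hp
        exact hinner b1 b3)
    convert h using 1
    have hiA := integrableOn_face hcA (C := C * C) fun p hp => hinner (hC 0 h0' p hp).2.1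
      (hC 0 h0' p hp).2.2.1
    have hiB := integrableOn_face hcB (C := C * C) fun p hp => hinner (hC 0 h0' p hp).1
      (hC 0 h0' p hp).2.2.2
    rw [integral_add hiB hiA, add_comm]
    congr 1
    · refine setIntegral_congr_fun (S.measurableSet_face j) fun p hp => ?_
      simp only
      rw [hXj.areaVelocity_zero hδ (fun x hx => hX.initial_face hx) hp, hX.initial_face hp]
    · refine setIntegral_congr_fun (S.measurableSet_face j) fun p hp => ?_
      rw [areaVector_eq_normal (fun x hx => hX.initial_face hx) hp]
  -- Varying the position gives the flux once, varying the area vector gives it twice; the factor `1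
  -- / 3` normalizes the total.
  have hsum := (HasDerivAt.fun_sum fun j (_ : j ∈ Finset.univ) => key j).const_mul (1 / 3 : ℝ)
  rw [Finset.sum_add_distrib, sum_areaVariation_id hW, ← flux] at hsum
  rwa [show (1 / 3 : ℝ) * (S.flux (velocity X 0) + 2 * S.flux (velocity X 0)) =
    S.flux (velocity X 0) by ring] at hsum

variable {γ : S2 → ℝ} (hγ' : ContMDiff (𝓡 2) 𝓘(ℝ, ℝ) 3 γ)
include hγ'

/-- The derivative of the energy. -/
theorem IsVariation.hasDerivAt_energy (hX : S.IsVariation δ X) :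
    HasDerivAt (fun ε => S.energy γ (X ε))
      (∑ j, S.areaVariation j (S.cahnHoffman γ j) (velocity X 0)) 0 := by
  have hδ := hX.pos
  have h0 : (0 : ℝ) ∈ Ioo (-δ) δ := ⟨by linarith, hδ⟩
  refine HasDerivAt.fun_sum fun j _ => ?_
  have hXj := hX.smoothOnFace j
  obtain ⟨C, hC0, δ', hδ', hC⟩ := hXj.exists_bound_areaVelocity hδ
  obtain ⟨G, hG⟩ := norm_gradient_homExt_le hγ'
  have hsub := Ioo_subset_of_mem_Ioc hδ'
  have h0' : (0 : ℝ) ∈ Ioo (-δ') δ' := ⟨by linarith [hδ'.1], hδ'.1⟩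
  have hinit : ∀ x ∈ S.face j, X 0 x = x := fun x hx => hX.initial_face hx
  obtain ⟨C₀, hC₀⟩ := (isCompact_sphere (0 : E3) 1).exists_bound_of_continuousOn
    (f := homExt γ) fun x hx => (contDiffAt_homExt hγ'
      (Metric.ne_of_mem_sphere hx one_ne_zero)).continuousAt.continuousWithinAt
  -- The immersion condition keeps area vectors away from the origin, the only point where the
  -- extension of `γ` may fail to be differentiable.
  have hne : ∀ ε ∈ Ioo (-δ') δ', ∀ p ∈ S.face j, S.areaVector (X ε) j p ≠ 0 := fun ε hε p hp =>
    hX.immersion ε (hsub hε) j p hp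
  have hgrad : ContinuousOn (fun p => gradient (homExt γ) (S.areaVector (X 0) j p)) (S.face j) :=
    fun p hp => ContinuousAt.comp_continuousWithinAt (g := gradient (homExt γ))
      (contDiffAt_gradient_homExt hγ' (hne 0 h0' p hp)).continuousAt
      (hXj.continuousOn_areaVector h0 p hp)
  have h := hasDerivAt_integral_face (j := j) hδ'.1 (C := |G| * C) (C₀ := C₀)
    (F := fun ε p => homExt γ (S.areaVector (X ε) j p))
    (F' := fun ε p => ⟪gradient (homExt γ) (S.areaVector (X ε) j p), S.areaVelocity j X ε p⟫)
    (fun ε hε p hp => ContinuousAt.comp_continuousWithinAt (g := homExt γ)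
      (contDiffAt_homExt hγ' (hne ε hε p hp)).continuousAt
      (hXj.continuousOn_areaVector (hsub hε) p hp))
    (hgrad.inner (hXj.continuousOn_areaVelocity h0))
    (fun ε hε p hp => by
      rw [inner_gradient_homExt]
      exact ((contDiffAt_homExt hγ' (hne ε hε p hp)).differentiableAt
        (by norm_num)).hasFDerivAt.comp_hasDerivAt ε (hXj.hasDerivAt_areaVector (hsub hε) hp))
    (fun ε hε p hp => (abs_real_inner_le_norm _ _).trans (mul_le_mul
      ((hG _ (hne ε hε p hp)).trans (le_abs_self G)) (hC ε hε p hp).2.2.2 (norm_nonneg _)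
      (abs_nonneg G)))
    (fun p hp => by
      rw [areaVector_eq_normal hinit hp]
      exact hC₀ _ (by simpa using norm_normal_face hp))
  have heq : S.areaVariation j (S.cahnHoffman γ j) (velocity X 0) = ∫ p in S.face j,
      ⟪gradient (homExt γ) (S.areaVector (X 0) j p), S.areaVelocity j X 0 p⟫ ∂μHE[2] := by
    refine setIntegral_congr_fun (S.measurableSet_face j) fun p hp => ?_
    rw [areaVector_eq_normal hinit hp, hXj.areaVelocity_zero hδ hinit hp, cahnHoffman]
  rw [heq]
  exact h

/-- The first variation formula. -/
theorem IsVariation.hasDerivAt_energy' (hX : S.IsVariation δ X) :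
    HasDerivAt (fun ε => S.energy γ (X ε))
      (-∑ j, ∫ p in S.face j, S.anisotropicMeanCurvature γ j p *
        ⟪velocity X 0 p, S.normal j p⟫ ∂μHE[2] -
      ∑ i, S.edgeWork i (S.cahnHoffman γ) (velocity X 0)) 0 := by
  rw [← sum_areaVariation_cahnHoffman hγ' fun j => (hX.smoothOnFace j).isFaceField_velocity hX.pos]
  exact hX.hasDerivAt_energy hγ'

/-- Constant curvature turns the face terms of the first variation into `-c` times the flux of the
velocity. That flux is the derivative of the volume, which is constant. -/
theorem isEquilibrium_of_forceBalance {c : ℝ}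
    (hc : ∀ j, ∀ p ∈ S.face j, S.anisotropicMeanCurvature γ j p = c) (hF : S.ForceBalance γ) :
    S.IsEquilibrium γ := by
  intro δ X hX hvol
  have hflux : S.flux (velocity X 0) = 0 := by
    refine hX.hasDerivAt_volume.unique ((hasDerivAt_const (0 : ℝ)
      (S.volume (X 0))).congr_of_eventuallyEq ?_)
    filter_upwards [isOpen_Ioo.mem_nhds (show (0 : ℝ) ∈ Ioo (-δ) δ from
      ⟨by linarith [hX.pos], hX.pos⟩)] with ε hε
    exact hvol ε hε
  have h := hX.hasDerivAt_energy' hγ'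
  have h1 : ∀ j, ∫ p in S.face j, S.anisotropicMeanCurvature γ j p *
      ⟪velocity X 0 p, S.normal j p⟫ ∂μHE[2] =
      c * ∫ p in S.face j, ⟪velocity X 0 p, S.normal j p⟫ ∂μHE[2] := by
    intro j
    rw [← integral_const_mul]
    exact setIntegral_congr_fun (S.measurableSet_face j) fun p hp => by simp only [hc j p hp]
  have h2 : ∀ i, S.edgeWork i (S.cahnHoffman γ) (velocity X 0) = 0 := by
    intro i
    refine setIntegral_eq_zero_of_forall_eq_zero fun t ht => ?_
    rw [edgeTangent, hF i t (Ioo_subset_Icc_self ht), inner_zero_right]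
  rw [Finset.sum_congr rfl fun j _ => h1 j, ← Finset.mul_sum, ← flux, hflux,
    Finset.sum_eq_zero fun i _ => h2 i] at h
  simpa using h

end PiecewiseSmoothSurface

end AnisotropicSurface

namespace AnisotropicSurface

/-! ### Two parameter deformations -/

/-- The bilinear form of the quadratic map `areaMap`. -/
def areaForm (D D' : E3 →L[ℝ] E3) (n : E3) : E3 :=
  n 0 • cross (D (EuclideanSpace.single 1 1)) (D' (EuclideanSpace.single 2 1)) +
  n 1 • cross (D (EuclideanSpace.single 2 1)) (D' (EuclideanSpace.single 0 1)) +
  n 2 • cross (D (EuclideanSpace.single 0 1)) (D' (EuclideanSpace.single 1 1))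

/-- Expansion of a quadratic map. It makes the volume of a deformation a polynomial of degree at
most three in the parameters. -/
theorem areaMap_sum {ι : Type*} (s : Finset ι) (u : ι → ℝ) (D : ι → E3 →L[ℝ] E3) (n : E3) :
    areaMap (∑ k ∈ s, u k • D k) n = ∑ k ∈ s, ∑ l ∈ s, (u k * u l) • areaForm (D k) (D l) n := by
  have hc : ∀ v w : E3, cross ((∑ k ∈ s, u k • D k) v) ((∑ k ∈ s, u k • D k) w) =
      ∑ k ∈ s, ∑ l ∈ s, (u k * u l) • cross (D k v) (D l w) := by
    intro v w
    simp only [sum_apply, smul_apply, ← crossL_apply, map_sum, map_smul, Finset.smul_sum, smul_smul]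
    rw [Finset.sum_comm]
    exact Finset.sum_congr rfl fun k _ => Finset.sum_congr rfl fun l _ => by rw [mul_comm]
  simp only [areaMap, areaForm, hc, smul_add, Finset.sum_add_distrib, Finset.smul_sum,
    smul_comm (n _)]

theorem continuous_areaForm : Continuous fun q : (E3 →L[ℝ] E3) × (E3 →L[ℝ] E3) × E3 =>
    areaForm q.1 q.2.1 q.2.2 := by
  have hc : ∀ v w : E3, Continuous fun q : (E3 →L[ℝ] E3) × (E3 →L[ℝ] E3) × E3 =>
      cross (q.1 v) (q.2.1 w) := fun v w =>
    (crossL.continuous₂.comp (by fun_prop : Continuous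
      fun q : (E3 →L[ℝ] E3) × (E3 →L[ℝ] E3) × E3 => (q.1 v, q.2.1 w)) :)
  have hn : ∀ i, Continuous fun q : (E3 →L[ℝ] E3) × (E3 →L[ℝ] E3) × E3 => q.2.2 i :=
    fun i => by fun_prop
  exact (((hn 0).smul (hc _ _)).add ((hn 1).smul (hc _ _))).add ((hn 2).smul (hc _ _))

namespace PiecewiseSmoothSurface

variable {S : PiecewiseSmoothSurface} {j : Fin S.N}

/-- The deformation in the direction of two vector fields. -/
def deformation (W W' : E3 → E3) (q : ℝ × ℝ) (p : E3) : E3 := p + q.1 • W p + q.2 • W' p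

variable {W W' : E3 → E3}

theorem areaVector_deformation (hW : ContDiff ℝ ∞ W) (hW' : ContDiff ℝ ∞ W') (q : ℝ × ℝ) {p : E3}
    (hp : p ∈ S.face j) : S.areaVector (deformation W W' q) j p =
      areaMap (ContinuousLinearMap.id ℝ E3 + q.1 • fderiv ℝ W p + q.2 • fderiv ℝ W' p)
        (S.normal j p) := by
  have h : ∀ {V : E3 → E3}, ContDiff ℝ ∞ V → HasFDerivAt V (fderiv ℝ V p) p := fun hV =>
    (hV.differentiable (by simp) p).hasFDerivAt
  have h1 : HasFDerivAt (deformation W W' q) _ p :=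
    ((hasFDerivAt_id p).add ((h hW).const_smul q.1)).add ((h hW').const_smul q.2)
  exact areaMap_congr (norm_normal_face hp) fun v hv =>
    fderivWithin_apply_eq hp h1.hasFDerivWithinAt hv

theorem continuous_areaMap_deformation (hW : ContDiff ℝ ∞ W) (hW' : ContDiff ℝ ∞ W') :
    Continuous fun z : (ℝ × ℝ) × (E3 × E3) => areaMap (ContinuousLinearMap.id ℝ E3 +
      z.1.1 • fderiv ℝ W z.2.1 + z.1.2 • fderiv ℝ W' z.2.1) z.2.2 := by
  have hcW : Continuous (fderiv ℝ W) := hW.continuous_fderiv (by simp)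
  have hcW' : Continuous (fderiv ℝ W') := hW'.continuous_fderiv (by simp)
  have h : Continuous fun z : (ℝ × ℝ) × (E3 × E3) => (ContinuousLinearMap.id ℝ E3 +
      z.1.1 • fderiv ℝ W z.2.1 + z.1.2 • fderiv ℝ W' z.2.1, z.2.2) := by fun_prop
  exact continuous_areaMap.comp h

/-- At parameter zero the area vector is the normal. The formula is jointly continuous in the
parameters and in the point-normal pair, which ranges over a compact set, so one neighbourhood of
zero serves all points. -/
theorem eventually_areaVector_ne_zero (hW : ContDiff ℝ ∞ W) (hW' : ContDiff ℝ ∞ W') :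
    ∀ᶠ q in 𝓝 (0 : ℝ × ℝ), ∀ j, ∀ p ∈ S.face j,
      S.areaVector (deformation W W' q) j p ≠ 0 := by
  rw [Filter.eventually_all]
  intro j
  have hK : IsCompact ((fun p => (p, S.normal j p)) '' closure (S.face j)) :=
    (S.isCompact_closure_face j).image_of_continuousOn
      (continuousOn_id.prodMk (S.normal_continuousOn j))
  have hev : ∀ x ∈ (fun p => (p, S.normal j p)) '' closure (S.face j),
      ∀ᶠ z : (ℝ × ℝ) × (E3 × E3) in 𝓝 (0, x), areaMap (ContinuousLinearMap.id ℝ E3 +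
        z.1.1 • fderiv ℝ W z.2.1 + z.1.2 • fderiv ℝ W' z.2.1) z.2.2 ≠ 0 := by
    rintro _ ⟨p, hp, rfl⟩
    refine (continuous_areaMap_deformation hW hW').continuousAt.eventually_ne ?_
    change areaMap (ContinuousLinearMap.id ℝ E3 + (0 : ℝ) • fderiv ℝ W p +
        (0 : ℝ) • fderiv ℝ W' p) (S.normal j p) ≠ 0
    rw [zero_smul ℝ (fderiv ℝ W p), zero_smul ℝ (fderiv ℝ W' p), add_zero, add_zero, areaMap_one]
    exact normal_ne_zero hp
  have key := hK.eventually_forall_of_forall_eventually (x₀ := (0 : ℝ × ℝ))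
    (P := fun q x => areaMap (ContinuousLinearMap.id ℝ E3 + q.1 • fderiv ℝ W x.1 +
      q.2 • fderiv ℝ W' x.1) x.2 ≠ 0) hev
  filter_upwards [key] with q hq p hp
  rw [areaVector_deformation hW hW' q hp]
  exact hq (p, S.normal j p) (mem_image_of_mem _ (subset_closure hp))

/-- Any smooth curve of parameters through zero gives a variation for short time. The predicate `P`
lets a further local condition, such as constancy of the volume, hold on the same interval. -/
theorem isVariation_deformation (hW : ContDiff ℝ ∞ W) (hW' : ContDiff ℝ ∞ W') {a b : ℝ → ℝ}
    (ha : ∀ᶠ ε in 𝓝 0, ContDiffAt ℝ ∞ a ε) (hb : ∀ᶠ ε in 𝓝 0, ContDiffAt ℝ ∞ b ε) (ha0 : a 0 = 0)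
    (hb0 : b 0 = 0) {P : ℝ → Prop} (hP : ∀ᶠ ε in 𝓝 0, P ε) :
    ∃ δ, S.IsVariation δ (fun ε => deformation W W' (a ε, b ε)) ∧ ∀ ε ∈ Ioo (-δ) δ, P ε := by
  have hab : Filter.Tendsto (fun ε => (a ε, b ε)) (𝓝 0) (𝓝 (0 : ℝ × ℝ)) := by
    have := ha.self_of_nhds.continuousAt.prodMk hb.self_of_nhds.continuousAt
    have h0 : ((0 : ℝ), (0 : ℝ)) = (a 0, b 0) := by rw [ha0, hb0]
    change Filter.Tendsto _ _ (𝓝 ((0 : ℝ), (0 : ℝ)))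
    rw [h0]
    exact this
  obtain ⟨δ, hδ, h⟩ := Metric.eventually_nhds_iff_ball.mp
    ((ha.and hb).and ((hab.eventually (eventually_areaVector_ne_zero (S := S) hW hW')).and hP))
  rw [Real.ball_eq_Ioo, zero_sub, zero_add] at h
  refine ⟨δ, ⟨hδ, fun p _ => by simp [deformation, ha0, hb0], fun j => ?_,
    fun ε hε j p hp => (h ε hε).2.1 j p hp⟩, fun ε hε => (h ε hε).2.2⟩
  rintro ⟨ε, p⟩ ⟨hε, -⟩
  have h1 : ContDiffAt ℝ ∞ (fun q : ℝ × E3 => a q.1) (ε, p) :=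
    ContDiffAt.comp (ε, p) (h ε hε).1.1 contDiffAt_fst
  have h2 : ContDiffAt ℝ ∞ (fun q : ℝ × E3 => b q.1) (ε, p) :=
    ContDiffAt.comp (ε, p) (h ε hε).1.2 contDiffAt_fst
  exact ((contDiffAt_snd.add (h1.smul (hW.contDiffAt.comp (ε, p) contDiffAt_snd))).add
    (h2.smul (hW'.contDiffAt.comp (ε, p) contDiffAt_snd))).contDiffWithinAt

theorem velocity_deformation {a b : ℝ → ℝ} {a' b' : ℝ} (ha : HasDerivAt a a' 0)
    (hb : HasDerivAt b b' 0) : velocity (fun ε => deformation W W' (a ε, b ε)) 0 =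
      fun p => a' • W p + b' • W' p := by
  ext1 p
  have h := (((hasDerivAt_const (0 : ℝ) p).add (ha.smul_const (W p))).add (hb.smul_const (W' p)))
  rw [zero_add] at h
  exact h.deriv

/-- The volume is a polynomial in the parameters of the deformation. -/
theorem contDiff_volume_deformation (hW : ContDiff ℝ ∞ W) (hW' : ContDiff ℝ ∞ W') :
    ContDiff ℝ ω (fun q => S.volume (deformation W W' q)) := by
  -- The deformation is the combination of `id`, `W`, `W'` with coefficients `1`, `q.1`, `q.2`,
  -- which makes the integrand a homogeneous cubic in `u`.
  set u : ℝ × ℝ → Fin 3 → ℝ := fun q => ![1, q.1, q.2] with hu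
  set F : Fin 3 → E3 → E3 := ![id, W, W'] with hF
  have hFs : ∀ k, ContDiff ℝ ∞ (F k) := by
    intro k; fin_cases k
    exacts [contDiff_id, hW, hW']
  have hus : ∀ k, ContDiff ℝ ω (fun q => u q k) := by
    intro k; fin_cases k
    exacts [contDiff_const, contDiff_fst, contDiff_snd]
  set I : Fin S.N → Fin 3 → Fin 3 → Fin 3 → E3 → ℝ := fun j i k l p =>
    ⟪F i p, areaForm (fderiv ℝ (F k) p) (fderiv ℝ (F l) p) (S.normal j p)⟫ with hI
  have hint : ∀ j i k l, IntegrableOn (I j i k l) (S.face j) μHE[2] := by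
    intro j i k l
    have hcd : ∀ k, Continuous (fderiv ℝ (F k)) := fun k => (hFs k).continuous_fderiv (by simp)
    have h2 : ContinuousOn (I j i k l) (closure (S.face j)) := by
      intro p hp
      have h3 : ContinuousWithinAt (fun p => areaForm (fderiv ℝ (F k) p) (fderiv ℝ (F l) p)
          (S.normal j p)) (closure (S.face j)) p :=
        ContinuousAt.comp_continuousWithinAt
          (g := fun q : (E3 →L[ℝ] E3) × (E3 →L[ℝ] E3) × E3 => areaForm q.1 q.2.1 q.2.2)
          (f := fun p => (fderiv ℝ (F k) p, fderiv ℝ (F l) p, S.normal j p))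
          continuous_areaForm.continuousAt ((hcd k).continuousWithinAt.prodMk
            ((hcd l).continuousWithinAt.prodMk (S.normal_continuousOn j p hp)))
      exact (hFs i).continuous.continuousWithinAt.inner (𝕜 := ℝ) h3
    obtain ⟨C, hC⟩ := (S.isCompact_closure_face j).exists_bound_of_continuousOn h2
    exact integrableOn_face (h2.mono subset_closure) fun p hp => hC p (subset_closure hp)
  have hvol : (fun q => S.volume (deformation W W' q)) = fun q => (1 / 3) * ∑ j, ∑ i, ∑ k, ∑ l,
      u q i * (u q k * u q l) * ∫ p in S.face j, I j i k l p ∂μHE[2] := by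
    ext1 q
    rw [PiecewiseSmoothSurface.volume]
    congr 1
    refine Finset.sum_congr rfl fun j _ => ?_
    have hpt : ∀ p ∈ S.face j, ⟪deformation W W' q p, S.areaVector (deformation W W' q) j p⟫ =
        ∑ i, ∑ k, ∑ l, u q i * (u q k * u q l) * I j i k l p := by
      intro p hp
      have e1 : deformation W W' q p = ∑ i, u q i • F i p := by
        simp [deformation, Fin.sum_univ_three, hu, hF]
      have e2 : ContinuousLinearMap.id ℝ E3 + q.1 • fderiv ℝ W p + q.2 • fderiv ℝ W' p =
          ∑ k, u q k • fderiv ℝ (F k) p := by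
        simp [Fin.sum_univ_three, hu, hF]
      rw [areaVector_deformation hW hW' q hp, e1, e2, areaMap_sum, sum_inner]
      simp only [inner_sum, inner_smul_left, inner_smul_right, hI]
      refine Finset.sum_congr rfl fun i _ => Finset.sum_congr rfl fun k _ =>
        Finset.sum_congr rfl fun l _ => ?_
      simp
      ring
    rw [setIntegral_congr_fun (S.measurableSet_face j) hpt]
    rw [integral_finsetSum _ fun i _ => integrable_finsetSum _ fun k _ =>
      integrable_finsetSum _ fun l _ => (hint j i k l).const_mul _]
    refine Finset.sum_congr rfl fun i _ => ?_
    rw [integral_finsetSum _ fun k _ => integrable_finsetSum _ fun l _ =>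
      (hint j i k l).const_mul _]
    refine Finset.sum_congr rfl fun k _ => ?_
    rw [integral_finsetSum _ fun l _ => (hint j i k l).const_mul _]
    exact Finset.sum_congr rfl fun l _ => integral_const_mul _ _
  rw [hvol]
  exact contDiff_const.mul (ContDiff.sum fun j _ => ContDiff.sum fun i _ => ContDiff.sum fun k _ =>
    ContDiff.sum fun l _ => ((hus i).mul ((hus k).mul (hus l))).mul contDiff_const)

theorem hasDerivAt_volume_deformation_snd (hW : ContDiff ℝ ∞ W) (hW' : ContDiff ℝ ∞ W') :
    HasDerivAt (fun τ : ℝ => S.volume (deformation W W' (0, τ))) (S.flux W') 0 := by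
  obtain ⟨δ, hX, -⟩ := isVariation_deformation (S := S) hW hW' (a := fun _ => 0) (b := id)
    (.of_forall fun _ => contDiffAt_const) (.of_forall fun _ => contDiffAt_id) rfl rfl
    (P := fun _ => True) (by simp)
  have h := hX.hasDerivAt_volume
  rw [velocity_deformation (hasDerivAt_const _ _) (hasDerivAt_id _)] at h
  simpa using h

/-- A one parameter family in the direction of `W`, corrected by `W'` so as to preserve the
volume. -/
theorem exists_volume_preserving (hW : ContDiff ℝ ∞ W) (hW' : ContDiff ℝ ∞ W')
    (hflux : S.flux W' ≠ 0) : ∃ (δ b : ℝ) (X : ℝ → E3 → E3), S.IsVariation δ X ∧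
      (∀ ε ∈ Ioo (-δ) δ, S.volume (X ε) = S.volume (X 0)) ∧
      velocity X 0 = fun p => (1 : ℝ) • W p + b • W' p := by
  set V : ℝ × ℝ → ℝ := fun q => S.volume (deformation W W' q) with hV
  have hVc : ContDiffAt ℝ ω V (0, 0) := (contDiff_volume_deformation hW hW').contDiffAt
  have hVd : HasFDerivAt V (fderiv ℝ V (0, 0)) (0, 0) :=
    (hVc.differentiableAt (by simp)).hasFDerivAt
  have hV2 : fderiv ℝ V (0, 0) (0, 1) = S.flux W' := by
    have h1 : HasDerivAt (fun τ : ℝ => V (0, τ)) (fderiv ℝ V (0, 0) (0, 1)) 0 :=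
      HasFDerivAt.comp_hasDerivAt (0 : ℝ) (f := fun τ : ℝ => ((0 : ℝ), τ)) hVd
        ((hasDerivAt_const (0 : ℝ) (0 : ℝ)).prodMk (hasDerivAt_id (0 : ℝ)))
    exact h1.unique (hasDerivAt_volume_deformation_snd hW hW')
  have hinv : (fderiv ℝ V (0, 0) ∘L .inr ℝ ℝ ℝ).IsInvertible := by
    refine ⟨ContinuousLinearEquiv.unitsEquivAut ℝ (Units.mk0 _ hflux), ?_⟩
    ext
    simp [hV2]
  set τ := hVc.implicitFunction (by simp) hinv with hτ
  have hτ0 : τ 0 = 0 := hVc.implicitFunction_apply_self (by simp) hinv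
  -- Analyticity at a point persists in a neighbourhood, unlike mere `C^∞` regularity at a point in
  -- the sense of `ContDiffAt`. For this reason the volume was shown to be of class `ω`.
  have hτc : ContDiffAt ℝ ω τ 0 := hVc.contDiffAt_implicitFunction (by simp) hinv
  have hτV : ∀ᶠ ε in 𝓝 (0 : ℝ), V (ε, τ ε) = V (0, 0) :=
    hVc.eventually_apply_implicitFunction (by simp) hinv
  obtain ⟨δ, hX, hP⟩ := isVariation_deformation (S := S) hW hW' (a := id) (b := τ)
    (.of_forall fun _ => contDiffAt_id)
    ((hτc.eventually (by simp)).mono fun _ h => h.of_le le_top) rfl hτ0 hτV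
  refine ⟨δ, deriv τ 0, _, hX, fun ε hε => ?_, velocity_deformation (hasDerivAt_id _)
    (hτc.differentiableAt (by simp)).hasDerivAt⟩
  have := hP ε hε
  simp only [hV] at this
  simp only [id, hτ0, this]

end PiecewiseSmoothSurface

end AnisotropicSurface

namespace AnisotropicSurface

namespace PiecewiseSmoothSurface

variable {S : PiecewiseSmoothSurface} {j : Fin S.N}

/-! ### Necessity of the equilibrium conditions -/

variable (S) in
/-- The linear functional which is minus the first variation of the energy. -/
def energyForm (γ : S2 → ℝ) (W : E3 → E3) : ℝ :=
  ∑ j, ∫ p in S.face j, S.anisotropicMeanCurvature γ j p * ⟪W p, S.normal j p⟫ ∂μHE[2] +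
    ∑ i, S.edgeWork i (S.cahnHoffman γ) W

theorem integral_linear {α : Type*} [MeasurableSpace α] {μ : Measure α} {f g h : α → ℝ} {a b : ℝ}
    (hf : Integrable f μ) (hg : Integrable g μ) (hh : ∀ x, h x = a * f x + b * g x) :
    ∫ x, h x ∂μ = a * ∫ x, f x ∂μ + b * ∫ x, g x ∂μ := by
  rw [integral_congr_ae (.of_forall hh), integral_add (hf.const_mul a) (hg.const_mul b),
    integral_const_mul, integral_const_mul]

theorem continuousOn_inner_normal {W : E3 → E3} (hW : Continuous W) :
    ContinuousOn (fun p => ⟪W p, S.normal j p⟫) (closure (S.face j)) :=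
  hW.continuousOn.inner (𝕜 := ℝ) (S.normal_continuousOn j)

theorem integrableOn_inner_normal {W : E3 → E3} (hW : Continuous W) :
    IntegrableOn (fun p => ⟪W p, S.normal j p⟫) (S.face j) μHE[2] := by
  obtain ⟨C, hC⟩ := (S.isCompact_closure_face j).exists_bound_of_continuousOn
    (continuousOn_inner_normal hW)
  exact integrableOn_face ((continuousOn_inner_normal hW).mono subset_closure)
    fun p hp => hC p (subset_closure hp)

theorem flux_linear {W W' : E3 → E3} (hW : Continuous W) (hW' : Continuous W') (a b : ℝ) :
    S.flux (fun p => a • W p + b • W' p) = a * S.flux W + b * S.flux W' := by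
  simp only [flux, Finset.mul_sum]
  rw [← Finset.sum_add_distrib]
  refine Finset.sum_congr rfl fun j _ => ?_
  exact integral_linear (integrableOn_inner_normal hW) (integrableOn_inner_normal hW') fun p => by
    rw [inner_add_left, inner_smul_left, inner_smul_left]; rfl

variable {γ : S2 → ℝ} (hγ' : ContMDiff (𝓡 2) 𝓘(ℝ, ℝ) 3 γ)

variable (S) in
/-- The unbalanced force along an edge. -/
def edgeForce (γ : S2 → ℝ) (i : Fin S.L) (t : ℝ) : E3 :=
  cross (S.cahnHoffman γ (S.left i) (S.edge i t) - S.cahnHoffman γ (S.right i) (S.edge i t))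
    (S.edgeTangent i t)

include hγ'

theorem continuousOn_edgeForce (i : Fin S.L) : ContinuousOn (S.edgeForce γ i) (Icc 0 1) := by
  have h : ∀ j, S.left i = j ∨ S.right i = j →
      ContinuousOn (fun t => S.cahnHoffman γ j (S.edge i t)) (Icc 0 1) := fun j hj =>
    (isFaceField_cahnHoffman hγ').continuousOn_edge hj
  have h1 := ((h _ (.inl rfl)).sub (h _ (.inr rfl))).prodMk (continuousOn_edgeTangent i)
  exact (crossL.continuous₂.comp_continuousOn h1 :)

theorem integrableOn_edgeForce {W : E3 → E3} (hW : Continuous W) (i : Fin S.L) :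
    IntegrableOn (fun t => ⟪W (S.edge i t), S.edgeForce γ i t⟫) (Ioo 0 1) := by
  have h1 : ContinuousOn (fun t => W (S.edge i t)) (Icc 0 1) :=
    hW.comp_continuousOn (S.edge_contDiffOn i).continuousOn
  exact ((h1.inner (𝕜 := ℝ) (continuousOn_edgeForce hγ' i)).integrableOn_Icc).mono_set
    Ioo_subset_Icc_self

theorem integrableOn_curvature_mul {W : E3 → E3} (hW : ContDiff ℝ ∞ W) :
    IntegrableOn (fun p => S.anisotropicMeanCurvature γ j p * ⟪W p, S.normal j p⟫) (S.face j)
      μHE[2] := by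
  have h := (integrableOn_surfaceDiv_mul (S := S) (j := j) (isFaceField_cahnHoffman hγ')
    (isFaceField_of_contDiff hW)).neg
  refine h.congr (.of_forall fun p => ?_)
  simp [anisotropicMeanCurvature]

theorem energyForm_linear {W W' : E3 → E3} (hW : ContDiff ℝ ∞ W) (hW' : ContDiff ℝ ∞ W')
    (a b : ℝ) : S.energyForm γ (fun p => a • W p + b • W' p) =
      a * S.energyForm γ W + b * S.energyForm γ W' := by
  have h1 : ∀ j, ∫ p in S.face j, S.anisotropicMeanCurvature γ j p *
      ⟪a • W p + b • W' p, S.normal j p⟫ ∂μHE[2] =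
      a * ∫ p in S.face j, S.anisotropicMeanCurvature γ j p * ⟪W p, S.normal j p⟫ ∂μHE[2] +
      b * ∫ p in S.face j, S.anisotropicMeanCurvature γ j p * ⟪W' p, S.normal j p⟫ ∂μHE[2] :=
    fun j => integral_linear (integrableOn_curvature_mul hγ' hW)
      (integrableOn_curvature_mul hγ' hW') fun p => by
        rw [inner_add_left, inner_smul_left, inner_smul_left]
        simp
        ring
  have h2 : ∀ i, S.edgeWork i (S.cahnHoffman γ) (fun p => a • W p + b • W' p) =
      a * S.edgeWork i (S.cahnHoffman γ) W + b * S.edgeWork i (S.cahnHoffman γ) W' := fun i =>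
    integral_linear (integrableOn_edgeForce hγ' hW.continuous i)
      (integrableOn_edgeForce hγ' hW'.continuous i) fun t => by
        rw [inner_add_left, inner_smul_left, inner_smul_left]; rfl
  simp only [energyForm, h1, h2, Finset.sum_add_distrib, ← Finset.mul_sum]
  ring

/-- The Lagrange multiplier rule. -/
theorem IsEquilibrium.energyForm_mul_flux (h : S.IsEquilibrium γ) {W W' : E3 → E3}
    (hW : ContDiff ℝ ∞ W) (hW' : ContDiff ℝ ∞ W') (hflux : S.flux W' ≠ 0) :
    S.energyForm γ W * S.flux W' = S.energyForm γ W' * S.flux W := by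
  obtain ⟨δ, b, X, hX, hvol, hvel⟩ := exists_volume_preserving hW hW' hflux
  have h1 : S.flux W + b * S.flux W' = 0 := by
    have h2 : HasDerivAt (fun ε => S.volume (X ε)) 0 0 := by
      refine (hasDerivAt_const (0 : ℝ) (S.volume (X 0))).congr_of_eventuallyEq ?_
      filter_upwards [isOpen_Ioo.mem_nhds (show (0 : ℝ) ∈ Ioo (-δ) δ from
        ⟨by linarith [hX.pos], hX.pos⟩)] with ε hε
      exact hvol ε hε
    have h3 := hX.hasDerivAt_volume.unique h2
    rwa [hvel, flux_linear hW.continuous hW'.continuous, one_mul] at h3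
  have h2 : S.energyForm γ W + b * S.energyForm γ W' = 0 := by
    have h3 := (hX.hasDerivAt_energy' hγ').unique (h δ X hX hvol)
    have h4 : S.energyForm γ (velocity X 0) = 0 := by
      rw [energyForm]; linarith
    rwa [hvel, energyForm_linear hγ' hW hW', one_mul] at h4
  -- The unknown velocity `b` of the correction is eliminated between the two linear relations.
  linear_combination S.flux W' * h2 - S.energyForm γ W' * h1

omit hγ' in
/-- A localized test field on a face. -/
theorem exists_bump_face {f : E3 → ℝ} (hf : ContinuousOn f (S.face j)) {p₀ : E3}
    (hp₀ : p₀ ∈ S.face j) (hne : f p₀ ≠ 0) : ∃ W : E3 → E3, ContDiff ℝ ∞ W ∧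
      (∀ k ≠ j, ∀ p ∈ S.face k, W p = 0) ∧ (∀ i, ∀ t ∈ Icc (0 : ℝ) 1, W (S.edge i t) = 0) ∧
      0 < ∫ p in S.face j, f p * ⟪W p, S.normal j p⟫ ∂μHE[2] := by
  -- The test direction is `f p₀ • ν(p₀)`, so that the integrand without cutoff equals `f p₀ ^ 2` at
  -- `p₀` and stays positive nearby.
  set h : E3 → ℝ := fun p => f p * ⟪f p₀ • S.normal j p₀, S.normal j p⟫ with hh
  have hhc : ContinuousOn h (S.face j) := hf.mul
    (continuousOn_const.inner (𝕜 := ℝ) ((S.normal_continuousOn j).mono subset_closure))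
  have hh0 : h p₀ = f p₀ ^ 2 := by
    rw [hh]
    simp only
    rw [inner_smul_left, real_inner_self_eq_norm_sq, norm_normal_face hp₀]
    simp
    ring
  have hpos : 0 < h p₀ := by rw [hh0]; positivity
  obtain ⟨U, hU, hUj⟩ := S.exists_isOpen_face j
  have hpU : p₀ ∈ U := by rw [hUj] at hp₀; exact hp₀.1
  have hnear : ∀ᶠ x in 𝓝 p₀, x ∈ S.face j → h p₀ / 2 < h x ∧ h x < 2 * h p₀ := by
    rw [← eventually_nhdsWithin_iff]
    exact (hhc p₀ hp₀).eventually ((lt_mem_nhds (by linarith)).and (gt_mem_nhds (by linarith)))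
  obtain ⟨r, hr, hball⟩ := Metric.eventually_nhds_iff_ball.mp (hnear.and (hU.mem_nhds hpU))
  set χ : ContDiffBump p₀ := ⟨r / 2, r, half_pos hr, half_lt_self hr⟩ with hχ
  have hχ0 : ∀ x, x ∉ Metric.ball p₀ r → χ x = 0 := fun x hx =>
    χ.zero_of_le_dist (not_lt.mp hx)
  -- The support is confined to an open set in which the surface is the face `j`; the field is zero
  -- on all other faces and on all edges.
  have hout : ∀ x ∈ S.carrier, x ∉ S.face j → χ x = 0 := by
    intro x hx hxj
    refine hχ0 x fun hb => hxj ?_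
    rw [hUj]
    exact ⟨(hball x hb).2, hx⟩
  refine ⟨fun x => χ x • f p₀ • S.normal j p₀, χ.contDiff.smul contDiff_const, ?_, ?_, ?_⟩
  · intro k hk p hp
    change χ p • _ = 0
    rw [hout p (S.face_subset k hp) fun hpj => (S.face_disjoint hk).ne_of_mem hp hpj rfl, zero_smul]
  · intro i t ht
    have he := mem_image_of_mem (S.edge i) ht
    change χ (S.edge i t) • _ = 0
    rw [hout _ (S.edge_subset i he) fun hj => (S.face_edge_disjoint j i).ne_of_mem hj he rfl,
      zero_smul]
  · have heq : ∀ p, f p * ⟪χ p • f p₀ • S.normal j p₀, S.normal j p⟫ = χ p * h p := by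
      intro p
      rw [inner_smul_left, hh]
      simp
      ring
    simp only [heq]
    have hnonneg : ∀ p ∈ S.face j, 0 ≤ χ p * h p := by
      intro p hp
      by_cases hb : p ∈ Metric.ball p₀ r
      · have := ((hball p hb).1 hp).1
        exact mul_nonneg χ.nonneg (by linarith)
      · rw [hχ0 p hb, zero_mul]
    have hint : IntegrableOn (fun p => χ p * h p) (S.face j) μHE[2] := by
      refine integrableOn_face (C := 2 * h p₀) (χ.continuous.continuousOn.mul hhc) fun p hp => ?_
      rw [abs_of_nonneg (hnonneg p hp)]
      by_cases hb : p ∈ Metric.ball p₀ r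
      · obtain ⟨h1, h2⟩ := (hball p hb).1 hp
        have h3 : χ p ≤ 1 := χ.le_one
        have h4 : 0 ≤ χ p := χ.nonneg
        nlinarith
      · rw [hχ0 p hb, zero_mul]; linarith
    rw [setIntegral_pos_iff_support_of_nonneg_ae ((ae_restrict_iff' (S.measurableSet_face j)).mpr
      (.of_forall hnonneg)) hint]
    refine (measure_face_inter_ball_pos hp₀ (half_pos hr)).trans_le (measure_mono ?_)
    rintro x ⟨hx, hxb⟩
    refine ⟨?_, hx⟩
    have h1 : χ x = 1 := χ.one_of_mem_closedBall (Metric.ball_subset_closedBall hxb)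
    have h2 := ((hball x (Metric.ball_subset_ball (half_le_self hr.le) hxb)).1 hx).1
    rw [Function.mem_support, h1, one_mul]
    linarith

omit hγ' in
theorem edgeWork_eq_zero {W : E3 → E3} {i : Fin S.L}
    (hW : ∀ t ∈ Ioo (0 : ℝ) 1, W (S.edge i t) = 0) : S.edgeWork i (S.cahnHoffman γ) W = 0 :=
  setIntegral_eq_zero_of_forall_eq_zero fun t ht => by rw [hW t ht, inner_zero_left]

omit hγ' in
theorem exists_flux_ne_zero {p₀ : E3} (hp₀ : p₀ ∈ S.face j) :
    ∃ W : E3 → E3, ContDiff ℝ ∞ W ∧ S.flux W ≠ 0 := by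
  obtain ⟨W, hW, h1, -, h3⟩ := exists_bump_face (f := fun _ => 1) continuousOn_const hp₀ one_ne_zero
  refine ⟨W, hW, ?_⟩
  rw [flux, Finset.sum_eq_single j]
  · simpa using h3.ne'
  · intro k _ hk
    exact setIntegral_eq_zero_of_forall_eq_zero fun p hp => by rw [h1 k hk p hp, inner_zero_left]
  · simp

theorem continuousOn_curvature : ContinuousOn (S.anisotropicMeanCurvature γ j) (S.face j) :=
  (isFaceField_cahnHoffman hγ').continuousOn_surfaceDiv.neg

omit hγ' in
/-- A part of an edge which is mapped close to one of its points is close in the parameter. -/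
theorem _root_.ContinuousOn.exists_ball_preimage_subset {α β : Type*} [TopologicalSpace α]
    [MetricSpace β] {f : α → β} {K N : Set α} (hf : ContinuousOn f K) (hK : IsCompact K) {x : α}
    (hN : N ∈ 𝓝[K] x) (hinj : ∀ y ∈ K, f y = f x → y = x) :
    ∀ᶠ z in 𝓝 (f x), ∀ y ∈ K, f y = z → y ∈ N := by
  obtain ⟨O, hO, hxO, hON⟩ := mem_nhdsWithin.mp hN
  have hc : IsCompact (f '' (K \ O)) :=
    (hK.diff hO).image_of_continuousOn (hf.mono sdiff_subset)
  have hx : f x ∉ f '' (K \ O) := by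
    rintro ⟨y, hy, hyx⟩
    exact hy.2 (hinj y hy.1 hyx ▸ hxO)
  filter_upwards [hc.isClosed.isOpen_compl.mem_nhds hx] with z hz y hy hyz
  by_contra hyN
  exact hz ⟨y, ⟨hy, fun hyO => hyN (hON ⟨hyO, hy⟩)⟩, hyz⟩

/-- A localized test field on an edge. -/
theorem exists_bump_edge {i : Fin S.L} {t₀ : ℝ} (ht₀ : t₀ ∈ Ioo (0 : ℝ) 1)
    (hne : S.edgeForce γ i t₀ ≠ 0) : ∃ W : E3 → E3, ContDiff ℝ ∞ W ∧
      (∀ k ≠ i, ∀ t ∈ Ioo (0 : ℝ) 1, W (S.edge k t) = 0) ∧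
      0 < S.edgeWork i (S.cahnHoffman γ) W := by
  set h : ℝ → ℝ := fun t => ⟪S.edgeForce γ i t₀, S.edgeForce γ i t⟫ with hh
  have hhc : ContinuousOn h (Icc 0 1) :=
    continuousOn_const.inner (𝕜 := ℝ) (continuousOn_edgeForce hγ' i)
  have hpos : 0 < h t₀ := by
    rw [hh]
    exact real_inner_self_pos.mpr hne
  have ht₀' := Ioo_subset_Icc_self ht₀
  have hedge := (S.edge_contDiffOn i).continuousOn
  have hinj : ∀ t ∈ Icc (0 : ℝ) 1, S.edge i t = S.edge i t₀ → t = t₀ := by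
    intro t ht htt
    by_cases ht' : t ∈ Ioo (0 : ℝ) 1
    · exact S.edge_injOn i ht' ht₀ htt
    · refine absurd htt.symm (vertices_notMem_edge (v := S.edge i t) ⟨i, t, ?_, rfl⟩ ht₀)
      rw [← Icc_sdiff_Ioo_same zero_le_one]
      exact ⟨ht, ht'⟩
  -- A small ball in space contains no points of the edge with parameters far from `t₀`, so the
  -- integrand is positive wherever the bump meets the edge.
  have hnear := hedge.exists_ball_preimage_subset isCompact_Icc
    ((hhc t₀ ht₀').eventually (lt_mem_nhds hpos)) hinj
  obtain ⟨r, hr, hball⟩ := Metric.eventually_nhds_iff_ball.mp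
    (hnear.and (exists_nhds_edgeIntegral_eq_zero ht₀))
  set χ : ContDiffBump (S.edge i t₀) := ⟨r / 2, r, half_pos hr, half_lt_self hr⟩ with hχ
  have hχ0 : ∀ x, x ∉ Metric.ball (S.edge i t₀) r → χ x = 0 := fun x hx =>
    χ.zero_of_le_dist (not_lt.mp hx)
  have hW : ContDiff ℝ ∞ (fun x => χ x • S.edgeForce γ i t₀) := χ.contDiff.smul contDiff_const
  refine ⟨_, hW, ?_, ?_⟩
  · intro k hk t ht
    rw [hχ0 _ fun hb => (hball _ hb).2 k hk (mem_image_of_mem _ (Ioo_subset_Icc_self ht)),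
      zero_smul]
  · have heq : ∀ t, ⟪χ (S.edge i t) • S.edgeForce γ i t₀, S.edgeForce γ i t⟫ =
        χ (S.edge i t) * h t := fun t => by rw [inner_smul_left]; rfl
    have hnonneg : ∀ t ∈ Ioo (0 : ℝ) 1, 0 ≤ χ (S.edge i t) * h t := by
      intro t ht
      by_cases hb : S.edge i t ∈ Metric.ball (S.edge i t₀) r
      · exact mul_nonneg χ.nonneg (le_of_lt ((hball _ hb).1 t (Ioo_subset_Icc_self ht) rfl))
      · rw [hχ0 _ hb, zero_mul]
    have hint := integrableOn_edgeForce hγ' hW.continuous i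
    change 0 < ∫ t in Ioo (0 : ℝ) 1, ⟪χ (S.edge i t) • S.edgeForce γ i t₀, S.edgeForce γ i t⟫
    simp only [heq] at hint ⊢
    rw [setIntegral_pos_iff_support_of_nonneg_ae ((ae_restrict_iff' measurableSet_Ioo).mpr
      (.of_forall hnonneg)) hint]
    have hO : IsOpen (Ioo (0 : ℝ) 1 ∩ S.edge i ⁻¹' Metric.ball (S.edge i t₀) (r / 2)) :=
      (hedge.mono Ioo_subset_Icc_self).isOpen_inter_preimage isOpen_Ioo Metric.isOpen_ball
    refine (hO.measure_pos MeasureTheory.volume ⟨t₀, ht₀,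
      Metric.mem_ball_self (half_pos hr)⟩).trans_le (measure_mono ?_)
    rintro t ⟨ht, htb⟩
    refine ⟨?_, ht⟩
    have h1 : χ (S.edge i t) = 1 := χ.one_of_mem_closedBall (Metric.ball_subset_closedBall htb)
    have h2 : 0 < h t := (hball _ (Metric.ball_subset_ball (half_le_self hr.le) htb)).1 t
      (Ioo_subset_Icc_self ht) rfl
    rw [Function.mem_support, h1, one_mul]
    exact h2.ne'

theorem IsEquilibrium.exists_multiplier (h : S.IsEquilibrium γ) {p₀ : E3} (hp₀ : p₀ ∈ S.face j) :
    ∃ c : ℝ, ∀ W, ContDiff ℝ ∞ W → S.energyForm γ W = c * S.flux W := by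
  obtain ⟨W', hW', hflux⟩ := exists_flux_ne_zero hp₀
  refine ⟨S.energyForm γ W' / S.flux W', fun W hW => ?_⟩
  have := h.energyForm_mul_flux hγ' hW hW' hflux
  field_simp
  exact this

theorem curvature_eq_of_multiplier {c : ℝ}
    (hc : ∀ W, ContDiff ℝ ∞ W → S.energyForm γ W = c * S.flux W) {p : E3} (hp : p ∈ S.face j) :
    S.anisotropicMeanCurvature γ j p = c := by
  by_contra hne
  obtain ⟨W, hW, h1, h2, h3⟩ := exists_bump_face
    (f := fun p => S.anisotropicMeanCurvature γ j p - c)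
    ((continuousOn_curvature hγ').sub continuousOn_const) hp (sub_ne_zero.mpr hne)
  have h4 := hc W hW
  rw [energyForm, Finset.sum_eq_zero fun i _ => edgeWork_eq_zero fun t ht =>
    h2 i t (Ioo_subset_Icc_self ht), add_zero, flux, Finset.sum_eq_single j, Finset.sum_eq_single j]
    at h4
  · have h5 : ∫ p in S.face j, (S.anisotropicMeanCurvature γ j p - c) * ⟪W p, S.normal j p⟫
        ∂μHE[2] = 0 := by
      rw [integral_linear (a := 1) (b := -c) (integrableOn_curvature_mul hγ' hW)
        (integrableOn_inner_normal hW.continuous) fun p => by ring]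
      linarith
    exact h3.ne' h5
  · intro k _ hk
    exact setIntegral_eq_zero_of_forall_eq_zero fun p hp => by rw [h1 k hk p hp, inner_zero_left]
  · simp
  · intro k _ hk
    exact setIntegral_eq_zero_of_forall_eq_zero fun p hp => by
      rw [h1 k hk p hp, inner_zero_left, mul_zero]
  · simp

/-- A bump field at an edge also acts on the adjacent faces. There `Λ = c` is already known, so its
face terms equal `c * flux` and cancel, leaving the edge work alone. -/
theorem forceBalance_of_multiplier {c : ℝ}
    (hc : ∀ W, ContDiff ℝ ∞ W → S.energyForm γ W = c * S.flux W) : S.ForceBalance γ := by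
  intro i
  have hio : ∀ t ∈ Ioo (0 : ℝ) 1, S.edgeForce γ i t = 0 := by
    intro t ht
    by_contra hne
    obtain ⟨W, hW, h1, h2⟩ := exists_bump_edge hγ' ht hne
    have h3 := hc W hW
    have h4 : ∀ j, ∫ p in S.face j, S.anisotropicMeanCurvature γ j p * ⟪W p, S.normal j p⟫
        ∂μHE[2] = c * ∫ p in S.face j, ⟪W p, S.normal j p⟫ ∂μHE[2] := by
      intro j
      rw [← integral_const_mul]
      exact setIntegral_congr_fun (S.measurableSet_face j) fun p hp => by
        simp only [curvature_eq_of_multiplier hγ' hc hp]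
    rw [energyForm, Finset.sum_congr rfl fun j _ => h4 j, ← Finset.mul_sum, ← flux,
      Finset.sum_eq_single i (fun k _ hk => edgeWork_eq_zero (h1 k hk)) (by simp)] at h3
    linarith
  -- The force is continuous on the closed interval, so it vanishes at the end points too.
  intro t ht
  have hcl : t ∈ closure (Ioo (0 : ℝ) 1) := by rwa [closure_Ioo zero_ne_one]
  have := (((continuousOn_edgeForce hγ' i) t ht).mono Ioo_subset_Icc_self).mem_closure hcl
    (t := {0}) hio
  rw [closure_singleton] at this
  exact this

/-- Two continuous fields that agree on a face agree on its closure. Both one-sided limits at an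
edge point are thus the value of the extension, and the jump is zero. -/
theorem forceBalance_of_extends (h : S.CahnHoffmanExtends γ) : S.ForceBalance γ := by
  obtain ⟨ξ, hξ, hξj⟩ := h
  intro i t ht
  have key : ∀ j, S.left i = j ∨ S.right i = j →
      ξ (S.edge i t) = S.cahnHoffman γ j (S.edge i t) := by
    intro j hj
    have heq : EqOn ξ (S.cahnHoffman γ j) (closure (S.face j)) :=
      EqOn.of_subset_closure (fun p hp => hξj j p hp) (hξ.mono (S.closure_face_subset j))
        (contDiffOn_cahnHoffman hγ').continuousOn subset_closure subset_rfl
    exact heq (edge_mem_closure hj ht)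
  rw [← key _ (.inl rfl), ← key _ (.inr rfl), sub_self, cross_zero_left]

theorem IsEquilibrium.curvature_and_forceBalance (h : S.IsEquilibrium γ) :
    (∃ c : ℝ, ∀ j, ∀ p ∈ S.face j, S.anisotropicMeanCurvature γ j p = c) ∧ S.ForceBalance γ := by
  by_cases hne : ∃ j, (S.face j).Nonempty
  · obtain ⟨j, p₀, hp₀⟩ := hne
    obtain ⟨c, hc⟩ := h.exists_multiplier hγ' hp₀
    exact ⟨⟨c, fun j p hp => curvature_eq_of_multiplier hγ' hc hp⟩,
      forceBalance_of_multiplier hγ' hc⟩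
  -- Without points in any face there is no field of nonzero flux. The curvature condition is then
  -- empty, and so is the force balance, since edges lie in closures of faces.
  · push Not at hne
    refine ⟨⟨0, fun j p hp => ?_⟩, fun i t ht => ?_⟩
    · rw [hne j] at hp
      exact hp.elim
    · have := edge_mem_closure (j := S.left i) (.inl rfl) ht
      rw [hne, closure_empty] at this
      exact this.elim

end PiecewiseSmoothSurface

end AnisotropicSurface

end

theorem mainTheorem2 (γ : AnisotropicSurface.S2 → ℝ) (hγ : ∀ n, 0 < γ n)
    (hγ' : ContMDiff (𝓡 2) 𝓘(ℝ, ℝ) 3 γ) (S : AnisotropicSurface.PiecewiseSmoothSurface) :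
    (S.IsEquilibrium γ ↔
      (∃ c : ℝ, ∀ j, ∀ p ∈ S.face j, S.anisotropicMeanCurvature γ j p = c) ∧
        S.ForceBalance γ) ∧
    (S.CahnHoffmanExtends γ → S.ForceBalance γ) :=
  ⟨⟨fun h => h.curvature_and_forceBalance hγ', fun ⟨⟨_, hc⟩, hF⟩ =>
    AnisotropicSurface.PiecewiseSmoothSurface.isEquilibrium_of_forceBalance hγ' hc hF⟩,
    AnisotropicSurface.PiecewiseSmoothSurface.forceBalance_of_extends hγ'⟩
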